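/- **Theorem (Gaussian DP-KDE in low dimensions).** For a finite dataset $X$ (a finite sequence of $n=|X|$ points of $\mathbb R^d$, repetitions allowed) let $KDE_X(y)=\frac1n\sum_{x\in X}e^{-\|x-y\|_2^2}$. Two datasets are neighboring if, up to order, one arises from the other by omitting one point. A function release mechanism consists of a randomized *curator* algorithm, which maps $X$ to a released message $M(X)$ (a finite sequence of real machine words), and a deterministic *client* algorithm, which maps a released message and a query $y\in\mathbb R^d$ to an answer $\hat e(y)\in[0,1]$; both know the public parameters $d,\epsilon,\alpha,\eta,\Phi$ and the center of the ball below. It is $\epsilon$-DP on a class of datasets if $\Pr[M(X)\in O]\le e^{\epsilon}\Pr[M(X')\in O]$ for all neighboring $X,X'$ in the class and all measurable $O$. It gives an $(\alpha,\eta)$-approximation for $X$ if $\Pr[|\hat e(y)-KDE_X(y)|\le\alpha]\ge1-\eta$ for every $y\in\mathbb R^d$. Time is the number of steps of a real RAM: memory words hold real numbers, and arithmetic operations, floor, $\exp$, $\log$, square root, $\sin$, $\cos$, comparisons, memory accesses, and drawing an independent sample that is uniform on $[0,1]$, standard normal, or Laplace with scale $1$, cost one step each. Let $\alpha_0<1/e$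 and $\eta_0<1$. There are a curator program, a client program and a constant $C\in\mathbb N$ such that for all $d\ge1$, $\epsilon>0$, $\alpha\in(0,\alpha_0]$, $\eta\in(0,\eta_0]$, $\Phi>0$ and every closed Euclidean ball $B\subset\mathbb R^d$ of radius $\Phi$ the following holds. The curator halts on every dataset contained in $B$, and the mechanism is $\epsilon$-DP on the class of all datasets (of any size) contained in $B$. For every dataset $X\subset B$ of size $$n\ \ge\ \frac{\log(1/\eta)\,(\log(1/\alpha))^{Cd}}{\epsilon\,\alpha}$$ the mechanism gives an $(\alpha,\eta)$-approximation for $X$, and, for every outcome of the randomness, * the curator runs in time at most $\bigl(nd+(\Phi/\sqrt d)^d\bigr)\,(C\log(1/\alpha))^{Cd}\,\log(1/\eta)$; * the message has at most $\bigl(C\,(1+\Phi/\sqrt d)\,\log(1/\alpha)\bigr)^d\,\log(1/\eta)$ words; * the client answers every query $y\in\mathbb R^d$ in time at most $(\log(1/\alpha))^{Cd}\,\log(1/\eta)$. -/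

import Mathlib

namespace DPKDE

open MeasureTheory ProbabilityTheory

noncomputable section

/-! ### Kernel density estimation, datasets, neighbouring datasets -/

/-- Points of `ℝ^d` with the Euclidean norm. -/
abbrev Pt (d : ℕ) : Type := EuclideanSpace ℝ (Fin d)

/-- The Gaussian kernel with bandwidth `1`. -/
def gaussianKernel {d : ℕ} (x y : Pt d) : ℝ := Real.exp (-‖x - y‖ ^ 2)

/-- The Gaussian kernel density estimate of the dataset `X` (a finite sequence of points). -/
def kde {d : ℕ} (X : List (Pt d)) (y : Pt d) : ℝ :=
  (X.map fun x => gaussianKernel x y).sum / X.length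

/-- Two datasets are neighbouring if omitting a single data point from one of them yields the
other; the order in which the points are listed is irrelevant. -/
def Neighboring {d : ℕ} (X Y : List (Pt d)) : Prop :=
  ∃ x : Pt d, X.Perm (x :: Y) ∨ Y.Perm (x :: X)

/-- All points of the dataset lie in the closed ball of radius `Φ` around `c`. -/
def InBall {d : ℕ} (c : Pt d) (Φ : ℝ) (X : List (Pt d)) : Prop :=
  ∀ x ∈ X, x ∈ Metric.closedBall c Φ

/-! ### Randomness: independent samples from three standard distributions -/

/-- The distributions from which a machine can draw a fresh sample in one step. -/
inductive Source where
  | uniform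
  | normal
  | laplace

/-- The Laplace distribution with scale `1`: density `exp (-|x|) / 2`. -/
def laplaceMeasure : Measure ℝ :=
  volume.withDensity fun x => ENNReal.ofReal (Real.exp (-|x|) / 2)

/-- Uniform on `[0,1]`, standard normal, and Laplace with scale `1`. -/
def Source.law : Source → Measure ℝ
  | .uniform => volume.restrict (Set.Icc 0 1)
  | .normal => gaussianReal 0 1
  | .laplace => laplaceMeasure

theorem integral_laplace : ∫ x : ℝ, Real.exp (-|x|) / 2 = 1 := by
  rw [integral_div, integral_comp_abs (f := fun x => Real.exp (-x)), integral_exp_neg_Ioi_zero]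
  norm_num

instance : IsProbabilityMeasure laplaceMeasure := by
  constructor
  have hi : Integrable fun x : ℝ => Real.exp (-|x|) / 2 := by
    by_contra h
    have h0 := integral_undef h
    rw [integral_laplace] at h0
    exact one_ne_zero h0
  rw [laplaceMeasure, withDensity_apply _ MeasurableSet.univ, Measure.restrict_univ,
    ← ofReal_integral_eq_lintegral_ofReal hi (Filter.Eventually.of_forall fun x => by positivity),
    integral_laplace, ENNReal.ofReal_one]

instance (s : Source) : IsProbabilityMeasure s.law := by
  cases s
  · exact ⟨by simp [Source.law]⟩
  · exact inferInstanceAs (IsProbabilityMeasure (gaussianReal 0 1))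
  · exact inferInstanceAs (IsProbabilityMeasure laplaceMeasure)

/-- A random tape: `ω (k, s)` is the value returned by the `k`-th sampling instruction of a run,
if that instruction samples from the source `s`. -/
abbrev Tape : Type := ℕ × Source → ℝ

/-- All entries of the random tape are independent, with the laws prescribed by their sources. -/
def tapeMeasure : Measure Tape := Measure.infinitePi fun i : ℕ × Source => i.2.law

/-! ### The machine model: a real RAM with a step count

Memory consists of arrays of real words, addressed by the number of the array (fixed in the program
text) and an index (computed at run time).  Every arithmetic operation, every evaluation of an
elementary function, every memory access, every comparison and every sample costs one step. -/

inductive UnOp where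
  | neg | floor | exp | log | sqrt | cos | sin

inductive BinOp where
  | add | sub | mul | div

def UnOp.eval : UnOp → ℝ → ℝ
  | .neg, x => -x
  | .floor, x => (⌊x⌋ : ℤ)
  | .exp, x => Real.exp x
  | .log, x => Real.log x
  | .sqrt, x => Real.sqrt x
  | .cos, x => Real.cos x
  | .sin, x => Real.sin x

def BinOp.eval : BinOp → ℝ → ℝ → ℝ
  | .add, x, y => x + y
  | .sub, x, y => x - y
  | .mul, x, y => x * y
  | .div, x, y => x / y

/-- Expressions; `read a i` is the word at index `i` of array `a`. -/
inductive Expr where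
  | const (q : ℚ)
  | read (a : ℕ) (i : Expr)
  | un (op : UnOp) (e : Expr)
  | bin (op : BinOp) (e₁ e₂ : Expr)

/-- Contents of the memory: word `mem a i` at index `i` of array `a`. -/
abbrev Mem : Type := ℕ → ℕ → ℝ

/-- Value of an expression. An index that is not a natural number is rounded down
(and negative indices are read as `0`). -/
def Expr.eval (m : Mem) : Expr → ℝ
  | .const q => (q : ℝ)
  | .read a i => m a ⌊i.eval m⌋₊
  | .un op e => op.eval (e.eval m)
  | .bin op e₁ e₂ => op.eval (e₁.eval m) (e₂.eval m)

/-- Number of steps needed to evaluate an expression. -/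
def Expr.cost : Expr → ℕ
  | .const _ => 1
  | .read _ i => i.cost + 1
  | .un _ e => e.cost + 1
  | .bin _ e₁ e₂ => e₁.cost + e₂.cost + 1

/-- Programs. `assign a i e` stores the value of `e` at index `i` of array `a`; `sample a i s` stores
there a fresh sample from `s`; the tests of `ite` and `loop` are `e₁ ≤ e₂`. -/
inductive Cmd where
  | skip
  | assign (a : ℕ) (i e : Expr)
  | sample (a : ℕ) (i : Expr) (s : Source)
  | seq (p q : Cmd)
  | ite (e₁ e₂ : Expr) (p q : Cmd)
  | loop (e₁ e₂ : Expr) (p : Cmd)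

/-- Programs without sampling instructions, i.e. deterministic ones. -/
def Cmd.SampleFree : Cmd → Prop
  | .skip => True
  | .assign _ _ _ => True
  | .sample _ _ _ => False
  | .seq p q => p.SampleFree ∧ q.SampleFree
  | .ite _ _ p q => p.SampleFree ∧ q.SampleFree
  | .loop _ _ p => p.SampleFree

/-- A configuration: the memory, and the number of samples drawn so far. -/
structure State where
  mem : Mem
  pos : ℕ

/-- The memory `m` with `v` written to index `i` of array `a`. -/
def Mem.write (m : Mem) (a i : ℕ) (v : ℝ) : Mem :=
  Function.update m a (Function.update (m a) i v)

/-- `Exec ω p σ τ t`: with random tape `ω`, the program `p` started in configuration `σ` halts in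
configuration `τ` after exactly `t` steps. -/
inductive Exec (ω : Tape) : Cmd → State → State → ℕ → Prop where
  | skip (σ : State) : Exec ω .skip σ σ 0
  | assign (a : ℕ) (i e : Expr) (σ : State) :
      Exec ω (.assign a i e) σ ⟨σ.mem.write a ⌊i.eval σ.mem⌋₊ (e.eval σ.mem), σ.pos⟩
        (i.cost + e.cost + 1)
  | sample (a : ℕ) (i : Expr) (s : Source) (σ : State) :
      Exec ω (.sample a i s) σ ⟨σ.mem.write a ⌊i.eval σ.mem⌋₊ (ω (σ.pos, s)), σ.pos + 1⟩
        (i.cost + 1)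
  | seq {p q : Cmd} {σ₁ σ₂ σ₃ : State} {t₁ t₂ : ℕ} :
      Exec ω p σ₁ σ₂ t₁ → Exec ω q σ₂ σ₃ t₂ → Exec ω (.seq p q) σ₁ σ₃ (t₁ + t₂)
  | iteTrue {e₁ e₂ : Expr} {p q : Cmd} {σ τ : State} {t : ℕ} :
      e₁.eval σ.mem ≤ e₂.eval σ.mem → Exec ω p σ τ t →
        Exec ω (.ite e₁ e₂ p q) σ τ (e₁.cost + e₂.cost + 1 + t)
  | iteFalse {e₁ e₂ : Expr} {p q : Cmd} {σ τ : State} {t : ℕ} :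
      ¬ e₁.eval σ.mem ≤ e₂.eval σ.mem → Exec ω q σ τ t →
        Exec ω (.ite e₁ e₂ p q) σ τ (e₁.cost + e₂.cost + 1 + t)
  | loopTrue {e₁ e₂ : Expr} {p : Cmd} {σ₁ σ₂ σ₃ : State} {t₁ t₂ : ℕ} :
      e₁.eval σ₁.mem ≤ e₂.eval σ₁.mem → Exec ω p σ₁ σ₂ t₁ → Exec ω (.loop e₁ e₂ p) σ₂ σ₃ t₂ →
        Exec ω (.loop e₁ e₂ p) σ₁ σ₃ (e₁.cost + e₂.cost + 1 + t₁ + t₂)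
  | loopFalse {e₁ e₂ : Expr} {p : Cmd} {σ : State} :
      ¬ e₁.eval σ.mem ≤ e₂.eval σ.mem →
        Exec ω (.loop e₁ e₂ p) σ σ (e₁.cost + e₂.cost + 1)

/-- For a fixed tape, the final configuration and the number of steps are unique. -/
theorem Exec.unique {ω : Tape} {p : Cmd} {σ τ₁ : State} {t₁ : ℕ} (h₁ : Exec ω p σ τ₁ t₁) :
    ∀ {τ₂ : State} {t₂ : ℕ}, Exec ω p σ τ₂ t₂ → τ₁ = τ₂ ∧ t₁ = t₂ := by
  induction h₁ with
  | skip | assign | sample => intro _ _ h; cases h; exact ⟨rfl, rfl⟩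
  | seq _ _ ih₁ ih₂ =>
    intro _ _ h
    cases h with
    | seq a b =>
      obtain ⟨rfl, rfl⟩ := ih₁ a
      obtain ⟨rfl, rfl⟩ := ih₂ b
      exact ⟨rfl, rfl⟩
  | iteTrue c _ ih | iteFalse c _ ih =>
    intro _ _ h
    cases h with
    | iteTrue c₂ a | iteFalse c₂ a =>
      first
      | exact absurd c c₂
      | exact absurd c₂ c
      | (obtain ⟨rfl, rfl⟩ := ih a; exact ⟨rfl, rfl⟩)
  | loopTrue c _ _ ih₁ ih₂ =>
    intro _ _ h
    cases h with
    | loopFalse c₂ => exact absurd c c₂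
    | loopTrue _ a b =>
      obtain ⟨rfl, rfl⟩ := ih₁ a
      obtain ⟨rfl, rfl⟩ := ih₂ b
      exact ⟨rfl, rfl⟩
  | loopFalse c =>
    intro _ _ h
    cases h with
    | loopFalse _ => exact ⟨rfl, rfl⟩
    | loopTrue c₂ _ _ => exact absurd c₂ c

/-! ### Curator and client -/

/-- The public parameters: privacy level `ε`, error `α`, failure probability `η`, and the ball of
radius `Φ` around `center` that contains the data. -/
structure Params (d : ℕ) where
  ε : ℝ
  α : ℝ
  η : ℝ
  Φ : ℝ
  center : Pt d

/-- A released message: its length in words, and the words (`0` beyond the length). -/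
abbrev Message : Type := ℕ × (ℕ → ℝ)

/-- The coordinates of a point, as an array of words. -/
def coords {d : ℕ} (x : Pt d) (j : ℕ) : ℝ := if h : j < d then x ⟨j, h⟩ else 0

/-- Array with the dimension, the numerical public parameters, and the length of the main input. -/
def header {d : ℕ} (P : Params d) (len : ℕ) (i : ℕ) : ℝ :=
  [(d : ℝ), P.ε, P.α, P.η, P.Φ, (len : ℝ)].getD i 0

/-- Initial configuration of the curator: array `0` is the header (with the size of the dataset),
array `1` the center of the ball, array `2` the dataset, point after point; all else is `0`. -/
def curatorInit {d : ℕ} (P : Params d) (X : List (Pt d)) : State where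
  mem
    | 0 => header P X.length
    | 1 => coords P.center
    | 2 => fun k => coords (X.getD (k / d) 0) (k % d)
    | _ => fun _ => 0
  pos := 0

/-- The message released in a final configuration of the curator: its length is in word `0` of
array `3`, its words are at the beginning of array `4`. -/
def message (τ : State) : Message :=
  (⌊τ.mem 3 0⌋₊, fun i => if i < ⌊τ.mem 3 0⌋₊ then τ.mem 4 i else 0)

/-- Initial configuration of the client: array `0` is the header (with the length of the message),
array `1` the center of the ball, array `2` the message, array `3` the query; all else is `0`. -/
def clientInit {d : ℕ} (P : Params d) (M : Message) (y : Pt d) : State where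
  mem
    | 0 => header P M.1
    | 1 => coords P.center
    | 2 => M.2
    | 3 => coords y
    | _ => fun _ => 0
  pos := 0

/-- On the dataset `X`, with random tape `ω`, the curator releases `M` after exactly `t` steps. -/
def CuratorRun {d : ℕ} (p : Cmd) (P : Params d) (X : List (Pt d)) (ω : Tape) (M : Message)
    (t : ℕ) : Prop :=
  ∃ τ : State, Exec ω p (curatorInit P X) τ t ∧ message τ = M

/-- On the message `M` and the query `y`, the client answers `v` (in word `0` of array `4`) after
exactly `t` steps. -/
def ClientRun {d : ℕ} (p : Cmd) (P : Params d) (M : Message) (y : Pt d) (v : ℝ) (t : ℕ) : Prop :=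
  ∀ ω : Tape, ∃ τ : State, Exec ω p (clientInit P M y) τ t ∧ τ.mem 4 0 = v

/-! ### Privacy and utility -/

/-- The randomized map `release` on datasets satisfying `dom` is (purely) `ε`-differentially
private. -/
def IsDP {d : ℕ} (ε : ℝ) (dom : List (Pt d) → Prop) (release : List (Pt d) → Tape → Message) :
    Prop :=
  (∀ X, dom X → Measurable (release X)) ∧
  ∀ X Y, dom X → dom Y → Neighboring X Y → ∀ O : Set Message, MeasurableSet O →
    tapeMeasure {ω | release X ω ∈ O} ≤
      ENNReal.ofReal (Real.exp ε) * tapeMeasure {ω | release Y ω ∈ O}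

/-- The random function `e` with values in `[0,1]` is an `(α,η)`-approximation of the Gaussian KDE
of `X`: at each single query, the error is at most `α` with probability at least `1 - η`. -/
def IsApprox {d : ℕ} (α η : ℝ) (X : List (Pt d)) (e : Tape → Pt d → ℝ) : Prop :=
  ∀ y : Pt d, Measurable (fun ω => e ω y) ∧ (∀ ω, e ω y ∈ Set.Icc (0 : ℝ) 1) ∧
    ENNReal.ofReal (1 - η) ≤ tapeMeasure {ω | |e ω y - kde X y| ≤ α}

end

end DPKDE

namespace DPKDE

open MeasureTheory ProbabilityTheory

noncomputable section

/-! ### Verification of programs -/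

/-! Space is cut into cubical cells of side `s = √(4 log(1/α))`, anchored at the center of the ball.
A data point whose cell is not among the `3^d` cells around a query differs from it by at least `s`
in some coordinate, so its kernel value is at most `exp(-s²) = α⁴` and may be ignored. For a nearby
cell, let `u` and `v` be the positions of the data point and of the query relative to the corner of
the data point's cell. The kernel is `exp(-|u|²) exp(-|v|²) exp(2⟨u,v⟩)`, and `⟨u,v⟩` is of order `d
log(1/α)`. Truncating the last exponential at a degree `D` of the same order costs an error
exponentially small in `D` and leaves a scalar product of two vectors with `N = (D+d choose d)`
entries, one per multi-index of degree at most `D` (`abs_sum_feature_sub_le`). Each entry is bounded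
by `1`, because its square is a product of single terms of `exp(2uᵢ²)`, each damped by `exp(-2uᵢ²)`
(`abs_feature_le`).

The message consists of the number of points and, for every cell, the sum of the feature vectors of
its points, all with Laplace noise. Adding or removing a point changes the count by `1` and the `N`
words of one cell by at most `1` each; hence noise of scale `(N+1)/ε` gives pure `ε`-privacy
(`isDP_released`). The client pairs the feature vector of the query with the words of the `3^d`
nearby cells, divides by the noisy count and clamps to `[0,1]`. A union bound over the `3^d N + 1`
words that one query uses controls the noise (`isApprox_estimate`); neither the total number of
cells nor `Φ` enters the required sample size.

The factor `Φ/√d` in the size of the message comes from the numbering of the cells. A ball of radius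
`Φ` lies in an `ℓ¹`-ball of radius `√d Φ` (`psum_zigzag_le_cellRad`). Coding integers by naturals
and ranking tuples by their sum (`simplexRank`) thus gives all relevant cells addresses below a
binomial coefficient `(E+d choose d)` with `E` of order `√d Φ/s + d`, which is at most
`(9(1+Φ/√d))^d` (`numCells_le`). The rank is a sum of `d` binomial coefficients, so an address costs
`O(d²)` steps and no search.

Both programs are verified by a small program logic (`Reaches`, `forTo_spec`). The final constants
are absorbed using `α₀ < 1/e` and `η₀ < 1`: a fixed lower bound for `log(1/α)` exceeds `1`, so its
powers dominate every constant, and `log(1/η)` is bounded away from `0`. -/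

/-- The arrays to which a program may write. -/
def Cmd.writes : Cmd → List ℕ
  | .skip => []
  | .assign a _ _ => [a]
  | .sample a _ _ => [a]
  | .seq p q => p.writes ++ q.writes
  | .ite _ _ p q => p.writes ++ q.writes
  | .loop _ _ p => p.writes

@[simp] theorem Mem.write_of_ne (m : Mem) {a b : ℕ} (i : ℕ) (v : ℝ) (h : b ≠ a) :
    m.write a i v b = m b := by
  simp [Mem.write, h]

@[simp] theorem Mem.write_self (m : Mem) (a i : ℕ) (v : ℝ) :
    m.write a i v a = Function.update (m a) i v := by
  simp [Mem.write]

/-- Array numbers are fixed in the program text, so non-interference is a decidable syntactic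
condition; below it is nearly always discharged by `decide`. -/
theorem Exec.frame {ω : Tape} {p : Cmd} {σ τ : State} {t : ℕ} (h : Exec ω p σ τ t) :
    ∀ a, a ∉ p.writes → τ.mem a = σ.mem a := by
  induction h with
  | skip => intro _ _; rfl
  | assign | sample =>
    intro b hb
    simp only [Cmd.writes, List.mem_singleton] at hb
    simp [hb]
  | seq _ _ ih₁ ih₂ =>
    intro b hb
    simp only [Cmd.writes, List.mem_append, not_or] at hb
    rw [ih₂ b hb.2, ih₁ b hb.1]
  | iteTrue _ _ ih =>
    intro b hb
    simp only [Cmd.writes, List.mem_append, not_or] at hb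
    exact ih b hb.1
  | iteFalse _ _ ih =>
    intro b hb
    simp only [Cmd.writes, List.mem_append, not_or] at hb
    exact ih b hb.2
  | loopTrue _ _ _ ih₁ ih₂ =>
    intro b hb
    rw [ih₂ b hb, ih₁ b hb]
  | loopFalse => intro _ _; rfl

theorem Exec.pos_eq {ω : Tape} {p : Cmd} {σ τ : State} {t : ℕ} (h : Exec ω p σ τ t)
    (hp : p.SampleFree) : τ.pos = σ.pos := by
  induction h with
  | skip | assign | loopFalse => rfl
  | sample => exact hp.elim
  | seq _ _ ih₁ ih₂ => rw [ih₂ hp.2, ih₁ hp.1]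
  | iteTrue _ _ ih => exact ih hp.1
  | iteFalse _ _ ih => exact ih hp.2
  | loopTrue _ _ _ ih₁ ih₂ => rw [ih₂ hp, ih₁ hp]

theorem Exec.tape_congr {ω : Tape} {p : Cmd} {σ τ : State} {t : ℕ} (h : Exec ω p σ τ t)
    (ω' : Tape) (hp : p.SampleFree) : Exec ω' p σ τ t := by
  induction h with
  | skip => exact .skip _
  | assign => exact .assign _ _ _ _
  | sample => exact hp.elim
  | seq _ _ ih₁ ih₂ => exact (ih₁ hp.1).seq (ih₂ hp.2)
  | iteTrue h _ ih => exact .iteTrue h (ih hp.1)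
  | iteFalse h _ ih => exact .iteFalse h (ih hp.2)
  | loopTrue h _ _ ih₁ ih₂ => exact .loopTrue h (ih₁ hp) (ih₂ hp)
  | loopFalse h => exact .loopFalse h

/-- Tests whether a program has neither loops nor sampling instructions. -/
def Cmd.straight : Cmd → Bool
  | .skip => true
  | .assign _ _ _ => true
  | .sample _ _ _ => false
  | .seq p q => p.straight && q.straight
  | .ite _ _ p q => p.straight && q.straight
  | .loop _ _ _ => false

open Classical in
/-- The effect of a straight-line program on the memory. -/
def Cmd.run : Cmd → Mem → Mem
  | .assign a i e, m => m.write a ⌊i.eval m⌋₊ (e.eval m)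
  | .seq p q, m => q.run (p.run m)
  | .ite e₁ e₂ p q, m => if e₁.eval m ≤ e₂.eval m then p.run m else q.run m
  | _, m => m

/-- An upper bound for the running time of a straight-line program. -/
def Cmd.time : Cmd → ℕ
  | .assign _ i e => i.cost + e.cost + 1
  | .seq p q => p.time + q.time
  | .ite e₁ e₂ p q => e₁.cost + e₂.cost + 1 + (p.time + q.time)
  | _ => 0

/-- With random tape `ω`, the program `p` started in `σ` halts after at most `T` steps in a
configuration that satisfies `Q`. -/
def Reaches (ω : Tape) (p : Cmd) (σ : State) (T : ℕ) (Q : State → Prop) : Prop :=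
  ∃ τ t, Exec ω p σ τ t ∧ t ≤ T ∧ Q τ

theorem Reaches.mono {ω : Tape} {p : Cmd} {σ : State} {T T' : ℕ} {Q Q' : State → Prop}
    (h : Reaches ω p σ T Q) (hT : T ≤ T') (hQ : ∀ τ, Q τ → Q' τ) : Reaches ω p σ T' Q' := by
  obtain ⟨τ, t, h₁, h₂, h₃⟩ := h
  exact ⟨τ, t, h₁, h₂.trans hT, hQ _ h₃⟩

theorem Reaches.seq {ω : Tape} {p q : Cmd} {σ : State} {T₁ T₂ : ℕ} {Q R : State → Prop}
    (h : Reaches ω p σ T₁ Q)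
    (h' : ∀ τ, (∀ a, a ∉ p.writes → τ.mem a = σ.mem a) → Q τ → Reaches ω q τ T₂ R) :
    Reaches ω (.seq p q) σ (T₁ + T₂) R := by
  obtain ⟨τ, t, h₁, h₂, h₃⟩ := h
  obtain ⟨τ', t', h₁', h₂', h₃'⟩ := h' τ h₁.frame h₃
  exact ⟨τ', t + t', h₁.seq h₁', add_le_add h₂ h₂', h₃'⟩

theorem Reaches.and_frame {ω : Tape} {p : Cmd} {σ : State} {T : ℕ} {Q : State → Prop}
    (h : Reaches ω p σ T Q) :
    Reaches ω p σ T fun τ => Q τ ∧ ∀ a, a ∉ p.writes → τ.mem a = σ.mem a := by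
  obtain ⟨τ, t, h₁, h₂, h₃⟩ := h
  exact ⟨τ, t, h₁, h₂, h₃, h₁.frame⟩

theorem Reaches.and_pos {ω : Tape} {p : Cmd} {σ : State} {T : ℕ} {Q : State → Prop}
    (h : Reaches ω p σ T Q) (hp : p.SampleFree) :
    Reaches ω p σ T fun τ => Q τ ∧ τ.pos = σ.pos := by
  obtain ⟨τ, t, h₁, h₂, h₃⟩ := h
  exact ⟨τ, t, h₁, h₂, h₃, h₁.pos_eq hp⟩

theorem Cmd.exec_run (ω : Tape) {p : Cmd} (hp : p.straight = true) (m : Mem) (k : ℕ) :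
    ∃ t ≤ p.time, Exec ω p ⟨m, k⟩ ⟨p.run m, k⟩ t := by
  induction p generalizing m with
  | skip => exact ⟨0, le_rfl, .skip _⟩
  | assign a i e => exact ⟨_, le_rfl, .assign a i e ⟨m, k⟩⟩
  | sample => cases hp
  | loop => cases hp
  | seq p q ihp ihq =>
    have hp := (Bool.and_eq_true _ _).mp hp
    obtain ⟨t₁, h₁, e₁⟩ := ihp hp.1 m
    obtain ⟨t₂, h₂, e₂⟩ := ihq hp.2 (p.run m)
    exact ⟨t₁ + t₂, add_le_add h₁ h₂, e₁.seq e₂⟩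
  | ite e₁ e₂ p q ihp ihq =>
    have hp := (Bool.and_eq_true _ _).mp hp
    obtain ⟨t₁, h₁, x₁⟩ := ihp hp.1 m
    obtain ⟨t₂, h₂, x₂⟩ := ihq hp.2 m
    by_cases h : e₁.eval m ≤ e₂.eval m
    · refine ⟨e₁.cost + e₂.cost + 1 + t₁, by simp only [Cmd.time]; omega, ?_⟩
      simp only [Cmd.run, if_pos h]
      exact Exec.iteTrue (σ := ⟨m, k⟩) h x₁
    · refine ⟨e₁.cost + e₂.cost + 1 + t₂, by simp only [Cmd.time]; omega, ?_⟩
      simp only [Cmd.run, if_neg h]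
      exact Exec.iteFalse (σ := ⟨m, k⟩) h x₂

theorem Reaches.of_straight {ω : Tape} {p : Cmd} {σ : State} {T : ℕ} {Q : State → Prop}
    (hp : p.straight = true) (hT : p.time ≤ T) (hQ : Q ⟨p.run σ.mem, σ.pos⟩) :
    Reaches ω p σ T Q := by
  obtain ⟨t, ht, h⟩ := Cmd.exec_run ω hp σ.mem σ.pos
  exact ⟨_, t, h, ht.trans hT, hQ⟩

instance : Add Expr := ⟨.bin .add⟩
instance : Sub Expr := ⟨.bin .sub⟩
instance : Mul Expr := ⟨.bin .mul⟩
instance : Div Expr := ⟨.bin .div⟩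
instance : Neg Expr := ⟨.un .neg⟩
instance (n : ℕ) : OfNat Expr n := ⟨.const n⟩

/-- The variable stored in word `0` of array `a`. -/
def var (a : ℕ) : Expr := .read a 0

/-- Assignment to the variable stored in word `0` of array `a`. -/
def setVar (a : ℕ) (e : Expr) : Cmd := .assign a 0 e

notation:60 p:61 ";;" q:60 => Cmd.seq p q

section Eval

variable (m : Mem)

@[simp] theorem eval_add (e f : Expr) : (e + f).eval m = e.eval m + f.eval m := rfl
@[simp] theorem eval_sub (e f : Expr) : (e - f).eval m = e.eval m - f.eval m := rfl
@[simp] theorem eval_mul (e f : Expr) : (e * f).eval m = e.eval m * f.eval m := rfl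
@[simp] theorem eval_div (e f : Expr) : (e / f).eval m = e.eval m / f.eval m := rfl
@[simp] theorem eval_neg (e : Expr) : (-e).eval m = -e.eval m := rfl

@[simp] theorem eval_ofNat (n : ℕ) [n.AtLeastTwo] :
    Expr.eval m (no_index (OfNat.ofNat n) : Expr) = (OfNat.ofNat n : ℝ) := by
  change (((n : ℕ) : ℚ) : ℝ) = _
  rw [Rat.cast_natCast]
  exact (Nat.cast_ofNat (R := ℝ) (n := n))

@[simp] theorem eval_zero : Expr.eval m (0 : Expr) = 0 := by
  change (((0 : ℕ) : ℚ) : ℝ) = _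
  simp

@[simp] theorem eval_one : Expr.eval m (1 : Expr) = 1 := by
  change (((1 : ℕ) : ℚ) : ℝ) = _
  simp

@[simp] theorem eval_read (a : ℕ) (i : Expr) : (Expr.read a i).eval m = m a ⌊i.eval m⌋₊ := rfl

@[simp] theorem eval_var (a : ℕ) : (var a).eval m = m a 0 := by simp [var]

@[simp] theorem eval_un (op : UnOp) (e : Expr) : (Expr.un op e).eval m = op.eval (e.eval m) := rfl

@[simp] theorem run_setVar (a : ℕ) (e : Expr) : (setVar a e).run m = m.write a 0 (e.eval m) := by
  simp [setVar, Cmd.run]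

@[simp] theorem run_seq (p q : Cmd) : (p ;; q).run m = q.run (p.run m) := rfl

@[simp] theorem run_assign (a : ℕ) (i e : Expr) :
    (Cmd.assign a i e).run m = m.write a ⌊i.eval m⌋₊ (e.eval m) := rfl

end Eval

/-- `for v = 0, 1, …` as long as `v` is less than the value of the variable `b`. -/
def forTo (v b : ℕ) (p : Cmd) : Cmd :=
  setVar v 0 ;; .loop (var v + 1) (var b) (p ;; setVar v (var v + 1))

/-- Induction on the number `r` of remaining rounds. Each round pays `13` steps besides the body,
namely `7` for the test and `6` for the increment; the last `7` pay for the failing test. The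
invariant must tolerate writes to the counter (`stable`), since the increment happens after the body
has established it. -/
theorem loop_spec {ω : Tape} {v b : ℕ} {p : Cmd} (hvb : b ≠ v) (hv : v ∉ p.writes)
    (hb : b ∉ p.writes) {m : ℕ} {T : ℕ} (I : ℕ → State → Prop)
    (stable : ∀ k σ x, I k σ → I k ⟨σ.mem.write v 0 x, σ.pos⟩) (σ₀ : State)
    (step : ∀ k < m, ∀ σ, I k σ → σ.mem v 0 = k →
      (∀ a, a ≠ v → a ∉ p.writes → σ.mem a = σ₀.mem a) → Reaches ω p σ T (I (k + 1)))
    (r : ℕ) : ∀ k, k + r = m → ∀ σ, I k σ → σ.mem v 0 = k → σ.mem b 0 = m →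
      (∀ a, a ≠ v → a ∉ p.writes → σ.mem a = σ₀.mem a) →
      Reaches ω (.loop (var v + 1) (var b) (p ;; setVar v (var v + 1))) σ (r * (T + 13) + 7)
        (I m) := by
  induction r with
  | zero =>
    intro k hk σ hI hkv hm hf
    obtain rfl : k = m := by omega
    refine ⟨σ, _, .loopFalse ?_, ?_, hI⟩
    · simp [hkv, hm]
    · have : (var v + 1 : Expr).cost + (var b).cost + 1 = 7 := rfl
      omega
  | succ r ih =>
    intro k hk σ hI hkv hm hf
    obtain ⟨τ, t, e, ht, hI'⟩ := step k (by omega) σ hI hkv hf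
    have hτv : τ.mem v 0 = k := by rw [e.frame v hv, hkv]
    have hτb : τ.mem b 0 = m := by rw [e.frame b hb, hm]
    obtain ⟨t₂, ht₂, e₂⟩ := Cmd.exec_run ω (p := setVar v (var v + 1)) rfl τ.mem τ.pos
    obtain ⟨τ', t₃, e₃, ht₃, hI₃⟩ := ih (k + 1) (by omega)
      ⟨(setVar v (var v + 1)).run τ.mem, τ.pos⟩
      (by simpa using stable _ _ _ hI') (by simp [hτv])
      (by simp [hvb, hτb]) (by
        intro a ha ha'
        simp [ha, e.frame a ha', hf a ha ha'])
    refine ⟨τ', _, .loopTrue ?_ (e.seq e₂) e₃, ?_, hI₃⟩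
    · simp only [eval_add, eval_var, hkv, hm, eval_one]
      exact_mod_cast (by omega : k + 1 ≤ m)
    · have h₁ : (var v + 1 : Expr).cost + (var b).cost + 1 = 7 := rfl
      have h₂ : (setVar v (var v + 1)).time = 6 := rfl
      nlinarith

/-- Rule for `for` loops with an invariant `I`. -/
theorem forTo_spec {ω : Tape} {v b : ℕ} {p : Cmd} (hvb : b ≠ v) (hv : v ∉ p.writes)
    (hb : b ∉ p.writes) (m : ℕ) {T : ℕ} (I : ℕ → State → Prop)
    (stable : ∀ k σ x, I k σ → I k ⟨σ.mem.write v 0 x, σ.pos⟩) (σ : State)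
    (hm : σ.mem b 0 = m) (h0 : I 0 σ)
    (step : ∀ k < m, ∀ σ', I k σ' → σ'.mem v 0 = k →
      (∀ a, a ≠ v → a ∉ p.writes → σ'.mem a = σ.mem a) → Reaches ω p σ' T (I (k + 1))) :
    Reaches ω (forTo v b p) σ (m * (T + 13) + 10) (I m) := by
  have h : Reaches ω (setVar v 0) σ 3 fun τ => τ = ⟨σ.mem.write v 0 0, σ.pos⟩ :=
    .of_straight rfl (le_of_eq rfl) (by simp)
  refine (h.seq (T₂ := m * (T + 13) + 7) (R := I m) ?_).mono (by omega) fun _ h => h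
  rintro τ - rfl
  exact loop_spec hvb hv hb I stable σ step m 0 (by omega) _ (stable _ _ _ h0) (by simp)
    (by simpa [hvb] using hm) fun a ha _ => by simp [ha]

/-! ### Numbering of the cells -/

/-- The integers, numbered by `0, -1, 1, -2, 2, …`. -/
def zigzag (z : ℤ) : ℕ := if 0 ≤ z then (2 * z).toNat else (-2 * z - 1).toNat

theorem zigzag_injective : Function.Injective zigzag := by
  intro a b h
  unfold zigzag at h
  split_ifs at h <;> omega

theorem cast_zigzag (z : ℤ) :
    (zigzag z : ℝ) = if 0 ≤ (z : ℝ) then 2 * (z : ℝ) else -2 * (z : ℝ) - 1 := by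
  have h : ((zigzag z : ℤ)) = if 0 ≤ z then 2 * z else -2 * z - 1 := by
    unfold zigzag
    split_ifs <;> omega
  have h' := congrArg (Int.cast : ℤ → ℝ) h
  simp only [Int.cast_natCast, Int.cast_ite] at h'
  rw [h']
  simp only [Int.cast_nonneg_iff]
  push_cast
  rfl

theorem zigzag_floor_le (w : ℝ) : (zigzag ⌊w⌋ : ℝ) ≤ 2 * |w| + 2 := by
  rw [cast_zigzag]
  have h₁ := Int.floor_le w
  have h₂ := Int.lt_floor_add_one w
  have h₃ := neg_abs_le w
  have h₄ := le_abs_self w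
  split_ifs <;> linarith

/-- Partial sums of a sequence. -/
def psum (β : ℕ → ℕ) (j : ℕ) : ℕ := ∑ i ∈ Finset.range j, β i

theorem psum_succ (β : ℕ → ℕ) (j : ℕ) : psum β (j + 1) = psum β j + β j :=
  Finset.sum_range_succ _ _

theorem psum_update (β : ℕ → ℕ) (j k : ℕ) : psum (Function.update β j k) j = psum β j :=
  Finset.sum_congr rfl fun i hi => by
    rw [Function.update_of_ne (Finset.mem_range.1 hi).ne]

/-- The position of `(β 0, …, β (d - 1))` in an enumeration of `ℕ^d` by increasing sums
(the combinatorial number system). -/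
def simplexRank (d : ℕ) (β : ℕ → ℕ) : ℕ :=
  ∑ j ∈ Finset.range d, (psum β (j + 1) + j).choose (j + 1)

theorem simplexRank_succ (d : ℕ) (β : ℕ → ℕ) :
    simplexRank (d + 1) β = simplexRank d β + (psum β (d + 1) + d).choose (d + 1) :=
  Finset.sum_range_succ _ _

/-- The last summand `(S+d choose d+1)` and the bound `(S+d choose d)` for the preceding ones add up
to `(S+d+1 choose d+1)` by Pascal's rule. -/
theorem simplexRank_lt (d : ℕ) (β : ℕ → ℕ) :
    simplexRank d β < (psum β d + d).choose d := by
  induction d with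
  | zero => simp [simplexRank]
  | succ d ih =>
    have h : (psum β d + d).choose d ≤ (psum β (d + 1) + d).choose d :=
      Nat.choose_le_choose d (by rw [psum_succ]; omega)
    have := Nat.choose_succ_succ (psum β (d + 1) + d) d
    rw [simplexRank_succ, ← add_assoc]
    simp only [Nat.succ_eq_add_one] at this
    omega

theorem simplexRank_lt_of_le {d E : ℕ} {β : ℕ → ℕ} (h : psum β d ≤ E) :
    simplexRank d β < (E + d).choose d :=
  (simplexRank_lt d β).trans_le (Nat.choose_le_choose d (by omega))

/-- Tuples of larger sum come later: the last summand of the rank of `β` alone already exceeds the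
rank of every tuple of smaller sum. -/
theorem psum_le_of_simplexRank_le {d : ℕ} {β γ : ℕ → ℕ}
    (h : simplexRank (d + 1) β ≤ simplexRank (d + 1) γ) : psum β (d + 1) ≤ psum γ (d + 1) := by
  by_contra! hlt
  have h₁ := simplexRank_lt (d + 1) γ
  have h₂ : (psum γ (d + 1) + (d + 1)).choose (d + 1) ≤ (psum β (d + 1) + d).choose (d + 1) :=
    Nat.choose_le_choose _ (by omega)
  have h₃ := simplexRank_succ d β
  omega

/-- The rank determines the total sum, hence the last summand, hence the rank of the truncated
tuple; the last entry is then a difference of two sums. -/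
theorem simplexRank_injective {d : ℕ} {β γ : ℕ → ℕ} (h : simplexRank d β = simplexRank d γ) :
    ∀ i < d, β i = γ i := by
  induction d with
  | zero => intro i hi; omega
  | succ d ih =>
    have hs : psum β (d + 1) = psum γ (d + 1) :=
      le_antisymm (psum_le_of_simplexRank_le h.le) (psum_le_of_simplexRank_le h.ge)
    rw [simplexRank_succ, simplexRank_succ, hs] at h
    have ih' := ih (by omega)
    have hp : psum β d = psum γ d :=
      Finset.sum_congr rfl fun i hi => ih' i (Finset.mem_range.1 hi)
    rw [psum_succ, psum_succ, hp] at hs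
    intro i hi
    rcases Nat.lt_succ_iff_lt_or_eq.1 hi with hi | rfl
    · exact ih' i hi
    · omega

/-! ### Binomial coefficients: the products the programs multiply out, and an upper bound -/

theorem cast_choose_add_eq_prod (n k : ℕ) :
    ∏ i ∈ Finset.range k, (((n : ℝ) + (i + 1)) / (i + 1)) = ((n + k).choose k : ℝ) := by
  induction k with
  | zero => simp
  | succ k ih =>
    rw [Finset.prod_range_succ, ih, ← add_assoc n k 1]
    have h := Nat.add_one_mul_choose_eq (n + k) k
    have h' : ((n : ℝ) + k + 1) * ((n + k).choose k : ℝ)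
        = ((n + k + 1).choose (k + 1) : ℝ) * (k + 1) := by exact_mod_cast h
    field_simp
    linarith

theorem cast_choose_eq_prod (n k : ℕ) :
    ∏ i ∈ Finset.range (k + 1), (((n : ℝ) + i) / (i + 1)) = ((n + k).choose (k + 1) : ℝ) := by
  induction k with
  | zero => simp
  | succ k ih =>
    rw [Finset.prod_range_succ, ih, ← add_assoc n k 1]
    have h := Nat.add_one_mul_choose_eq (n + k) (k + 1)
    have h' : ((n : ℝ) + k + 1) * ((n + k).choose (k + 1) : ℝ)
        = ((n + k + 1).choose (k + 1 + 1) : ℝ) * (k + 1 + 1) := by exact_mod_cast h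
    push_cast
    field_simp
    linarith

/-- Uses `d^d / d! ≤ e^d ≤ 3^d`. Keeping the denominator `d` inside the power is what later turns a
factor `√d Φ` into `Φ/√d`. -/
theorem choose_add_le (m : ℕ) {d : ℕ} (hd : 1 ≤ d) :
    (((m + d).choose d : ℕ) : ℝ) ≤ (3 * ((m + d) / d)) ^ d := by
  have hd' : (0 : ℝ) < d := by exact_mod_cast hd
  have h₁ := Nat.choose_le_pow_div (α := ℝ) d (m + d)
  have h₂ := Real.pow_div_factorial_le_exp (d : ℝ) hd'.le d
  have h₃ : Real.exp d ≤ 3 ^ d := by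
    rw [← mul_one (d : ℝ), Real.exp_nat_mul]
    gcongr
    exact Real.exp_one_lt_three.le
  calc (((m + d).choose d : ℕ) : ℝ) ≤ ((m + d : ℕ) : ℝ) ^ d / (d.factorial : ℝ) := h₁
    _ = ((m + d) / d) ^ d * ((d : ℝ) ^ d / d.factorial) := by
        rw [div_pow]
        push_cast
        field_simp
    _ ≤ ((m + d) / d) ^ d * 3 ^ d := by
        gcongr
        exact h₂.trans h₃
    _ = _ := by rw [← mul_pow, mul_comm]

/-! ### Multi-indices of bounded degree -/

/-- Multi-indices in `j` variables of degree at most `D`, in the order in which the programs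
generate them. -/
def multiIdx (D : ℕ) : ℕ → List (ℕ → ℕ)
  | 0 => [0]
  | j + 1 => (multiIdx D j).map (fun β => Function.update β j 0) ++
      (multiIdx D j).flatMap fun β =>
        (List.range (D - psum β j)).map fun k => Function.update β j (k + 1)

theorem sum_map_multiIdx_succ {M : Type*} [AddCommMonoid M] (D j : ℕ) (f : (ℕ → ℕ) → M) :
    ((multiIdx D (j + 1)).map f).sum = ((multiIdx D j).map fun β =>
      ∑ k ∈ Finset.range (D - psum β j + 1), f (Function.update β j k)).sum := by
  rw [multiIdx]
  generalize multiIdx D j = l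
  induction l with
  | nil => simp
  | cons β l ih =>
    simp only [List.map_append, List.sum_append, List.map_map, List.map_cons, List.sum_cons,
      List.flatMap_cons] at ih ⊢
    rw [← ih, Finset.sum_range_succ', Finset.sum_range]
    have : (List.map (f ∘ fun k => Function.update β j (k + 1))
        (List.range (D - psum β j))).sum =
        ∑ i : Fin (D - psum β j), f (Function.update β j (i + 1)) := by
      rw [← Finset.sum_range (fun i => f (Function.update β j (i + 1)))]
      rfl
    rw [this]
    abel

/-- The hockey-stick identity, read from the top index downwards. -/
theorem sum_choose_sub (m r : ℕ) :
    ∑ k ∈ Finset.range (m + 1), (m - k + r).choose r = (m + r + 1).choose (r + 1) := by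
  induction m with
  | zero => simp
  | succ m ih =>
    rw [Finset.sum_range_succ']
    simp only [Nat.add_sub_add_right, Nat.sub_zero]
    rw [ih, show m + 1 + r + 1 = (m + r + 1) + 1 by ring, Nat.choose_succ_succ (m + r + 1) r,
      show m + 1 + r = m + r + 1 by ring]
    simp only [Nat.succ_eq_add_one]
    omega

/-- Each multi-index is weighted by the number of its extensions by `r` further variables within the
degree bound. The weight makes the induction on `j` go through; `r = 0` counts the list itself. -/
theorem sum_choose_multiIdx (D j r : ℕ) :
    ((multiIdx D j).map fun β => (D - psum β j + r).choose r).sum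
      = (D + j + r).choose (j + r) := by
  induction j generalizing r with
  | zero => simp [multiIdx, psum]
  | succ j ih =>
    rw [sum_map_multiIdx_succ]
    simp only [psum_succ, psum_update, Function.update_self, ← Nat.sub_sub]
    simp only [sum_choose_sub]
    have h := ih (r + 1)
    simp only [← add_assoc] at h
    rw [h]
    congr 1 <;> ring

theorem length_multiIdx (D d : ℕ) : (multiIdx D d).length = (D + d).choose d := by
  simpa using sum_choose_multiIdx D d 0

theorem length_multiIdx_mono (D : ℕ) : Monotone fun j => (multiIdx D j).length :=
  monotone_nat_of_le_succ fun j => by simp [multiIdx]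

/-! ### The truncated exponential series in several variables -/

/-- The Taylor polynomial of degree `m` of the exponential function. -/
def expTaylor (m : ℕ) (x : ℝ) : ℝ := ∑ k ∈ Finset.range (m + 1), x ^ k / (k.factorial : ℝ)

/-- The binomial theorem, with the terms of total degree at most `m` grouped by the degree in `x`.
-/
theorem expTaylor_add (m : ℕ) (x y : ℝ) :
    expTaylor m (x + y) =
      ∑ k ∈ Finset.range (m + 1), x ^ k / (k.factorial : ℝ) * expTaylor (m - k) y := by
  have h₁ : ∀ n, (x + y) ^ n / (n.factorial : ℝ) =
      ∑ k ∈ Finset.range (n + 1), x ^ k / (k.factorial : ℝ) *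
        (y ^ (n - k) / ((n - k).factorial : ℝ)) := by
    intro n
    rw [add_pow, Finset.sum_div]
    refine Finset.sum_congr rfl fun k hk => ?_
    have hk' : k ≤ n := Nat.lt_succ_iff.1 (Finset.mem_range.1 hk)
    rw [Nat.cast_choose ℝ hk']
    have := Nat.factorial_ne_zero n
    field_simp
  unfold expTaylor
  simp only [h₁, Finset.mul_sum]
  induction m with
  | zero => simp
  | succ m ih =>
    rw [Finset.sum_range_succ, ih, Finset.sum_range_succ _ (m + 1), Finset.sum_range_succ _ (m + 1),
      Nat.sub_self, zero_add, Finset.sum_range_one, ← add_assoc, ← Finset.sum_add_distrib]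
    congr 1
    refine Finset.sum_congr rfl fun k hk => ?_
    have hk' : k ≤ m := Nat.lt_succ_iff.1 (Finset.mem_range.1 hk)
    rw [Nat.succ_sub hk', Nat.succ_eq_add_one, Finset.sum_range_succ _ (m - k + 1)]

/-- The variable `r` stands for the sum of the coordinates not yet expanded, which get the degree
left over by `β`. Each induction step splits off one coordinate by `expTaylor_add`. -/
theorem sum_monomial_multiIdx (D : ℕ) (t : ℕ → ℝ) (j : ℕ) (r : ℝ) :
    ((multiIdx D j).map fun β => (∏ i ∈ Finset.range j, t i ^ β i / ((β i).factorial : ℝ)) *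
        expTaylor (D - psum β j) r).sum
      = expTaylor D (∑ i ∈ Finset.range j, t i + r) := by
  induction j generalizing r with
  | zero => simp [multiIdx, psum]
  | succ j ih =>
    rw [sum_map_multiIdx_succ, Finset.sum_range_succ, add_assoc, ← ih]
    congr 2
    funext β
    rw [expTaylor_add, Finset.mul_sum]
    refine Finset.sum_congr rfl fun k _ => ?_
    rw [Finset.prod_range_succ, psum_succ, psum_update, Function.update_self, Nat.sub_sub,
      mul_assoc]
    congr 1
    exact Finset.prod_congr rfl fun i hi => by
      rw [Function.update_of_ne (Finset.mem_range.1 hi).ne]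

/-! ### Features of the Gaussian kernel -/

/-- `√(2^k / k!) x^k`. -/
def monoFactor (x : ℝ) (k : ℕ) : ℝ := ∏ l ∈ Finset.range k, (x * Real.sqrt (2 / (l + 1)))

theorem monoFactor_succ (x : ℝ) (k : ℕ) :
    monoFactor x (k + 1) = monoFactor x k * (x * Real.sqrt (2 / (k + 1))) :=
  Finset.prod_range_succ _ _

theorem monoFactor_mul (x y : ℝ) (k : ℕ) :
    monoFactor x k * monoFactor y k = (2 * x * y) ^ k / (k.factorial : ℝ) := by
  induction k with
  | zero => simp [monoFactor]
  | succ k ih =>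
    have h : Real.sqrt (2 / (k + 1)) * Real.sqrt (2 / (k + 1)) = 2 / ((k : ℝ) + 1) :=
      Real.mul_self_sqrt (by positivity)
    rw [monoFactor_succ, monoFactor_succ, Nat.factorial_succ, pow_succ]
    calc _ = (monoFactor x k * monoFactor y k) * (x * y) *
          (Real.sqrt (2 / (k + 1)) * Real.sqrt (2 / (k + 1))) := by ring
      _ = _ := by
        rw [ih, h]
        push_cast
        field_simp

/-- The square of `monoFactor x k` is one term of the series of `exp (2x²)`, and the square of the
Gaussian factor cancels that exponential. -/
theorem abs_exp_mul_monoFactor_le (x : ℝ) (k : ℕ) :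
    |Real.exp (-(x * x)) * monoFactor x k| ≤ 1 := by
  rw [← sq_le_one_iff_abs_le_one]
  have h := Real.pow_div_factorial_le_exp (x := 2 * x * x) (by nlinarith [mul_self_nonneg x]) k
  rw [← monoFactor_mul] at h
  calc (Real.exp (-(x * x)) * monoFactor x k) ^ 2
      = (Real.exp (-(x * x)) * Real.exp (-(x * x))) * (monoFactor x k * monoFactor x k) := by ring
    _ ≤ (Real.exp (-(x * x)) * Real.exp (-(x * x))) * Real.exp (2 * x * x) := by gcongr
    _ = 1 := by
      rw [← Real.exp_add, ← Real.exp_add]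
      ring_nf
      exact Real.exp_zero

/-- The feature with multi-index `β` in `j` of the variables of the point `u`, up to the factor
`A`. -/
def feature (A : ℝ) (u : ℕ → ℝ) (j : ℕ) (β : ℕ → ℕ) : ℝ :=
  A * ∏ i ∈ Finset.range j, monoFactor (u i) (β i)

/-- The value at `0` of the Gaussian kernel centred at `u`. -/
def gaussWeight (d : ℕ) (u : ℕ → ℝ) : ℝ := Real.exp (-∑ i ∈ Finset.range d, u i * u i)

theorem feature_update (A : ℝ) (u : ℕ → ℝ) (j : ℕ) (β : ℕ → ℕ) (k : ℕ) :
    feature A u (j + 1) (Function.update β j k) = feature A u j β * monoFactor (u j) k := by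
  unfold feature
  rw [Finset.prod_range_succ, Function.update_self, ← mul_assoc]
  congr 2
  exact Finset.prod_congr rfl fun i hi => by
    rw [Function.update_of_ne (Finset.mem_range.1 hi).ne]

theorem abs_feature_le (u : ℕ → ℝ) (d : ℕ) (β : ℕ → ℕ) :
    |feature (gaussWeight d u) u d β| ≤ 1 := by
  have : feature (gaussWeight d u) u d β =
      ∏ i ∈ Finset.range d, (Real.exp (-(u i * u i)) * monoFactor (u i) (β i)) := by
    rw [feature, gaussWeight, Finset.prod_mul_distrib, ← Real.exp_sum, Finset.sum_neg_distrib]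
  rw [this, Finset.abs_prod]
  exact Finset.prod_le_one (fun _ _ => abs_nonneg _) fun i _ => abs_exp_mul_monoFactor_le _ _

theorem sum_feature_mul (D d : ℕ) (u v : ℕ → ℝ) :
    ((multiIdx D d).map fun β =>
      feature (gaussWeight d u) u d β * feature (gaussWeight d v) v d β).sum =
      gaussWeight d u * gaussWeight d v * expTaylor D (∑ i ∈ Finset.range d, 2 * u i * v i) := by
  have h := sum_monomial_multiIdx D (fun i => 2 * u i * v i) d 0
  have h0 : ∀ m, expTaylor m 0 = 1 := by
    intro m
    simp [expTaylor, Finset.sum_range_succ']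
  simp only [h0, mul_one, add_zero] at h
  rw [← h, ← List.sum_map_mul_left]
  congr 2
  funext β
  rw [feature, feature, mul_mul_mul_comm, ← Finset.prod_mul_distrib]
  simp only [monoFactor_mul]

/-- With `n = D + 1` the tail is at most `2|x|^n/n! ≤ 2(e|x|/n)^n ≤ 2(e/8)^n`, and `e/8 ≤ 1/e`. -/
theorem abs_expTaylor_sub_le {D : ℕ} {x : ℝ} (h : 8 * |x| ≤ D + 1) :
    |Real.exp x - expTaylor D x| ≤ 2 * Real.exp (-(D + 1)) := by
  have hD : (0 : ℝ) < D + 1 := by positivity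
  have h₁ : ‖Complex.exp x - ∑ m ∈ Finset.range (D + 1), (x : ℂ) ^ m / (m.factorial : ℂ)‖
      ≤ ‖(x : ℂ)‖ ^ (D + 1) / ((D + 1).factorial : ℝ) * 2 := by
    refine Complex.exp_bound' ?_
    rw [Complex.norm_real, Real.norm_eq_abs, div_le_iff₀ (by positivity)]
    push_cast
    have := abs_nonneg x
    linarith
  rw [Complex.norm_real, Real.norm_eq_abs] at h₁
  have h₂ : Complex.exp x - ∑ m ∈ Finset.range (D + 1), (x : ℂ) ^ m / (m.factorial : ℂ)
      = ((Real.exp x - expTaylor D x : ℝ) : ℂ) := by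
    simp [expTaylor]
  rw [h₂, Complex.norm_real, Real.norm_eq_abs] at h₁
  refine h₁.trans ?_
  rw [mul_comm]
  gcongr
  have h₃ := Real.pow_div_factorial_le_exp ((D : ℝ) + 1) hD.le (D + 1)
  -- This is where the factor `8` in the hypothesis comes from.
  have he : Real.exp 1 * Real.exp 1 ≤ 8 := by
    nlinarith [Real.exp_one_lt_d9, Real.exp_pos 1]
  have h₄ : |x| ^ (D + 1) ≤
      ((D : ℝ) + 1) ^ (D + 1) * (Real.exp (-(D + 1)) * Real.exp (-(D + 1))) := by
    have : Real.exp (-((D : ℝ) + 1)) * Real.exp (-(D + 1)) =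
        (Real.exp (-1) * Real.exp (-1)) ^ (D + 1) := by
      rw [mul_pow, ← Real.exp_nat_mul]
      push_cast
      ring_nf
    rw [this, ← mul_pow]
    gcongr
    rw [Real.exp_neg, ← mul_inv, ← div_eq_mul_inv, le_div_iff₀ (by positivity)]
    nlinarith [abs_nonneg x]
  calc |x| ^ (D + 1) / ((D + 1).factorial : ℝ)
      ≤ ((D : ℝ) + 1) ^ (D + 1) * (Real.exp (-(D + 1)) * Real.exp (-(D + 1))) /
        ((D + 1).factorial : ℝ) := by gcongr
    _ = ((D : ℝ) + 1) ^ (D + 1) / ((D + 1).factorial : ℝ) *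
        (Real.exp (-(D + 1)) * Real.exp (-(D + 1))) := by ring
    _ ≤ Real.exp (D + 1) * (Real.exp (-(D + 1)) * Real.exp (-(D + 1))) := by gcongr
    _ = Real.exp (-(D + 1)) := by
      rw [← mul_assoc, ← Real.exp_add, add_neg_cancel, Real.exp_zero, one_mul]

/-- The truncated feature expansion approximates the Gaussian kernel. -/
theorem abs_sum_feature_sub_le {D d : ℕ} {u v : ℕ → ℝ} {c : ℝ}
    (hc : ∀ i < d, |u i * v i| ≤ c) (hD : 16 * d * c ≤ D + 1) :
    |((multiIdx D d).map fun β =>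
        feature (gaussWeight d u) u d β * feature (gaussWeight d v) v d β).sum -
      Real.exp (-∑ i ∈ Finset.range d, (u i - v i) ^ 2)| ≤ 2 * Real.exp (-(D + 1)) := by
  rw [sum_feature_mul]
  have h : Real.exp (-∑ i ∈ Finset.range d, (u i - v i) ^ 2) =
      gaussWeight d u * gaussWeight d v * Real.exp (∑ i ∈ Finset.range d, 2 * u i * v i) := by
    rw [gaussWeight, gaussWeight, ← Real.exp_add, ← Real.exp_add, ← neg_add,
      ← Finset.sum_add_distrib, ← sub_eq_neg_add, ← Finset.sum_sub_distrib,
      ← Finset.sum_neg_distrib]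
    congr 1
    exact Finset.sum_congr rfl fun i _ => by ring
  have hw : ∀ w, 0 ≤ gaussWeight d w ∧ gaussWeight d w ≤ 1 := fun w =>
    ⟨(Real.exp_pos _).le, Real.exp_le_one_iff.2 (neg_nonpos.2
      (Finset.sum_nonneg fun i _ => mul_self_nonneg _))⟩
  -- Multiplied by the `8` of `abs_expTaylor_sub_le`, this gives the `16 * d * c` of the hypothesis.
  have hx : |∑ i ∈ Finset.range d, 2 * u i * v i| ≤ 2 * d * c := by
    refine (Finset.abs_sum_le_sum_abs _ _).trans ?_
    calc _ ≤ ∑ i ∈ Finset.range d, 2 * c := by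
          refine Finset.sum_le_sum fun i hi => ?_
          rw [mul_assoc, abs_mul, abs_two]
          linarith [hc i (Finset.mem_range.1 hi)]
      _ = _ := by simp; ring
  rw [h, ← mul_sub, abs_mul, abs_of_nonneg (mul_nonneg (hw u).1 (hw v).1), abs_sub_comm]
  have h₁ := abs_expTaylor_sub_le (D := D) (x := ∑ i ∈ Finset.range d, 2 * u i * v i)
    (by linarith)
  calc _ ≤ 1 * |Real.exp (∑ i ∈ Finset.range d, 2 * u i * v i) -
        expTaylor D (∑ i ∈ Finset.range d, 2 * u i * v i)| := by
        gcongr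
        exact mul_le_one₀ (hw u).2 (hw v).1 (hw v).2
    _ ≤ _ := by rwa [one_mul]

/-! ### Programs shared by curator and client

The arrays used besides the input and output arrays. -/

notation "rSide" => (5 : ℕ)
notation "rDeg" => (6 : ℕ)
notation "rRad" => (7 : ℕ)
notation "aCell" => (8 : ℕ)
notation "aOff" => (9 : ℕ)
notation "rSum" => (10 : ℕ)
notation "rRank" => (11 : ℕ)
notation "rBin" => (12 : ℕ)
notation "rJ" => (13 : ℕ)
notation "rI" => (14 : ℕ)
notation "rLim" => (15 : ℕ)
notation "rNormSq" => (16 : ℕ)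
notation "aVal" => (17 : ℕ)
notation "aDeg" => (18 : ℕ)
notation "rCnt" => (19 : ℕ)
notation "rOld" => (20 : ℕ)
notation "rK" => (21 : ℕ)
notation "rW" => (22 : ℕ)
notation "rFeats" => (23 : ℕ)

/-- `out := (top + d choose d)`. -/
def binomCmd (out top : ℕ) : Cmd :=
  setVar out 1 ;;
  forTo rJ 0 (setVar out (var out * ((var top + (var rJ + 1)) / (var rJ + 1))))

theorem binomCmd_spec {ω : Tape} {σ : State} {out top d n : ℕ} (ho : out ≠ rJ) (ht : top ≠ rJ)
    (hot : top ≠ out) (h0 : out ≠ 0) (hd : σ.mem 0 0 = d) (hn : σ.mem top 0 = n) :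
    Reaches ω (binomCmd out top) σ (30 * d + 20)
      fun τ => τ.mem out 0 = ((n + d).choose d : ℕ) := by
  have h₁ : Reaches ω (setVar out 1) σ 3 fun τ => τ.mem out 0 = 1 :=
    .of_straight rfl (le_of_eq rfl) (by simp)
  refine (h₁.seq (T₂ := d * (17 + 13) + 10)
    (R := fun τ => τ.mem out 0 = ((n + d).choose d : ℕ)) ?_).mono ?_ fun _ h => h
  · intro τ hτ h1
    have hτ0 : τ.mem 0 = σ.mem 0 := hτ 0 (by simpa [setVar, Cmd.writes] using h0.symm)
    have hτt : τ.mem top = σ.mem top := hτ top (by simpa [setVar, Cmd.writes] using hot)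
    refine (forTo_spec (by decide) (by simpa [setVar, Cmd.writes] using ho.symm)
      (by simpa [setVar, Cmd.writes] using h0.symm) d
      (fun k τ => τ.mem out 0 = ∏ i ∈ Finset.range k, (((n : ℝ) + (i + 1)) / (i + 1)))
      (fun k σ x h => by simpa [ho] using h) τ (by rw [hτ0, hd]) (by simpa using h1) ?_).mono
      le_rfl ?_
    · intro k _ σ' hI hk hf
      have hσt : σ'.mem top 0 = n := by
        rw [hf top ht (by simpa [setVar, Cmd.writes] using hot), hτt, hn]
      refine .of_straight rfl (le_of_eq (b := 17) rfl) ?_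
      simp [hI, hk, hσt, Finset.prod_range_succ, -Finset.prod_div_distrib]
    · intro τ' h
      rw [h, cast_choose_add_eq_prod]
  · omega

/-- Computes the sum of the zigzag codes of the integers in `aCell`, and the rank of these codes. -/
def addressCmd : Cmd :=
  (setVar rSum 0 ;; setVar rRank 0) ;;
  forTo rJ 0 (
    (.ite 0 (.read aCell (var rJ))
        (setVar rSum (var rSum + 2 * .read aCell (var rJ)))
        (setVar rSum (var rSum + (-2 * .read aCell (var rJ) - 1))) ;;
      setVar rBin 1 ;; setVar rLim (var rJ + 1)) ;;
    forTo rI rLim (setVar rBin (var rBin * ((var rSum + var rI) / (var rI + 1)))) ;;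
    setVar rRank (var rRank + var rBin))

theorem addressCmd_spec {ω : Tape} {σ : State} {d : ℕ} {z : ℕ → ℤ} (hd : σ.mem 0 0 = d)
    (hz : ∀ j < d, σ.mem aCell j = z j) :
    Reaches ω addressCmd σ (d * (28 * d + 90) + 20) fun τ =>
      τ.mem rSum 0 = psum (zigzag ∘ z) d ∧ τ.mem rRank 0 = simplexRank d (zigzag ∘ z) := by
  have h₁ : Reaches ω (setVar rSum 0 ;; setVar rRank 0) σ 6
      fun τ => τ.mem rSum 0 = 0 ∧ τ.mem rRank 0 = 0 :=
    .of_straight rfl (by decide) (by simp)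
  refine (h₁.seq (T₂ := d * ((28 * d + 70) + 13) + 10) ?_).mono ?_ fun _ h => h
  · intro τ hτ h0
    refine (forTo_spec (by decide) (by decide) (by decide) d
      (fun k τ => τ.mem rSum 0 = psum (zigzag ∘ z) k ∧
        τ.mem rRank 0 = simplexRank k (zigzag ∘ z))
      (fun k σ x h => by simpa using h) τ (by rw [hτ 0 (by decide), hd])
      (by simpa [psum, simplexRank] using h0) ?_)
    rintro k hkd σ' ⟨hS, hR⟩ hk hf
    have hzk : σ'.mem aCell k = z k := by
      rw [hf aCell (by decide) (by decide), hτ aCell (by decide), hz k hkd]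
    have hA : Reaches ω (.ite 0 (.read aCell (var rJ))
        (setVar rSum (var rSum + 2 * .read aCell (var rJ)))
        (setVar rSum (var rSum + (-2 * .read aCell (var rJ) - 1))) ;;
      setVar rBin 1 ;; setVar rLim (var rJ + 1)) σ' 41
      (fun τ => τ.mem rSum 0 = psum (zigzag ∘ z) (k + 1) ∧ τ.mem rBin 0 = 1 ∧
        τ.mem rLim 0 = (k + 1 : ℕ) ∧ τ.mem rRank 0 = simplexRank k (zigzag ∘ z)) := by
        refine .of_straight rfl (by decide) ?_
        have := cast_zigzag (z k)
        by_cases h : 0 ≤ ((z k : ℤ) : ℝ)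
        · simp only [h, if_true] at this
          simp [Cmd.run, hk, hzk, hS, hR, h, psum_succ, this]
        · simp only [h, if_false] at this
          simp [Cmd.run, hk, hzk, hS, hR, h, psum_succ, this]
    refine (hA.seq (T₂ := ((k + 1) * (15 + 13) + 10) + 7) ?_).mono ?_ fun _ h => h
    · rintro τ₁ - ⟨h₁S, h₁B, h₁L, h₁R⟩
      have hB : Reaches ω
          (forTo rI rLim (setVar rBin (var rBin * ((var rSum + var rI) / (var rI + 1))))) τ₁
          ((k + 1) * (15 + 13) + 10)
          (fun τ => τ.mem rBin 0 = ∏ i ∈ Finset.range (k + 1),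
            ((((psum (zigzag ∘ z) (k + 1) : ℕ) : ℝ) + i) / (i + 1))) := by
        refine forTo_spec (by decide) (by decide) (by decide) (k + 1)
          (fun l τ => τ.mem rBin 0 = ∏ i ∈ Finset.range l,
            ((((psum (zigzag ∘ z) (k + 1) : ℕ) : ℝ) + i) / (i + 1)))
          (fun k σ x h => by simpa using h) τ₁ h₁L (by simpa using h₁B) ?_
        intro l _ σ₂ hI hl hf₂
        have hσS : σ₂.mem rSum 0 = psum (zigzag ∘ z) (k + 1) := by
          rw [hf₂ rSum (by decide) (by decide), h₁S]
        refine .of_straight rfl (by decide) ?_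
        simp [hI, hl, hσS, Finset.prod_range_succ, -Finset.prod_div_distrib]
      refine hB.seq ?_
      intro τ₂ hτ₂ h₂
      refine .of_straight rfl (by decide) ?_
      have h₂S : τ₂.mem rSum 0 = psum (zigzag ∘ z) (k + 1) := by
        rw [hτ₂ rSum (by decide), h₁S]
      have h₂R : τ₂.mem rRank 0 = simplexRank k (zigzag ∘ z) := by
        rw [hτ₂ rRank (by decide), h₁R]
      rw [cast_choose_eq_prod] at h₂
      simp [h₂, h₂S, h₂R, simplexRank_succ]
    · omega
  · nlinarith

/-- Appends to the list of features all products of its members with powers of the `rJ`-th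
coordinate, up to degree `rDeg`. -/
def growCmd : Cmd :=
  setVar rOld (var rCnt) ;;
  forTo rI rOld (
    (setVar rW (.read aVal (var rI)) ;;
      setVar rLim (var rDeg - .read aDeg (var rI))) ;;
    forTo rK rLim (
      setVar rW (var rW * (.read aOff (var rJ) * .un .sqrt (2 / (var rK + 1)))) ;;
      .assign aVal (var rCnt) (var rW) ;;
      .assign aDeg (var rCnt) (.read aDeg (var rI) + (var rK + 1)) ;;
      setVar rCnt (var rCnt + 1)))

/-- Writes the features of the point in `aOff` to `aVal`. -/
def featCmd : Cmd :=
  setVar rNormSq 0 ;;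
  forTo rJ 0 (setVar rNormSq (var rNormSq +
    .read aOff (var rJ) * .read aOff (var rJ))) ;;
  (.assign aVal 0 (.un .exp (-var rNormSq)) ;; .assign aDeg 0 0 ;; setVar rCnt 1) ;;
  forTo rJ 0 growCmd

/-- The features with multi-indices in the list `l` are stored in `aVal`, their degrees in
`aDeg`, and their number in `rCnt`. -/
def Stored (A : ℝ) (u : ℕ → ℝ) (j : ℕ) (l : List (ℕ → ℕ)) (σ : State) : Prop :=
  σ.mem rCnt 0 = l.length ∧ ∀ i (h : i < l.length),
    σ.mem aVal i = feature A u j l[i] ∧ σ.mem aDeg i = psum l[i] j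

theorem Stored.append {A : ℝ} {u : ℕ → ℝ} {j : ℕ} {l : List (ℕ → ℕ)} {σ τ : State}
    (h : Stored A u j l σ) (β : ℕ → ℕ)
    (hv : τ.mem aVal = Function.update (σ.mem aVal) l.length (feature A u j β))
    (hg : τ.mem aDeg = Function.update (σ.mem aDeg) l.length (psum β j : ℕ))
    (hc : τ.mem rCnt 0 = σ.mem rCnt 0 + 1) : Stored A u j (l ++ [β]) τ := by
  refine ⟨by simp [hc, h.1], fun i hi => ?_⟩
  rw [List.length_append, List.length_singleton] at hi
  rcases Nat.lt_succ_iff_lt_or_eq.1 hi with hi | rfl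
  · rw [hv, hg, Function.update_of_ne hi.ne, Function.update_of_ne hi.ne,
      List.getElem_append_left hi]
    exact h.2 i hi
  · simp [hv, hg]

/-- Makes the truncated subtraction `D - psum β j` of the list agree with the real subtraction that
the program performs. -/
theorem psum_le_of_mem_multiIdx {D j : ℕ} {β : ℕ → ℕ} (h : β ∈ multiIdx D j) : psum β j ≤ D := by
  induction j generalizing β with
  | zero => simp [psum]
  | succ j ih =>
    rw [multiIdx, List.mem_append] at h
    rcases h with h | h
    · obtain ⟨γ, hγ, rfl⟩ := List.mem_map.1 h
      simpa [psum_succ, psum_update] using ih hγ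
    · obtain ⟨γ, hγ, h⟩ := List.mem_flatMap.1 h
      obtain ⟨k, hk, rfl⟩ := List.mem_map.1 h
      have := List.mem_range.1 hk
      rw [psum_succ, psum_update, Function.update_self]
      omega

/-- The loop only appends. Entry `i` of the old list is read while longer lists are being built, and
the recursion defining `multiIdx` lists the new multi-indices in exactly the order of appending. -/
theorem growCmd_spec {ω : Tape} {σ : State} {A : ℝ} {u : ℕ → ℝ} {D j : ℕ}
    (hD : σ.mem rDeg 0 = D) (hj : σ.mem rJ 0 = j) (hu : σ.mem aOff j = u j)
    (h : Stored A u j (multiIdx D j) σ) :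
    Reaches ω growCmd σ ((multiIdx D j).length * (60 * D + 40) + 20)
      (Stored A u (j + 1) (multiIdx D (j + 1))) := by
  set M := multiIdx D j with hM
  set F : (ℕ → ℕ) → List (ℕ → ℕ) := fun β =>
    (List.range (D - psum β j)).map fun k => Function.update β j (k + 1) with hF
  -- The stored words need no change: exponent `0` in the new variable multiplies a feature by an
  -- empty product and adds nothing to the degree.
  have h₁ : Reaches ω (setVar rOld (var rCnt)) σ 4 fun τ => τ.mem rOld 0 = M.length ∧
      Stored A u (j + 1) (M.map fun β => Function.update β j 0) τ := by
    refine .of_straight rfl (by decide) ⟨by simp [h.1], by simp [h.1], fun i hi => ?_⟩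
    rw [List.length_map] at hi
    simp only [run_setVar, Mem.write_of_ne _ _ _ (show aVal ≠ rOld by decide),
      Mem.write_of_ne _ _ _ (show aDeg ≠ rOld by decide), List.getElem_map]
    rw [(h.2 i hi).1, (h.2 i hi).2, feature_update, psum_succ, psum_update]
    simp [monoFactor]
  refine (h₁.seq (T₂ := M.length * ((60 * D + 27) + 13) + 10) ?_).mono (by nlinarith) fun _ h => h
  rintro τ hτ ⟨hold, hst⟩
  have hloop := forTo_spec (ω := ω) (v := rI) (b := rOld) (p := (setVar rW (.read aVal (var rI)) ;;
      setVar rLim (var rDeg - .read aDeg (var rI))) ;;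
    forTo rK rLim (
      setVar rW (var rW * (.read aOff (var rJ) * .un .sqrt (2 / (var rK + 1)))) ;;
      .assign aVal (var rCnt) (var rW) ;;
      .assign aDeg (var rCnt) (.read aDeg (var rI) + (var rK + 1)) ;;
      setVar rCnt (var rCnt + 1))) (by decide) (by decide) (by decide) M.length
      (T := 60 * D + 27)
      (fun i => Stored A u (j + 1) (M.map (fun β => Function.update β j 0) ++
        (M.take i).flatMap F)) (fun k σ x h => by simpa [Stored] using h) τ hold
      (by simpa using hst) ?_
  · refine hloop.mono le_rfl fun τ' h' => ?_
    rw [List.take_length] at h'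
    exact h'
  intro i hi σ₁ hI hi₁ hf₁
  have hin : M[i] ∈ multiIdx D j := List.getElem_mem hi
  set β := M[i] with hβ
  have hle : psum β j ≤ D := psum_le_of_mem_multiIdx hin
  -- Whatever has been appended, position `i` still belongs to the old block, so the value and the
  -- degree of `β` can still be read there.
  have hget : ∀ l : List (ℕ → ℕ), ∀ h, (M.map (fun β => Function.update β j 0) ++ l)[i]'h =
      Function.update β j 0 := by
    intro l h
    rw [List.getElem_append_left (by simpa using hi), List.getElem_map]
  have hst₁ := hI.2 i (by simp; omega)
  rw [hget, feature_update, psum_succ, psum_update, Function.update_self, add_zero] at hst₁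
  have hD₁ : σ₁.mem rDeg 0 = D := by
    rw [hf₁ rDeg (by decide) (by decide), hτ rDeg (by decide), hD]
  have hj₁ : σ₁.mem rJ 0 = j := by
    rw [hf₁ rJ (by decide) (by decide), hτ rJ (by decide), hj]
  have hu₁ : σ₁.mem aOff j = u j := by
    rw [hf₁ aOff (by decide) (by decide), hτ aOff (by decide), hu]
  have hA : Reaches ω (setVar rW (.read aVal (var rI)) ;;
      setVar rLim (var rDeg - .read aDeg (var rI))) σ₁ 14 fun τ =>
      τ.mem rW 0 = feature A u j β ∧ τ.mem rLim 0 = (D - psum β j : ℕ) ∧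
      Stored A u (j + 1) (M.map (fun β => Function.update β j 0) ++ (M.take i).flatMap F) τ := by
    refine .of_straight rfl (by decide) ⟨?_, ?_, ?_⟩
    · simp [hi₁, hst₁.1, monoFactor]
    · simp [hi₁, hst₁.2, hD₁, Nat.cast_sub hle]
    · simpa [Stored] using hI
  refine (hA.seq (T₂ := (D - psum β j) * (45 + 13) + 10) ?_).mono ?_ fun _ h => h
  · rintro τ₂ hτ₂ ⟨hW₂, hL₂, hS₂⟩
    have hj₂ : τ₂.mem rJ 0 = j := by rw [hτ₂ rJ (by decide), hj₁]
    have hi₂ : τ₂.mem rI 0 = i := by rw [hτ₂ rI (by decide), hi₁]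
    have hu₂ : τ₂.mem aOff j = u j := by rw [hτ₂ aOff (by decide), hu₁]
    refine (forTo_spec (by decide) (by decide) (by decide) (D - psum β j)
      (fun k τ => τ.mem rW 0 = feature A u j β * monoFactor (u j) k ∧
        Stored A u (j + 1) ((M.map (fun β => Function.update β j 0) ++ (M.take i).flatMap F) ++
          (List.range k).map fun k => Function.update β j (k + 1)) τ)
      (fun k σ x h => by simpa [Stored] using h) τ₂ hL₂ ?_ ?_).mono le_rfl ?_
    · exact ⟨by simpa [monoFactor] using hW₂, by simpa using hS₂⟩
    · rintro k hk σ₃ ⟨hW₃, hS₃⟩ hk₃ hf₃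
      have hj₃ : σ₃.mem rJ 0 = j := by rw [hf₃ rJ (by decide) (by decide), hj₂]
      have hi₃ : σ₃.mem rI 0 = i := by rw [hf₃ rI (by decide) (by decide), hi₂]
      have hu₃ : σ₃.mem aOff j = u j := by rw [hf₃ aOff (by decide) (by decide), hu₂]
      have hst₃ := hS₃.2 i (by simp; omega)
      rw [List.getElem_append_left (by simp; omega), hget, psum_succ, psum_update,
        Function.update_self, add_zero] at hst₃
      have hc₃ := hS₃.1
      obtain ⟨n, hn⟩ : ∃ n, n = ((M.map (fun β => Function.update β j 0) ++
          (M.take i).flatMap F) ++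
          (List.range k).map fun k => Function.update β j (k + 1)).length := ⟨_, rfl⟩
      rw [← hn] at hc₃
      refine .of_straight rfl (by decide) ⟨?_, ?_⟩
      · simp [hj₃, hu₃, hW₃, hk₃, UnOp.eval, monoFactor_succ]
        ring
      · rw [List.range_succ, List.map_append, ← List.append_assoc]
        refine hS₃.append _ ?_ ?_ ?_
        · rw [← hn]
          simp [hj₃, hu₃, hW₃, hk₃, UnOp.eval, hc₃, feature_update, monoFactor_succ]
          ring_nf
        · rw [← hn]
          simp [hi₃, hk₃, hc₃, psum_succ, psum_update, hst₃.2]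
        · simp
    · rintro τ₃ ⟨-, h⟩
      rw [List.take_succ_eq_append_getElem hi, List.flatMap_append, ← List.append_assoc]
      simpa [F, hβ] using h
  · have : (D - psum β j) * (45 + 13) ≤ D * (45 + 13) := by gcongr; omega
    omega

theorem featCmd_spec {ω : Tape} {σ : State} {u : ℕ → ℝ} {D d : ℕ}
    (hd : σ.mem 0 0 = d) (hD : σ.mem rDeg 0 = D) (hu : ∀ j < d, σ.mem aOff j = u j) :
    Reaches ω featCmd σ (d * ((multiIdx D d).length * (60 * D + 40) + 70) + 50)
      fun τ => ∀ i (h : i < (multiIdx D d).length),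
        τ.mem aVal i = feature (gaussWeight d u) u d (multiIdx D d)[i] := by
  have h₁ : Reaches ω (setVar rNormSq 0) σ 3 fun τ => τ.mem rNormSq 0 = 0 :=
    .of_straight rfl (by decide) (by simp)
  refine (h₁.seq (T₂ := (d * (14 + 13) + 10) + (12 + (d * (((multiIdx D d).length *
    (60 * D + 40) + 20) + 13) + 10))) ?_).mono ?_ fun _ h => h
  · intro τ₁ hτ₁ h0
    have h₂ : Reaches ω (forTo rJ 0 (setVar rNormSq (var rNormSq +
        .read aOff (var rJ) * .read aOff (var rJ)))) τ₁ (d * (14 + 13) + 10)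
        fun τ => τ.mem rNormSq 0 = ∑ i ∈ Finset.range d, u i * u i := by
      refine forTo_spec (by decide) (by decide) (by decide) d
        (fun k τ => τ.mem rNormSq 0 = ∑ i ∈ Finset.range k, u i * u i)
        (fun k σ x h => by simpa using h) τ₁ (by rw [hτ₁ 0 (by decide), hd]) (by simpa using h0) ?_
      intro k hk σ' hI hkv hf
      have hu' : σ'.mem aOff k = u k := by
        rw [hf aOff (by decide) (by decide), hτ₁ aOff (by decide), hu k hk]
      refine .of_straight rfl (by decide) ?_
      simp [hkv, hu', hI, Finset.sum_range_succ]
    refine h₂.seq ?_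
    intro τ₂ hτ₂ hq
    have h₃ : Reaches ω (.assign aVal 0 (.un .exp (-var rNormSq)) ;; .assign aDeg 0 0 ;;
        setVar rCnt 1) τ₂ 12 (Stored (gaussWeight d u) u 0 (multiIdx D 0)) := by
      refine .of_straight rfl (by decide) ⟨by simp [multiIdx], fun i hi => ?_⟩
      obtain rfl : i = 0 := by simpa [multiIdx] using hi
      simp [hq, UnOp.eval, feature, psum, gaussWeight]
    refine h₃.seq ?_
    intro τ₃ hτ₃ hS
    refine (forTo_spec (by decide) (by decide) (by decide) d
      (fun k => Stored (gaussWeight d u) u k (multiIdx D k))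
      (fun k σ x h => by simpa [Stored] using h) τ₃
      (by rw [hτ₃ 0 (by decide), hτ₂ 0 (by decide), hτ₁ 0 (by decide), hd]) hS ?_).mono le_rfl
      fun τ h i hi => (h.2 i hi).1
    intro k hk σ' hI hkv hf
    refine (growCmd_spec (D := D) ?_ hkv ?_ hI).mono ?_ fun _ h => h
    · rw [hf rDeg (by decide) (by decide), hτ₃ rDeg (by decide), hτ₂ rDeg (by decide),
        hτ₁ rDeg (by decide), hD]
    · rw [hf aOff (by decide) (by decide), hτ₃ aOff (by decide), hτ₂ aOff (by decide),
        hτ₁ aOff (by decide), hu k hk]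
    -- The lists only grow with `j`, so every round may be charged for the final length.
    · have := length_multiIdx_mono D hk.le
      simp only at this
      gcongr
  · nlinarith

/-! ### The parameters of the mechanism -/

/-- The side length of the cells. -/
def cellSide (α : ℝ) : ℝ := Real.sqrt (4 * Real.log (1 / α))

/-- The degree at which the feature expansion is truncated. -/
def featDeg (d : ℕ) (α : ℝ) : ℕ := ⌊128 * d * Real.log (1 / α)⌋₊

/-- A bound for the sum of the zigzag codes of a cell that meets the ball of radius `Φ`. -/
def cellRad (d : ℕ) (α Φ : ℝ) : ℕ := ⌊2 * Real.sqrt d * Φ / cellSide α + 2 * d⌋₊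

/-- The number of features of a cell. -/
def numFeats (d : ℕ) (α : ℝ) : ℕ := (featDeg d α + d).choose d

/-- The number of cells. -/
def numCells (d : ℕ) (α Φ : ℝ) : ℕ := (cellRad d α Φ + d).choose d

/-- The number of words of the message. -/
def msgLen (d : ℕ) (α Φ : ℝ) : ℕ := numCells d α Φ * numFeats d α + 1

/-- The cell, in a grid of side `s` with origin `c`, that contains `x`. -/
def cellOf (s : ℝ) (c x : ℕ → ℝ) (j : ℕ) : ℤ := ⌊(x j - c j) / s⌋

/-- The position of `x` relative to the lower corner of the cell `z`. -/
def offsetIn (s : ℝ) (c x : ℕ → ℝ) (z : ℕ → ℤ) (j : ℕ) : ℝ := x j - c j - s * z j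

/-- The `i`-th feature of the point `u`. -/
def featAt (d : ℕ) (α : ℝ) (u : ℕ → ℝ) (i : ℕ) : ℝ :=
  feature (gaussWeight d u) u d ((multiIdx (featDeg d α) d).getD i 0)

/-- The index in the message of the first word of the cell `z`. -/
def cellAddr (d : ℕ) (α : ℝ) (z : ℕ → ℤ) : ℕ :=
  1 + simplexRank d (zigzag ∘ z) * numFeats d α

/-- The contribution of the data point `x` to the word with index `a`, apart from the count. -/
def contrib (d : ℕ) (α : ℝ) (c x : ℕ → ℝ) (a : ℕ) : ℝ :=
  if cellAddr d α (cellOf (cellSide α) c x) ≤ a ∧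
      a < cellAddr d α (cellOf (cellSide α) c x) + numFeats d α then
    featAt d α (offsetIn (cellSide α) c x (cellOf (cellSide α) c x))
      (a - cellAddr d α (cellOf (cellSide α) c x))
  else 0

theorem length_multiIdx_featDeg (d : ℕ) (α : ℝ) :
    (multiIdx (featDeg d α) d).length = numFeats d α := length_multiIdx _ _

notation "rSize" => (24 : ℕ)
notation "rCells" => (25 : ℕ)
notation "rScale" => (26 : ℕ)
notation "rLen" => (27 : ℕ)
notation "rPos" => (28 : ℕ)
notation "rPt" => (29 : ℕ)
notation "rPow" => (30 : ℕ)
notation "rBox" => (31 : ℕ)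
notation "rRem" => (32 : ℕ)
notation "rQuo" => (33 : ℕ)
notation "rTot" => (34 : ℕ)

/-- Computes the parameters of the mechanism. -/
def setupCmd : Cmd :=
  (setVar rSide (.un .sqrt (4 * .un .log (1 / .read 0 2))) ;;
    setVar rDeg (.un .floor (128 * var 0 * .un .log (1 / .read 0 2))) ;;
    setVar rRad (.un .floor (2 * .un .sqrt (var 0) * .read 0 4 / var rSide + 2 * var 0))) ;;
  binomCmd rFeats rDeg

theorem setupCmd_spec {ω : Tape} {σ : State} {d : ℕ} {α Φ : ℝ} (hα : 0 < α) (hα₁ : α < 1)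
    (hΦ : 0 < Φ) (hd : σ.mem 0 0 = d) (hm₂ : σ.mem 0 2 = α) (hm₄ : σ.mem 0 4 = Φ) :
    Reaches ω setupCmd σ (30 * d + 80) fun τ =>
      (τ.mem rSide 0 = cellSide α ∧ τ.mem rDeg 0 = featDeg d α ∧ τ.mem rRad 0 = cellRad d α Φ) ∧
      τ.mem rFeats 0 = numFeats d α := by
  have hL : 0 ≤ Real.log (1 / α) := Real.log_nonneg (by rw [le_div_iff₀ hα]; linarith)
  have h₁ : Reaches ω (setVar rSide (.un .sqrt (4 * .un .log (1 / .read 0 2))) ;;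
      setVar rDeg (.un .floor (128 * var 0 * .un .log (1 / .read 0 2))) ;;
      setVar rRad (.un .floor (2 * .un .sqrt (var 0) * .read 0 4 / var rSide + 2 * var 0))) σ 60
      fun τ => τ.mem rSide 0 = cellSide α ∧ τ.mem rDeg 0 = featDeg d α ∧
        τ.mem rRad 0 = cellRad d α Φ := by
    refine .of_straight rfl (by decide) ⟨?_, ?_, ?_⟩
    · simp [UnOp.eval, hm₂, cellSide]
    -- The machine takes integer floors and the definitions natural ones; they agree because the
    -- argument is nonnegative.
    · rw [featDeg, natCast_floor_eq_intCast_floor (by positivity)]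
      simp [UnOp.eval, hm₂, hd]
    · rw [cellRad, natCast_floor_eq_intCast_floor (by unfold cellSide; positivity)]
      simp [UnOp.eval, hm₂, hd, hm₄, cellSide]
  refine (h₁.seq (T₂ := 30 * d + 20) ?_).mono (by omega) fun _ h => h
  rintro τ hτ ⟨h5, h6, h7⟩
  refine (binomCmd_spec (by decide) (by decide) (by decide) (by decide)
    (by rw [hτ 0 (by decide), hd]) h6).and_frame.mono le_rfl ?_
  rintro τ' ⟨h, hf⟩
  refine ⟨⟨?_, ?_, ?_⟩, h⟩
  · rw [hf rSide (by decide), h5]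
  · rw [hf rDeg (by decide), h6]
  · rw [hf rRad (by decide), h7]

theorem featCmd_spec_featAt {ω : Tape} {σ : State} {u : ℕ → ℝ} {d : ℕ} {α : ℝ}
    (hd : σ.mem 0 0 = d) (hD : σ.mem rDeg 0 = featDeg d α) (hu : ∀ j < d, σ.mem aOff j = u j) :
    Reaches ω featCmd σ (d * (numFeats d α * (60 * featDeg d α + 40) + 70) + 50)
      fun τ => ∀ i < numFeats d α, τ.mem aVal i = featAt d α u i := by
  refine (featCmd_spec hd hD hu).mono (by rw [length_multiIdx_featDeg]) fun τ h i hi => ?_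
  have hlt : i < (multiIdx (featDeg d α) d).length := by rwa [length_multiIdx_featDeg]
  rw [h i hlt, featAt, List.getD_eq_getElem _ _ hlt]

/-! ### The curator -/

/-- Computes the cell of the current data point and its position in the cell. -/
def locateCmd : Cmd :=
  forTo rJ 0 (
    .assign aCell (var rJ) (.un .floor
      ((.read 2 (var rPt * var 0 + var rJ) - .read 1 (var rJ)) / var rSide)) ;;
    .assign aOff (var rJ) (.read 2 (var rPt * var 0 + var rJ) - .read 1 (var rJ) -
      var rSide * .read aCell (var rJ)))

theorem locateCmd_spec {ω : Tape} {σ : State} {d p : ℕ} {s : ℝ} {x : ℕ → ℝ}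
    (hd : σ.mem 0 0 = d) (hs : σ.mem rSide 0 = s) (hp : σ.mem rPt 0 = p)
    (hx : ∀ j < d, σ.mem 2 (p * d + j) = x j) :
    Reaches ω locateCmd σ (70 * d + 10) fun τ => ∀ j < d,
      τ.mem aCell j = cellOf s (σ.mem 1) x j ∧
      τ.mem aOff j = offsetIn s (σ.mem 1) x (cellOf s (σ.mem 1) x) j := by
  refine (forTo_spec (T := 50) (by decide) (by decide) (by decide) d
    (fun k τ => ∀ j < k, τ.mem aCell j = cellOf s (σ.mem 1) x j ∧
      τ.mem aOff j = offsetIn s (σ.mem 1) x (cellOf s (σ.mem 1) x) j)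
    (fun k σ x h => by simpa using h) σ hd (by simp) ?_).mono (by omega) fun _ h => h
  intro k hk σ' hI hkv hf
  have hx' : σ'.mem 2 (p * d + k) = x k := by rw [hf 2 (by decide) (by decide), hx k hk]
  have h1 : σ'.mem 1 = σ.mem 1 := hf 1 (by decide) (by decide)
  have hd' : σ'.mem 0 0 = d := by rw [hf 0 (by decide) (by decide), hd]
  have hs' : σ'.mem rSide 0 = s := by rw [hf rSide (by decide) (by decide), hs]
  have hp' : σ'.mem rPt 0 = p := by rw [hf rPt (by decide) (by decide), hp]
  have hfl : ⌊(p : ℝ) * d + k⌋₊ = p * d + k := by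
    rw [← Nat.cast_mul, ← Nat.cast_add, Nat.floor_natCast]
  refine .of_straight rfl (by decide) fun j hj => ?_
  rcases Nat.lt_succ_iff_lt_or_eq.1 hj with hj | rfl
  · simpa [hkv, hj.ne] using hI j hj
  · simp [hkv, hx', h1, hd', hs', hp', hfl, UnOp.eval, cellOf, offsetIn]

/-- Adds the features of the current data point to the words of its cell. -/
def accumulateCmd : Cmd :=
  forTo rI rFeats (
    .assign 4 (1 + var rRank * var rFeats + var rI)
      (.read 4 (1 + var rRank * var rFeats + var rI) + .read aVal (var rI)))

theorem accumulateCmd_spec {ω : Tape} {σ : State} {r N : ℕ} {f : ℕ → ℝ}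
    (hr : σ.mem rRank 0 = r) (hN : σ.mem rFeats 0 = N) (hv : ∀ i < N, σ.mem aVal i = f i) :
    Reaches ω accumulateCmd σ (40 * N + 10) fun τ => ∀ a, τ.mem 4 a = σ.mem 4 a +
      if 1 + r * N ≤ a ∧ a < 1 + r * N + N then f (a - (1 + r * N)) else 0 := by
  refine (forTo_spec (T := 27) (by decide) (by decide) (by decide) N
    (fun k τ => ∀ a, τ.mem 4 a = σ.mem 4 a +
      if 1 + r * N ≤ a ∧ a < 1 + r * N + k then f (a - (1 + r * N)) else 0)
    (fun k σ x h => by simpa using h) σ hN ?_ ?_).mono (by omega) fun _ h => h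
  · intro a
    rw [if_neg (by omega), add_zero]
  intro k hk σ' hI hkv hf
  have hr' : σ'.mem rRank 0 = r := by rw [hf rRank (by decide) (by decide), hr]
  have hN' : σ'.mem rFeats 0 = N := by rw [hf rFeats (by decide) (by decide), hN]
  have hv' : σ'.mem aVal k = f k := by rw [hf aVal (by decide) (by decide), hv k hk]
  have hfl : ⌊(1 : ℝ) + r * N + k⌋₊ = 1 + r * N + k := by
    rw [← Nat.cast_one, ← Nat.cast_mul, ← Nat.cast_add, ← Nat.cast_add, Nat.floor_natCast]
  refine .of_straight rfl (by decide) fun a => ?_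
  have ha := hI a
  rcases eq_or_ne a (1 + r * N + k) with rfl | hne
  · rw [if_neg (by omega), add_zero] at ha
    rw [if_pos (by omega)]
    simp [hkv, hr', hN', hfl, hv', ha]
  · simp only [run_assign, Mem.write_self, eval_add, eval_one, eval_mul, eval_var, hr', hN', hkv,
      hfl]
    rw [Function.update_of_ne hne, ha]
    congr 2
    simp only [eq_iff_iff]
    omega

/-- Processes the current data point. -/
def pointCmd : Cmd := locateCmd ;; addressCmd ;; featCmd ;; accumulateCmd

/-- A bound for the running time of `addressCmd` followed by `featCmd`. -/
def cellTime (d : ℕ) (α : ℝ) : ℕ :=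
  (d * (28 * d + 90) + 20) + (d * (numFeats d α * (60 * featDeg d α + 40) + 70) + 50)

theorem pointCmd_spec {ω : Tape} {σ : State} {d p : ℕ} {α : ℝ} {x : ℕ → ℝ}
    (hd : σ.mem 0 0 = d) (hs : σ.mem rSide 0 = cellSide α) (hD : σ.mem rDeg 0 = featDeg d α)
    (hN : σ.mem rFeats 0 = numFeats d α) (hp : σ.mem rPt 0 = p)
    (hx : ∀ j < d, σ.mem 2 (p * d + j) = x j) :
    Reaches ω pointCmd σ (70 * d + 20 + cellTime d α + 40 * numFeats d α)
      fun τ => ∀ a, τ.mem 4 a = σ.mem 4 a + contrib d α (σ.mem 1) x a := by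
  refine ((locateCmd_spec hd hs hp hx).seq (T₂ := (d * (28 * d + 90) + 20) +
    ((d * (numFeats d α * (60 * featDeg d α + 40) + 70) + 50) + (40 * numFeats d α + 10)))
    ?_).mono (by unfold cellTime; omega) fun _ h => h
  intro τ₁ hτ₁ h₁
  refine (addressCmd_spec (z := cellOf (cellSide α) (σ.mem 1) x)
    (by rw [hτ₁ 0 (by decide), hd]) fun j hj => (h₁ j hj).1).seq ?_
  rintro τ₂ hτ₂ ⟨-, h₂⟩
  have hf := featCmd_spec_featAt (ω := ω) (σ := τ₂) (d := d) (α := α)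
    (u := offsetIn (cellSide α) (σ.mem 1) x (cellOf (cellSide α) (σ.mem 1) x))
    (by rw [hτ₂ 0 (by decide), hτ₁ 0 (by decide), hd])
    (by rw [hτ₂ rDeg (by decide), hτ₁ rDeg (by decide), hD])
    fun j hj => by rw [hτ₂ aOff (by decide), (h₁ j hj).2]
  refine hf.seq ?_
  intro τ₃ hτ₃ h₃
  refine (accumulateCmd_spec (N := numFeats d α)
    (f := featAt d α (offsetIn (cellSide α) (σ.mem 1) x (cellOf (cellSide α) (σ.mem 1) x)))
    (by rw [hτ₃ rRank (by decide), h₂])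
    (by rw [hτ₃ rFeats (by decide), hτ₂ rFeats (by decide), hτ₁ rFeats (by decide), hN])
    h₃).mono le_rfl ?_
  intro τ₄ h a
  rw [h a, hτ₃ 4 (by decide), hτ₂ 4 (by decide), hτ₁ 4 (by decide)]
  rfl

/-- Fills the message with Laplace noise. -/
def noiseCmd : Cmd :=
  forTo rPos rLen (
    .sample 4 (var rPos) .laplace ;;
    .assign 4 (var rPos) (var rScale * .read 4 (var rPos)))

/-- Starting with no sample drawn aligns the sample counter with the word index, so word `a`
receives the tape entry `(a, .laplace)`. -/
theorem noiseCmd_spec {ω : Tape} {σ : State} {len : ℕ} {b : ℝ} (hlen : σ.mem rLen 0 = len)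
    (hb : σ.mem rScale 0 = b) (hpos : σ.pos = 0) (h4 : ∀ a, σ.mem 4 a = 0) :
    Reaches ω noiseCmd σ (30 * len + 10) fun τ => ∀ a, τ.mem 4 a =
      if a < len then b * ω (a, .laplace) else 0 := by
  refine (forTo_spec (T := 15) (by decide) (by decide) (by decide) len
    (fun k τ => τ.pos = k ∧ ∀ a, τ.mem 4 a = if a < k then b * ω (a, .laplace) else 0)
    (fun k σ x h => by simpa using h) σ hlen (by simpa [hpos] using h4) ?_).mono (by omega)
    fun _ h => h.2
  rintro k hk σ' ⟨hpk, hI⟩ hkv hf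
  have hb' : σ'.mem rScale 0 = b := by rw [hf rScale (by decide) (by decide), hb]
  refine ⟨_, _, (Exec.sample 4 (var rPos) .laplace σ').seq (Exec.assign _ _ _ _), by decide,
    by simp [hpk], fun a => ?_⟩
  rcases eq_or_ne a k with rfl | hne
  · simp [hkv, hb', hpk]
  · simp only [eval_var, Mem.write_of_ne _ _ _ (show rPos ≠ 4 by decide), hkv, Nat.floor_natCast,
      Mem.write_self, Function.update_of_ne hne, hI a]
    congr 1
    simp only [eq_iff_iff]
    omega

/-- The curator. -/
def curatorCmd : Cmd :=
  setupCmd ;; binomCmd rCells rRad ;;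
  (setVar rScale ((var rFeats + 1) / .read 0 1) ;;
    setVar rLen (var rCells * var rFeats + 1) ;;
    setVar 3 (var rLen) ;;
    setVar rSize (.read 0 5)) ;;
  noiseCmd ;;
  .assign 4 0 (.read 4 0 + var rSize) ;;
  forTo rPt rSize pointCmd

/-- The word with index `a` of the message, before noise is added. -/
def exactWord {d : ℕ} (P : Params d) (X : List (Pt d)) (a : ℕ) : ℝ :=
  (X.map fun x => (if a = 0 then 1 else 0) + contrib d P.α (coords P.center) (coords x) a).sum

/-- The scale of the noise. -/
def noiseScale {d : ℕ} (P : Params d) : ℝ := (numFeats d P.α + 1) / P.ε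

/-- The message released by the curator. -/
def released {d : ℕ} (P : Params d) (X : List (Pt d)) (ω : Tape) : Message :=
  (msgLen d P.α P.Φ, fun a =>
    if a < msgLen d P.α P.Φ then exactWord P X a + noiseScale P * ω (a, .laplace) else 0)

/-- A bound for the running time of the curator. -/
def curatorTime (d n : ℕ) (α Φ : ℝ) : ℕ :=
  60 * d + 200 + 30 * msgLen d α Φ + n * (70 * d + 40 + cellTime d α + 40 * numFeats d α)

theorem exactWord_eq {d : ℕ} (P : Params d) (X : List (Pt d)) (a : ℕ) :
    exactWord P X a = (if a = 0 then (X.length : ℝ) else 0) +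
      (X.map fun x => contrib d P.α (coords P.center) (coords x) a).sum := by
  unfold exactWord
  induction X with
  | nil => simp
  | cons x X ih =>
    rw [List.map_cons, List.sum_cons, ih, List.map_cons, List.sum_cons, List.length_cons]
    split_ifs <;> push_cast <;> ring

/-- The noise is written first and the data are added on top, so the result is the exact words plus
independent noise, with a length that does not depend on the data. -/
theorem curatorCmd_spec {d : ℕ} (P : Params d) (hα : 0 < P.α) (hα₁ : P.α < 1) (hΦ : 0 < P.Φ)
    (X : List (Pt d)) (ω : Tape) :
    ∃ t ≤ curatorTime d X.length P.α P.Φ, CuratorRun curatorCmd P X ω (released P X ω) t := by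
  suffices h : Reaches ω curatorCmd (curatorInit P X) (curatorTime d X.length P.α P.Φ)
      fun τ => message τ = released P X ω by
    obtain ⟨τ, t, h₁, h₂, h₃⟩ := h
    exact ⟨t, h₂, τ, h₁, h₃⟩
  set σ := curatorInit P X with hσ
  have hd : σ.mem 0 0 = d := rfl
  refine ((setupCmd_spec hα hα₁ hΦ hd rfl rfl).and_pos ?_).seq (T₂ := (30 * d + 20) + (30 +
    ((30 * msgLen d P.α P.Φ + 10) + (7 + (X.length * ((70 * d + 20 + cellTime d P.α +
      40 * numFeats d P.α) + 13) + 10))))) ?_ |>.mono ?_ fun _ h => h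
  -- No sample is drawn before `noiseCmd`, so the counter is still `0` there.
  · simp [setupCmd, binomCmd, forTo, setVar, Cmd.SampleFree]
  · rintro τ₁ hτ₁ ⟨⟨⟨hs, hD, hR⟩, hN⟩, hp₁⟩
    refine ((binomCmd_spec (out := rCells) (top := rRad) (by decide) (by decide) (by decide)
      (by decide) (by rw [hτ₁ 0 (by decide), hd]) hR).and_pos ?_).seq ?_
    · simp [binomCmd, forTo, setVar, Cmd.SampleFree]
    rintro τ₂ hτ₂ ⟨hC, hp₂⟩
    have hN₂ : τ₂.mem rFeats 0 = numFeats d P.α := by rw [hτ₂ rFeats (by decide), hN]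
    have h0₂ : τ₂.mem 0 = header P X.length := by rw [hτ₂ 0 (by decide), hτ₁ 0 (by decide)]; rfl
    have h4₂ : ∀ a, τ₂.mem 4 a = 0 := fun a => by rw [hτ₂ 4 (by decide), hτ₁ 4 (by decide)]; rfl
    have h₃ : Reaches ω (setVar rScale ((var rFeats + 1) / .read 0 1) ;;
        setVar rLen (var rCells * var rFeats + 1) ;;
        setVar 3 (var rLen) ;; setVar rSize (.read 0 5)) τ₂ 30 fun τ =>
        τ.mem rScale 0 = noiseScale P ∧ τ.mem rLen 0 = msgLen d P.α P.Φ ∧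
        τ.mem 3 0 = msgLen d P.α P.Φ ∧ τ.mem rSize 0 = X.length ∧ τ.pos = 0 := by
      refine .of_straight rfl (by decide) ⟨?_, ?_, ?_, ?_, ?_⟩
      · simp [hN₂, h0₂, header, noiseScale]
      · simp [hN₂, hC, msgLen, numCells]
      · simp [hN₂, hC, msgLen, numCells]
      · simp [h0₂, header]
      · rw [hp₂, hp₁]
        rfl
    refine h₃.seq ?_
    rintro τ₃ hτ₃ ⟨hsc₃, hl₃, hm₃, hn₃, hp₃⟩
    refine (noiseCmd_spec hl₃ hsc₃ hp₃ fun a => by rw [hτ₃ 4 (by decide), h4₂]).seq ?_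
    intro τ₄ hτ₄ h4₄
    have hn₄ : τ₄.mem rSize 0 = X.length := by rw [hτ₄ rSize (by decide), hn₃]
    have h₅ : Reaches ω (.assign 4 0 (.read 4 0 + var rSize)) τ₄ 7 fun τ =>
        ∀ a, τ.mem 4 a = (if a < msgLen d P.α P.Φ then noiseScale P * ω (a, .laplace) else 0) +
          if a = 0 then (X.length : ℝ) else 0 := by
      refine .of_straight rfl (by decide) fun a => ?_
      rcases eq_or_ne a 0 with rfl | ha
      · simp [hn₄, h4₄]
      · simp [ha, h4₄]
    refine h₅.seq ?_
    intro τ₅ hτ₅ h4₅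
    have hfr : ∀ a ∈ [0, 1, 2, rSide, rDeg, rFeats], τ₅.mem a = τ₁.mem a := by
      intro a ha
      rw [hτ₅ a (by revert a; decide), hτ₄ a (by revert a; decide), hτ₃ a (by revert a; decide),
        hτ₂ a (by revert a; decide)]
    have hn₅ : τ₅.mem rSize 0 = X.length := by rw [hτ₅ rSize (by decide), hn₄]
    have hm₅ : τ₅.mem 3 0 = msgLen d P.α P.Φ := by
      rw [hτ₅ 3 (by decide), hτ₄ 3 (by decide), hm₃]
    refine (forTo_spec (by decide) (by decide) (by decide) X.length
      (fun k τ => ∀ a, τ.mem 4 a = τ₅.mem 4 a +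
        ((X.take k).map fun x => contrib d P.α (coords P.center) (coords x) a).sum)
      (fun k σ x h => by simpa using h) τ₅ hn₅ (by simp) ?_).and_frame.mono le_rfl ?_
    · intro k hk σ' hI hkv hf
      have hσ0 : σ'.mem 0 0 = d := by
        rw [hf 0 (by decide) (by decide), hfr 0 (by decide), hτ₁ 0 (by decide), hd]
      have hσ1 : σ'.mem 1 = coords P.center := by
        rw [hf 1 (by decide) (by decide), hfr 1 (by decide), hτ₁ 1 (by decide)]
        rfl
      refine (pointCmd_spec (α := P.α) (x := coords X[k]) (p := k) hσ0 ?_ ?_ ?_ hkv ?_).mono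
        le_rfl ?_
      · rw [hf rSide (by decide) (by decide), hfr rSide (by decide), hs]
      · rw [hf rDeg (by decide) (by decide), hfr rDeg (by decide), hD]
      · rw [hf rFeats (by decide) (by decide), hfr rFeats (by decide), hN]
      · intro j hj
        rw [hf 2 (by decide) (by decide), hfr 2 (by decide), hτ₁ 2 (by decide)]
        change coords (X.getD ((k * d + j) / d) 0) ((k * d + j) % d) = _
        rw [mul_comm, Nat.mul_add_div (by omega), Nat.div_eq_of_lt hj, add_zero,
          Nat.mul_add_mod, Nat.mod_eq_of_lt hj, List.getD_eq_getElem _ _ hk]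
      · intro τ h a
        rw [h a, hσ1, hI a, List.take_succ_eq_append_getElem hk, List.map_append,
          List.sum_append, add_assoc, List.map_singleton, List.sum_singleton]
    · rintro τ ⟨h, hf⟩
      have h3 : ⌊τ.mem 3 0⌋₊ = msgLen d P.α P.Φ := by
        rw [hf 3 (by decide), hm₅, Nat.floor_natCast]
      rw [message, h3, released]
      congr 1
      funext a
      split_ifs with ha
      · rw [h a, h4₅ a, if_pos ha, List.take_length, exactWord_eq]
        ring
      · rfl
  · unfold curatorTime
    nlinarith

/-! ### The client -/

/-- The `r`-th of the cells around the cell of `y`. -/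
def nearCell (s : ℝ) (c y : ℕ → ℝ) (r j : ℕ) : ℤ :=
  cellOf s c y j + ((r / 3 ^ j % 3 : ℕ) : ℤ) - 1

/-- Computes the current cell around the query, and the position of the query relative to it. -/
def nearCellCmd : Cmd :=
  setVar rRem (var rBox) ;;
  forTo rJ 0 (
    setVar rQuo (.un .floor (var rRem / 3)) ;;
    .assign aCell (var rJ) (.un .floor ((.read 3 (var rJ) - .read 1 (var rJ)) / var rSide) +
      (var rRem - 3 * var rQuo) - 1) ;;
    setVar rRem (var rQuo) ;;
    .assign aOff (var rJ) (.read 3 (var rJ) - .read 1 (var rJ) -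
      var rSide * .read aCell (var rJ)))

/-- The variable `rRem` holds `r / 3^k`; subtracting three times the next quotient leaves the
current ternary digit, and digit minus one is the displacement of the cell. -/
theorem nearCellCmd_spec {ω : Tape} {σ : State} {d r : ℕ} {s : ℝ}
    (hd : σ.mem 0 0 = d) (hs : σ.mem rSide 0 = s) (hr : σ.mem rBox 0 = r) :
    Reaches ω nearCellCmd σ (80 * d + 14) fun τ => ∀ j < d,
      τ.mem aCell j = nearCell s (σ.mem 1) (σ.mem 3) r j ∧
      τ.mem aOff j = offsetIn s (σ.mem 1) (σ.mem 3) (nearCell s (σ.mem 1) (σ.mem 3) r) j := by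
  have h₁ : Reaches ω (setVar rRem (var rBox)) σ 4 fun τ => τ.mem rRem 0 = r :=
    .of_straight rfl (by decide) (by simp [hr])
  refine (h₁.seq (T₂ := d * (60 + 13) + 10) ?_).mono (by omega) fun _ h => h
  intro τ hτ h0
  refine (forTo_spec (by decide) (by decide) (by decide) d
    (fun k τ => τ.mem rRem 0 = (r / 3 ^ k : ℕ) ∧ ∀ j < k,
      τ.mem aCell j = nearCell s (σ.mem 1) (σ.mem 3) r j ∧
      τ.mem aOff j = offsetIn s (σ.mem 1) (σ.mem 3) (nearCell s (σ.mem 1) (σ.mem 3) r) j)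
    (fun k σ x h => by simpa using h) τ (by rw [hτ 0 (by decide), hd]) (by simpa using h0)
    ?_).mono le_rfl fun _ h => h.2
  rintro k hk σ' ⟨hR, hI⟩ hkv hf
  have h1 : σ'.mem 1 = σ.mem 1 := by rw [hf 1 (by decide) (by decide), hτ 1 (by decide)]
  have h3 : σ'.mem 3 = σ.mem 3 := by rw [hf 3 (by decide) (by decide), hτ 3 (by decide)]
  have hs' : σ'.mem rSide 0 = s := by
    rw [hf rSide (by decide) (by decide), hτ rSide (by decide), hs]
  have hq : ((⌊((r / 3 ^ k : ℕ) : ℝ) / 3⌋ : ℤ) : ℝ) = (r / 3 ^ (k + 1) : ℕ) := by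
    rw [← natCast_floor_eq_intCast_floor (by positivity), Nat.floor_div_ofNat, Nat.floor_natCast,
      Nat.div_div_eq_div_mul, pow_succ]
  have hmod : ((r / 3 ^ k % 3 : ℕ) : ℝ) =
      ((r / 3 ^ k : ℕ) : ℝ) - 3 * ((r / 3 ^ (k + 1) : ℕ) : ℝ) := by
    rw [eq_sub_iff_add_eq, pow_succ, ← Nat.div_div_eq_div_mul]
    exact_mod_cast Nat.mod_add_div _ 3
  refine .of_straight rfl (by decide) ⟨?_, fun j hj => ?_⟩
  · simp [UnOp.eval, hR, hq]
  rcases Nat.lt_succ_iff_lt_or_eq.1 hj with hj | rfl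
  · simpa [hkv, hj.ne] using hI j hj
  · have hz : ((nearCell s (σ.mem 1) (σ.mem 3) r j : ℤ) : ℝ) =
        ((⌊(σ.mem 3 j - σ.mem 1 j) / s⌋ : ℤ) : ℝ) +
          (((r / 3 ^ j : ℕ) : ℝ) - 3 * ((r / 3 ^ (j + 1) : ℕ) : ℝ)) - 1 := by
      rw [← hmod]
      simp only [nearCell, cellOf, Int.cast_sub, Int.cast_add, Int.cast_natCast, Int.cast_one]
    rw [offsetIn, hz]
    simp [hkv, h1, h3, hs', UnOp.eval, hR, hq]

/-- Adds to `rTot` the products of the features in `aVal` and the words of the current cell. -/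
def dotCmd : Cmd :=
  forTo rI rFeats (setVar rTot (var rTot +
    .read aVal (var rI) * .read 2 (1 + var rRank * var rFeats + var rI)))

theorem dotCmd_spec {ω : Tape} {σ : State} {r N : ℕ} {f : ℕ → ℝ}
    (hr : σ.mem rRank 0 = r) (hN : σ.mem rFeats 0 = N) (hv : ∀ i < N, σ.mem aVal i = f i) :
    Reaches ω dotCmd σ (40 * N + 10) fun τ => τ.mem rTot 0 = σ.mem rTot 0 +
      ∑ i ∈ Finset.range N, f i * σ.mem 2 (1 + r * N + i) := by
  refine (forTo_spec (T := 27) (by decide) (by decide) (by decide) N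
    (fun k τ => τ.mem rTot 0 = σ.mem rTot 0 +
      ∑ i ∈ Finset.range k, f i * σ.mem 2 (1 + r * N + i))
    (fun k σ x h => by simpa using h) σ hN (by simp) ?_).mono (by omega) fun _ h => h
  intro k hk σ' hI hkv hf
  have hr' : σ'.mem rRank 0 = r := by rw [hf rRank (by decide) (by decide), hr]
  have hN' : σ'.mem rFeats 0 = N := by rw [hf rFeats (by decide) (by decide), hN]
  have hv' : σ'.mem aVal k = f k := by rw [hf aVal (by decide) (by decide), hv k hk]
  have h2 : σ'.mem 2 = σ.mem 2 := hf 2 (by decide) (by decide)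
  have hfl : ⌊(1 : ℝ) + r * N + k⌋₊ = 1 + r * N + k := by
    rw [← Nat.cast_one, ← Nat.cast_mul, ← Nat.cast_add, ← Nat.cast_add, Nat.floor_natCast]
  refine .of_straight rfl (by decide) ?_
  rw [Finset.sum_range_succ, ← add_assoc]
  simp [hkv, hr', hN', hfl, hv', h2, hI]

/-- The contribution of the cell `z` to the sum computed by the client. -/
def cellTerm (d : ℕ) (α Φ : ℝ) (c y : ℕ → ℝ) (w : ℕ → ℝ) (z : ℕ → ℤ) : ℝ :=
  if psum (zigzag ∘ z) d ≤ cellRad d α Φ then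
    ∑ i ∈ Finset.range (numFeats d α),
      featAt d α (offsetIn (cellSide α) c y z) i * w (cellAddr d α z + i)
  else 0

/-- Processes the current cell around the query. -/
def boxCmd : Cmd :=
  nearCellCmd ;; addressCmd ;; .ite (var rSum) (var rRad) (featCmd ;; dotCmd) .skip

theorem boxCmd_spec {ω : Tape} {σ : State} {d r : ℕ} {α Φ : ℝ}
    (hd : σ.mem 0 0 = d) (hs : σ.mem rSide 0 = cellSide α) (hD : σ.mem rDeg 0 = featDeg d α)
    (hR : σ.mem rRad 0 = cellRad d α Φ) (hN : σ.mem rFeats 0 = numFeats d α)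
    (hr : σ.mem rBox 0 = r) :
    Reaches ω boxCmd σ (80 * d + 30 + cellTime d α + 40 * numFeats d α)
      fun τ => τ.mem rTot 0 = σ.mem rTot 0 + cellTerm d α Φ (σ.mem 1) (σ.mem 3) (σ.mem 2)
        (nearCell (cellSide α) (σ.mem 1) (σ.mem 3) r) := by
  set z := nearCell (cellSide α) (σ.mem 1) (σ.mem 3) r with hz
  refine ((nearCellCmd_spec hd hs hr).seq (T₂ := (d * (28 * d + 90) + 20) +
    (5 + ((d * (numFeats d α * (60 * featDeg d α + 40) + 70) + 50) + (40 * numFeats d α + 10))))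
    ?_).mono (by unfold cellTime; omega) fun _ h => h
  intro τ₁ hτ₁ h₁
  refine (addressCmd_spec (z := z) (by rw [hτ₁ 0 (by decide), hd]) fun j hj => (h₁ j hj).1).seq ?_
  rintro τ₂ hτ₂ ⟨hS, hK⟩
  have hR₂ : τ₂.mem rRad 0 = cellRad d α Φ := by
    rw [hτ₂ rRad (by decide), hτ₁ rRad (by decide), hR]
  have hT₂ : τ₂.mem rTot 0 = σ.mem rTot 0 := by
    rw [hτ₂ rTot (by decide), hτ₁ rTot (by decide)]
  by_cases hc : psum (zigzag ∘ z) d ≤ cellRad d α Φ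
  · have hf := featCmd_spec_featAt (ω := ω) (σ := τ₂) (d := d) (α := α)
      (u := offsetIn (cellSide α) (σ.mem 1) (σ.mem 3) z)
      (by rw [hτ₂ 0 (by decide), hτ₁ 0 (by decide), hd])
      (by rw [hτ₂ rDeg (by decide), hτ₁ rDeg (by decide), hD])
      fun j hj => by rw [hτ₂ aOff (by decide), (h₁ j hj).2]
    have hrun : Reaches ω (featCmd ;; dotCmd) τ₂
        ((d * (numFeats d α * (60 * featDeg d α + 40) + 70) + 50) + (40 * numFeats d α + 10))
        fun τ => τ.mem rTot 0 = σ.mem rTot 0 +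
          cellTerm d α Φ (σ.mem 1) (σ.mem 3) (σ.mem 2) z := by
      refine hf.seq ?_
      intro τ₃ hτ₃ h₃
      refine (dotCmd_spec (N := numFeats d α)
        (f := featAt d α (offsetIn (cellSide α) (σ.mem 1) (σ.mem 3) z))
        (by rw [hτ₃ rRank (by decide), hK])
        (by rw [hτ₃ rFeats (by decide), hτ₂ rFeats (by decide), hτ₁ rFeats (by decide), hN])
        h₃).mono le_rfl ?_
      intro τ₄ h
      rw [h, hτ₃ rTot (by decide), hT₂, hτ₃ 2 (by decide), hτ₂ 2 (by decide), hτ₁ 2 (by decide),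
        cellTerm, if_pos hc]
      rfl
    obtain ⟨τ, t, e, ht, hQ⟩ := hrun
    refine ⟨τ, _, .iteTrue ?_ e, ?_, hQ⟩
    · simpa [hS, hR₂] using hc
    · have : (var rSum).cost + (var rRad).cost + 1 = 5 := rfl
      omega
  · refine ⟨τ₂, _, .iteFalse ?_ (.skip _), ?_, ?_⟩
    · simpa [hS, hR₂] using hc
    · have : (var rSum).cost + (var rRad).cost + 1 = 5 := rfl
      omega
    · simp only [hT₂, cellTerm, if_neg hc, add_zero]

/-- The client. -/
def clientCmd : Cmd :=
  setupCmd ;;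
  (setVar rPow 1 ;; setVar rTot 0) ;;
  forTo rJ 0 (setVar rPow (var rPow * 3)) ;;
  forTo rBox rPow boxCmd ;;
  setVar 4 (var rTot / .read 2 0) ;;
  .ite 0 (var 4) .skip (setVar 4 0) ;;
  .ite (var 4) 1 .skip (setVar 4 1)

/-- The sum computed by the client. -/
def clientSum {d : ℕ} (P : Params d) (w : ℕ → ℝ) (y : Pt d) : ℝ :=
  ∑ r ∈ Finset.range (3 ^ d), cellTerm d P.α P.Φ (coords P.center) (coords y) w
    (nearCell (cellSide P.α) (coords P.center) (coords y) r)

/-- The answer of the client. -/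
def estimate {d : ℕ} (P : Params d) (M : Message) (y : Pt d) : ℝ :=
  min (max (clientSum P M.2 y / M.2 0) 0) 1

/-- A bound for the running time of the client. -/
def clientTime (d : ℕ) (α : ℝ) : ℕ :=
  60 * d + 200 + 3 ^ d * (80 * d + 50 + cellTime d α + 40 * numFeats d α)

theorem clientCmd_sampleFree : clientCmd.SampleFree := by
  simp [clientCmd, setupCmd, binomCmd, boxCmd, nearCellCmd, addressCmd, featCmd, growCmd, dotCmd,
    forTo, setVar, Cmd.SampleFree]

theorem clientCmd_reaches {d : ℕ} (P : Params d) (hα : 0 < P.α) (hα₁ : P.α < 1) (hΦ : 0 < P.Φ)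
    (M : Message) (y : Pt d) (ω : Tape) :
    Reaches ω clientCmd (clientInit P M y) (clientTime d P.α)
      fun τ => τ.mem 4 0 = estimate P M y := by
  set σ := clientInit P M y with hσ
  have hd : σ.mem 0 0 = d := rfl
  refine (setupCmd_spec hα hα₁ hΦ hd rfl rfl).seq (T₂ := 6 + ((d * (6 + 13) + 10) + (3 ^ d *
    ((80 * d + 30 + cellTime d P.α + 40 * numFeats d P.α) + 13) + 10 + 30))) ?_ |>.mono ?_
    fun _ h => h
  · rintro τ₁ hτ₁ ⟨⟨hs, hD, hR⟩, hN⟩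
    have h₂ : Reaches ω (setVar rPow 1 ;; setVar rTot 0) τ₁ 6
        fun τ => τ.mem rPow 0 = 1 ∧ τ.mem rTot 0 = 0 :=
      .of_straight rfl (by decide) (by simp)
    refine h₂.seq ?_
    rintro τ₂ hτ₂ ⟨hw, ht⟩
    have h₃ : Reaches ω (forTo rJ 0 (setVar rPow (var rPow * 3))) τ₂ (d * (6 + 13) + 10)
        fun τ => τ.mem rPow 0 = (3 ^ d : ℕ) := by
      refine (forTo_spec (by decide) (by decide) (by decide) d
        (fun k τ => τ.mem rPow 0 = (3 ^ k : ℕ)) (fun k σ x h => by simpa using h) τ₂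
        (by rw [hτ₂ 0 (by decide), hτ₁ 0 (by decide), hd]) (by simpa using hw) ?_)
      intro k _ σ' hI _ _
      refine .of_straight rfl (by decide) ?_
      simp [hI, pow_succ]
    refine h₃.seq ?_
    intro τ₃ hτ₃ hw₃
    have hfr : ∀ a ∈ [0, 1, 2, 3, rSide, rDeg, rRad, rFeats], τ₃.mem a = τ₁.mem a := by
      intro a ha
      rw [hτ₃ a (by revert a; decide), hτ₂ a (by revert a; decide)]
    have hfr' : ∀ a ∈ [0, 1, 2, 3], τ₁.mem a = σ.mem a := by
      intro a ha
      rw [hτ₁ a (by revert a; decide)]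
    refine Reaches.seq (Q := fun τ => τ.mem rTot 0 = clientSum P M.2 y) (T₁ := 3 ^ d *
      ((80 * d + 30 + cellTime d P.α + 40 * numFeats d P.α) + 13) + 10) ?_ ?_
    · refine forTo_spec (by decide) (by decide) (by decide) (3 ^ d)
        (fun k τ => τ.mem rTot 0 = ∑ r ∈ Finset.range k, cellTerm d P.α P.Φ (coords P.center)
          (coords y) M.2 (nearCell (cellSide P.α) (coords P.center) (coords y) r))
        (fun k σ x h => by simpa using h) τ₃ hw₃ ?_ ?_
      · rw [hτ₃ rTot (by decide), ht]
        simp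
      intro k _ σ' hI hkv hf
      have h1 : σ'.mem 1 = coords P.center := by
        rw [hf 1 (by decide) (by decide), hfr 1 (by decide), hfr' 1 (by decide)]
        rfl
      have h2 : σ'.mem 2 = M.2 := by
        rw [hf 2 (by decide) (by decide), hfr 2 (by decide), hfr' 2 (by decide)]
        rfl
      have h3 : σ'.mem 3 = coords y := by
        rw [hf 3 (by decide) (by decide), hfr 3 (by decide), hfr' 3 (by decide)]
        rfl
      refine (boxCmd_spec (d := d) (α := P.α) (Φ := P.Φ) ?_ ?_ ?_ ?_ ?_ hkv).mono le_rfl ?_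
      · rw [hf 0 (by decide) (by decide), hfr 0 (by decide), hfr' 0 (by decide), hd]
      · rw [hf rSide (by decide) (by decide), hfr rSide (by decide), hs]
      · rw [hf rDeg (by decide) (by decide), hfr rDeg (by decide), hD]
      · rw [hf rRad (by decide) (by decide), hfr rRad (by decide), hR]
      · rw [hf rFeats (by decide) (by decide), hfr rFeats (by decide), hN]
      · intro τ h
        rw [h, h1, h2, h3, hI, Finset.sum_range_succ]
    · intro τ₄ hτ₄ hT
      have h2 : τ₄.mem 2 0 = M.2 0 := by
        rw [hτ₄ 2 (by decide), hfr 2 (by decide), hfr' 2 (by decide)]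
        rfl
      refine .of_straight rfl (by decide) ?_
      rw [estimate]
      -- The machine and `estimate` use the same total division, so a vanishing or negative noisy
      -- count needs no separate case.
      generalize hv : clientSum P M.2 y / M.2 0 = v
      have hv' : τ₄.mem rTot 0 / τ₄.mem 2 0 = v := by rw [hT, h2, hv]
      by_cases h0 : 0 ≤ v
      · by_cases h1 : v ≤ 1
        · simp [Cmd.run, hv', h0, h1]
        · simp [Cmd.run, hv', h0, h1, le_of_not_ge h1]
      · simp [Cmd.run, hv', h0, le_of_not_ge h0]
  · unfold clientTime
    have : 3 ^ d * ((80 * d + 30 + cellTime d P.α + 40 * numFeats d P.α) + 13) ≤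
        3 ^ d * (80 * d + 50 + cellTime d P.α + 40 * numFeats d P.α) :=
      Nat.mul_le_mul_left _ (by omega)
    omega

theorem clientCmd_spec {d : ℕ} (P : Params d) (hα : 0 < P.α) (hα₁ : P.α < 1) (hΦ : 0 < P.Φ)
    (M : Message) (y : Pt d) :
    ∃ t ≤ clientTime d P.α, ClientRun clientCmd P M y (estimate P M y) t := by
  -- The run on the zero tape serves for all tapes, since the client never samples.
  obtain ⟨τ, t, e, ht, hQ⟩ := clientCmd_reaches P hα hα₁ hΦ M y fun _ => 0
  exact ⟨t, ht, fun ω => ⟨τ, e.tape_congr ω clientCmd_sampleFree, hQ⟩⟩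

/-! ### The Laplace mechanism -/

/-- The shifted density exceeds the original one by at most the factor `exp |δ|`, by the reverse
triangle inequality in the exponent. -/
theorem laplaceMeasure_map_add_le (δ : ℝ) :
    laplaceMeasure.map (· + δ) ≤ (Real.exp |δ|).toNNReal • laplaceMeasure := by
  refine Measure.le_iff.2 fun s hs => ?_
  have hm : Measurable fun x : ℝ => ENNReal.ofReal (Real.exp (-|x|) / 2) := by fun_prop
  rw [Measure.map_apply (measurable_add_const δ) hs, laplaceMeasure,
    withDensity_apply _ (measurable_add_const δ hs), Measure.smul_apply,
    withDensity_apply _ hs, ENNReal.smul_def, smul_eq_mul,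
    ← lintegral_const_mul _ hm]
  have h := (measurePreserving_add_right volume δ).setLIntegral_comp_preimage hs
    (f := fun x => ENNReal.ofReal (Real.exp (-|x - δ|) / 2)) (by fun_prop)
  simp only [add_sub_cancel_right] at h
  rw [h]
  refine lintegral_mono fun x => ?_
  change ENNReal.ofReal _ ≤ ENNReal.ofReal _ * _
  rw [← ENNReal.ofReal_mul (Real.exp_pos _).le]
  refine ENNReal.ofReal_le_ofReal ?_
  rw [← mul_div_assoc, ← Real.exp_add]
  gcongr
  have := abs_sub_abs_le_abs_sub x (x - δ)
  rw [sub_sub_cancel] at this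
  linarith

/-- The outer measure that defines a product is the largest one bounded on boxes by the products of
the side measures, so a comparison on boxes suffices. -/
theorem pi_mono {ι : Type*} [Fintype ι] {E : ι → Type*} [∀ i, MeasurableSpace (E i)]
    {μ ν : ∀ i, Measure (E i)} [∀ i, SigmaFinite (μ i)] (h : ∀ i, μ i ≤ ν i) :
    Measure.pi μ ≤ Measure.pi ν := by
  refine Measure.le_iff.2 fun s hs => ?_
  have h₁ : (Measure.pi μ).toOuterMeasure ≤ OuterMeasure.pi fun i => (ν i).toOuterMeasure := by
    rw [OuterMeasure.le_pi]
    intro t _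
    change Measure.pi μ _ ≤ _
    rw [Measure.pi_pi]
    exact Finset.prod_le_prod' fun i _ => h i _
  calc Measure.pi μ s ≤ (OuterMeasure.pi fun i => (ν i).toOuterMeasure) s := h₁ s
    _ ≤ Measure.pi ν s := by
      rw [Measure.pi]
      exact le_toMeasure_apply _ _ _

theorem pi_smul {ι : Type*} [Fintype ι] {E : ι → Type*} [∀ i, MeasurableSpace (E i)]
    (μ : ∀ i, Measure (E i)) [∀ i, IsFiniteMeasure (μ i)] (c : ι → NNReal) :
    Measure.pi (fun i => c i • μ i) = (∏ i, c i) • Measure.pi μ := by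
  refine Measure.pi_eq fun s _ => ?_
  simp only [Measure.smul_apply, Measure.pi_pi, ENNReal.smul_def, smul_eq_mul,
    Finset.prod_mul_distrib, ENNReal.ofNNReal_finsetProd]

/-- The one-dimensional factors `exp |δ i|` multiply to the exponential of the `ℓ¹`-norm of the
shift; this is why the noise is calibrated to `ℓ¹`-sensitivity. -/
theorem pi_laplace_preimage_add_le {n : ℕ} (δ : Fin n → ℝ) {A : Set (Fin n → ℝ)}
    (hA : MeasurableSet A) :
    Measure.pi (fun _ => laplaceMeasure) ((· + δ) ⁻¹' A) ≤
      ENNReal.ofReal (Real.exp (∑ i, |δ i|)) * Measure.pi (fun _ => laplaceMeasure) A := by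
  have hm : Measurable fun w : Fin n → ℝ => w + δ := by fun_prop
  have h₁ : (Measure.pi fun _ : Fin n => laplaceMeasure).map (fun w => w + δ) =
      Measure.pi fun i => laplaceMeasure.map (· + δ i) :=
    have : ∀ i, IsProbabilityMeasure (laplaceMeasure.map (· + δ i)) := fun i =>
      Measure.isProbabilityMeasure_map (by fun_prop)
    Measure.pi_map_pi (f := fun i x => x + δ i) fun i => by fun_prop
  have : ∀ i, IsProbabilityMeasure (laplaceMeasure.map (· + δ i)) := fun i =>
    Measure.isProbabilityMeasure_map (by fun_prop)
  have h₂ := pi_mono fun i => laplaceMeasure_map_add_le (δ i)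
  rw [pi_smul, ← h₁] at h₂
  have h₃ := h₂ A
  rw [Measure.map_apply hm hA, Measure.smul_apply, ENNReal.smul_def, smul_eq_mul] at h₃
  convert h₃ using 2
  rw [Real.exp_sum, ENNReal.ofReal, Real.toNNReal_prod_of_nonneg fun i _ => (Real.exp_pos _).le]

instance : IsProbabilityMeasure tapeMeasure := by
  unfold tapeMeasure
  infer_instance

/-- Both sides agree on boxes: a box in finitely many coordinates pulls back to a cylinder of the
tape space. -/
theorem tapeMeasure_map_laplace (n : ℕ) :
    tapeMeasure.map (fun ω (a : Fin n) => ω (a, .laplace)) =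
      Measure.pi fun _ => laplaceMeasure := by
  symm
  refine Measure.pi_eq fun s hs => ?_
  rw [Measure.map_apply (by fun_prop) (MeasurableSet.univ_pi hs)]
  set e : Fin n ↪ ℕ × Source := ⟨fun a => (a, .laplace), fun a b h => by
    simpa [Fin.ext_iff] using h⟩ with he
  set t : ℕ × Source → Set ℝ := fun i => if h : i.1 < n then s ⟨i.1, h⟩ else Set.univ with ht
  have hte : ∀ a, t (e a) = s a := fun a => by
    change (if h : (a : ℕ) < n then s ⟨a, h⟩ else Set.univ) = s a
    rw [dif_pos a.2]
  have hset : (fun (ω : Tape) (a : Fin n) => ω (a, .laplace)) ⁻¹' Set.univ.pi s =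
      Set.pi (Finset.univ.map e : Finset (ℕ × Source)) t := by
    ext ω
    simp only [Set.mem_preimage, Set.mem_pi, Set.mem_univ, true_imp_iff, Finset.mem_coe,
      Finset.mem_map, Finset.mem_univ, true_and, forall_exists_index, forall_apply_eq_imp_iff, hte]
    rfl
  rw [hset, tapeMeasure, Measure.infinitePi_pi, Finset.prod_map]
  · exact Finset.prod_congr rfl fun a _ => by
      rw [hte]
      rfl
  · intro i _
    simp only [ht]
    split_ifs
    · exact hs _
    · exact MeasurableSet.univ

/-! ### Tails of the noise -/

theorem laplaceMeasure_abs_gt {t : ℝ} (ht : 0 ≤ t) :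
    laplaceMeasure {x | t < |x|} = ENNReal.ofReal (Real.exp (-t)) := by
  have hs : MeasurableSet {x : ℝ | t < |x|} := measurableSet_lt measurable_const (by fun_prop)
  have hint : ∫ x : ℝ, (Set.Ioi t).indicator (fun x => Real.exp (-x) / 2) |x| = Real.exp (-t) := by
    rw [integral_comp_abs (f := (Set.Ioi t).indicator fun x => Real.exp (-x) / 2),
      setIntegral_indicator measurableSet_Ioi, Set.inter_eq_right.2 (Set.Ioi_subset_Ioi ht),
      integral_div, integral_exp_neg_Ioi]
    ring
  have hi : Integrable fun x : ℝ => (Set.Ioi t).indicator (fun x => Real.exp (-x) / 2) |x| := by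
    by_contra h
    rw [integral_undef h] at hint
    exact (Real.exp_pos _).ne hint
  rw [laplaceMeasure, withDensity_apply _ hs, ← lintegral_indicator hs, ← hint,
    ofReal_integral_eq_lintegral_ofReal hi (Filter.Eventually.of_forall fun x =>
      Set.indicator_nonneg (fun y _ => by positivity) _)]
  refine lintegral_congr fun x => ?_
  by_cases h : t < |x| <;> simp [Set.indicator, h]

theorem tapeMeasure_abs_gt (a : ℕ) {t : ℝ} (ht : 0 ≤ t) :
    tapeMeasure {ω | t < |ω (a, .laplace)|} = ENNReal.ofReal (Real.exp (-t)) := by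
  rw [← laplaceMeasure_abs_gt ht]
  have h : tapeMeasure.map (fun ω => ω (a, Source.laplace)) = laplaceMeasure :=
    Measure.infinitePi_map_eval (fun i : ℕ × Source => i.2.law) (a, .laplace)
  rw [← h, Measure.map_apply (by fun_prop) (measurableSet_lt measurable_const (by fun_prop))]
  rfl

/-- With probability at least `1 - m exp (-t)`, the samples at `m` given positions are at most
`t` in absolute value. -/
theorem tapeMeasure_forall_abs_le (I : Finset ℕ) {t η : ℝ} (ht : 0 ≤ t) (hη : 0 ≤ η)
    (h : I.card * Real.exp (-t) ≤ η) :
    ENNReal.ofReal (1 - η) ≤ tapeMeasure {ω | ∀ a ∈ I, |ω (a, .laplace)| ≤ t} := by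
  have hm : MeasurableSet {ω : Tape | ∀ a ∈ I, |ω (a, .laplace)| ≤ t} := by
    have : {ω : Tape | ∀ a ∈ I, |ω (a, .laplace)| ≤ t} =
        ⋂ a ∈ I, {ω : Tape | |ω (a, .laplace)| ≤ t} := by ext; simp
    rw [this]
    exact Finset.measurableSet_biInter _ fun a _ =>
      measurableSet_le (by fun_prop) measurable_const
  have hc : tapeMeasure {ω | ∀ a ∈ I, |ω (a, .laplace)| ≤ t}ᶜ ≤ ENNReal.ofReal η := by
    have : {ω : Tape | ∀ a ∈ I, |ω (a, .laplace)| ≤ t}ᶜ =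
        ⋃ a ∈ I, {ω : Tape | t < |ω (a, .laplace)|} := by ext; simp
    rw [this]
    refine (measure_biUnion_finset_le _ _).trans ?_
    simp only [tapeMeasure_abs_gt _ ht, Finset.sum_const, nsmul_eq_mul]
    refine le_trans (le_of_eq ?_) (ENNReal.ofReal_le_ofReal h)
    rw [ENNReal.ofReal_mul (by positivity), ENNReal.ofReal_natCast]
  rw [ENNReal.ofReal_sub _ hη, ENNReal.ofReal_one, tsub_le_iff_right]
  calc (1 : ENNReal) = tapeMeasure Set.univ := measure_univ.symm
    _ = _ := (measure_add_measure_compl hm).symm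
    _ ≤ _ := by gcongr

/-- The map that sends exact words and noise to the message. -/
def packMessage (n : ℕ) (w : Fin n → ℝ) : Message :=
  (n, fun a => if h : a < n then w ⟨a, h⟩ else 0)

theorem measurable_packMessage (n : ℕ) : Measurable (packMessage n) := by
  refine Measurable.prodMk measurable_const (measurable_pi_lambda _ fun a => ?_)
  by_cases h : a < n
  · simp only [h, dite_true]
    exact measurable_pi_apply _
  · simp only [h, dite_false]
    exact measurable_const

/-- The Laplace mechanism is private. -/
theorem laplace_mechanism {n : ℕ} {b ε : ℝ} (hb : 0 < b) (V W : Fin n → ℝ)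
    (h : ∑ i, |V i - W i| ≤ ε * b) {O : Set Message} (hO : MeasurableSet O) :
    tapeMeasure {ω | packMessage n (fun a => V a + b * ω (a, .laplace)) ∈ O} ≤
      ENNReal.ofReal (Real.exp ε) *
        tapeMeasure {ω | packMessage n (fun a => W a + b * ω (a, .laplace)) ∈ O} := by
  set A : (Fin n → ℝ) → Set (Fin n → ℝ) := fun V =>
    {w | packMessage n (fun a => V a + b * w a) ∈ O} with hA
  have hAm : ∀ V, MeasurableSet (A V) := fun V =>
    (measurable_packMessage n).comp (measurable_pi_lambda (fun (w : Fin n → ℝ) a => V a + b * w a)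
      fun a => by fun_prop) hO
  have hlaw : ∀ V : Fin n → ℝ,
      tapeMeasure {ω | packMessage n (fun a => V a + b * ω (a, .laplace)) ∈ O} =
        Measure.pi (fun _ => laplaceMeasure) (A V) := by
    intro V
    rw [← tapeMeasure_map_laplace, Measure.map_apply (by fun_prop) (hAm V)]
    rfl
  rw [hlaw, hlaw]
  -- Exchanging the exact words `V` for `W` amounts to translating the unscaled noise by `(V -
  -- W)/b`.
  have hshift : A V = (· + fun i => (V i - W i) / b) ⁻¹' A W := by
    ext w
    simp only [hA, Set.mem_ofPred_eq, Set.mem_preimage, Pi.add_apply]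
    have : (fun a => V a + b * w a) = fun a => W a + b * (w a + (V a - W a) / b) := by
      funext a
      field_simp
      ring
    rw [this]
  rw [hshift]
  refine (pi_laplace_preimage_add_le _ (hAm W)).trans ?_
  gcongr
  simp only [abs_div, abs_of_pos hb, ← Finset.sum_div]
  rwa [div_le_iff₀ hb]

/-! ### Privacy of the curator -/

theorem released_eq_packMessage {d : ℕ} (P : Params d) (X : List (Pt d)) (ω : Tape) :
    released P X ω = packMessage (msgLen d P.α P.Φ)
      (fun a => exactWord P X a + noiseScale P * ω (a, .laplace)) := by
  simp [released, packMessage]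

theorem measurable_released {d : ℕ} (P : Params d) (X : List (Pt d)) :
    Measurable (released P X) := by
  simp only [funext (released_eq_packMessage P X)]
  exact (measurable_packMessage _).comp (measurable_pi_lambda _ fun a => by fun_prop)

theorem abs_featAt_le (d : ℕ) (α : ℝ) (u : ℕ → ℝ) (i : ℕ) : |featAt d α u i| ≤ 1 :=
  abs_feature_le _ _ _

/-- The sensitivity bound: a point adds `1` to the count and touches one block of `N = numFeats d α`
words, each by at most `1`. -/
theorem sum_abs_contrib_le (d : ℕ) (α : ℝ) (c x : ℕ → ℝ) (n : ℕ) :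
    ∑ a ∈ Finset.range n, |(if a = 0 then 1 else 0) + contrib d α c x a| ≤ numFeats d α + 1 := by
  set r := cellAddr d α (cellOf (cellSide α) c x) with hr
  calc ∑ a ∈ Finset.range n, |(if a = 0 then 1 else 0) + contrib d α c x a|
      ≤ ∑ a ∈ Finset.range n, ((if a = 0 then 1 else 0) +
          if a ∈ Finset.Ico r (r + numFeats d α) then (1 : ℝ) else 0) := by
        refine Finset.sum_le_sum fun a _ => (abs_add_le _ _).trans (add_le_add ?_ ?_)
        · split_ifs <;> simp
        · rw [contrib]
          simp only [Finset.mem_Ico]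
          split_ifs
          · exact abs_featAt_le _ _ _ _
          · simp
    _ ≤ numFeats d α + 1 := by
        rw [Finset.sum_add_distrib, Finset.sum_ite_eq', Finset.sum_ite_mem, add_comm]
        refine add_le_add ?_ (by split_ifs <;> simp)
        rw [Finset.sum_const, nsmul_eq_mul, mul_one, Nat.cast_le]
        exact (Finset.card_le_card Finset.inter_subset_right).trans (by simp)

theorem exactWord_perm {d : ℕ} (P : Params d) {X Y : List (Pt d)} (h : X.Perm Y) (a : ℕ) :
    exactWord P X a = exactWord P Y a :=
  (h.map _).sum_eq

theorem sum_abs_exactWord_sub_le {d : ℕ} (P : Params d) {X Y : List (Pt d)} {x : Pt d}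
    (h : X.Perm (x :: Y)) (n : ℕ) :
    ∑ a ∈ Finset.range n, |exactWord P X a - exactWord P Y a| ≤ numFeats d P.α + 1 := by
  have : ∀ a, exactWord P X a - exactWord P Y a =
      (if a = 0 then 1 else 0) + contrib d P.α (coords P.center) (coords x) a := by
    intro a
    rw [exactWord_perm P h]
    simp [exactWord]
  simp only [this]
  exact sum_abs_contrib_le _ _ _ _ _

theorem noiseScale_pos {d : ℕ} (P : Params d) (hε : 0 < P.ε) : 0 < noiseScale P := by
  unfold noiseScale
  positivity

theorem isDP_released {d : ℕ} (P : Params d) (hε : 0 < P.ε) (dom : List (Pt d) → Prop) :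
    IsDP P.ε dom (released P) := by
  refine ⟨fun X _ => measurable_released P X, fun X Y _ _ hXY O hO => ?_⟩
  simp only [released_eq_packMessage]
  refine laplace_mechanism (noiseScale_pos P hε) (fun a => exactWord P X a)
    (fun a => exactWord P Y a) ?_ hO
  have hs : P.ε * noiseScale P = numFeats d P.α + 1 := by
    unfold noiseScale
    field_simp
  rw [hs, ← Finset.sum_range (fun a => |exactWord P X a - exactWord P Y a|)]
  obtain ⟨x, h | h⟩ := hXY
  · exact sum_abs_exactWord_sub_le P h _
  · simp only [abs_sub_comm (exactWord P X _)]
    exact sum_abs_exactWord_sub_le P h _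

/-! ### Accuracy -/

theorem exists_digits {d : ℕ} (δ : ℕ → ℕ) (hδ : ∀ j < d, δ j < 3) :
    ∃ r < 3 ^ d, ∀ j < d, r / 3 ^ j % 3 = δ j := by
  set f : Fin d → Fin 3 := fun j => ⟨δ j, hδ j j.2⟩ with hf
  refine ⟨finFunctionFinEquiv f, (finFunctionFinEquiv f).2, fun j hj => ?_⟩
  have h := congrFun (finFunctionFinEquiv.symm_apply_apply f) ⟨j, hj⟩
  exact congrArg Fin.val h

theorem digits_injective {d r r' : ℕ} (hr : r < 3 ^ d) (hr' : r' < 3 ^ d)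
    (h : ∀ j < d, r / 3 ^ j % 3 = r' / 3 ^ j % 3) : r = r' := by
  have heq : finFunctionFinEquiv.symm (⟨r, hr⟩ : Fin (3 ^ d)) =
      finFunctionFinEquiv.symm (⟨r', hr'⟩ : Fin (3 ^ d)) := by
    funext j
    exact Fin.ext (h j j.2)
  exact congrArg Fin.val (finFunctionFinEquiv.symm.injective heq)

/-- The cell `z` is one of the cells around `y` which the client considers. -/
def IsNear (d : ℕ) (s : ℝ) (c y : ℕ → ℝ) (z : ℕ → ℤ) : Prop :=
  ∃ r < 3 ^ d, ∀ j < d, nearCell s c y r j = z j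

open Classical in
-- No line of reasoning about multiplicities is needed later: distinct ternary codes give distinct
-- cells, so a cell near `y` is visited exactly once.
theorem sum_ite_nearCell_eq (d : ℕ) (s : ℝ) (c y : ℕ → ℝ) (z : ℕ → ℤ) (g : ℝ) :
    ∑ r ∈ Finset.range (3 ^ d), (if ∀ j < d, z j = nearCell s c y r j then g else 0) =
      if IsNear d s c y z then g else 0 := by
  split_ifs with h
  · obtain ⟨r, hr, h⟩ := h
    rw [Finset.sum_eq_single r]
    · rw [if_pos fun j hj => (h j hj).symm]
    · intro r' hr' hne
      rw [if_neg]
      intro h'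
      refine hne (digits_injective (Finset.mem_range.1 hr') hr fun j hj => ?_)
      have := (h j hj).trans (h' j hj)
      unfold nearCell at this
      omega
    · intro h
      exact absurd (Finset.mem_range.2 hr) h
  · refine Finset.sum_eq_zero fun r hr => if_neg fun h' => h ?_
    exact ⟨r, Finset.mem_range.1 hr, fun j hj => (h' j hj).symm⟩

theorem IsNear.bounds {d : ℕ} {s : ℝ} {c y : ℕ → ℝ} {z : ℕ → ℤ} (h : IsNear d s c y z) {j : ℕ}
    (hj : j < d) : cellOf s c y j - 1 ≤ z j ∧ z j ≤ cellOf s c y j + 1 := by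
  obtain ⟨r, -, h⟩ := h
  rw [← h j hj]
  unfold nearCell
  omega

theorem exists_of_not_isNear {d : ℕ} {s : ℝ} {c y : ℕ → ℝ} {z : ℕ → ℤ}
    (h : ¬ IsNear d s c y z) :
    ∃ j < d, z j < cellOf s c y j - 1 ∨ cellOf s c y j + 1 < z j := by
  by_contra! hcon
  refine h ?_
  obtain ⟨r, hr, hd⟩ := exists_digits (d := d) (fun j => (z j - cellOf s c y j + 1).toNat)
    fun j hj => by
      have := hcon j hj
      omega
  refine ⟨r, hr, fun j hj => ?_⟩
  have := hcon j hj
  unfold nearCell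
  rw [hd j hj]
  omega

theorem mul_cellOf_le {s : ℝ} (hs : 0 < s) (c x : ℕ → ℝ) (j : ℕ) : s * cellOf s c x j ≤ x j - c j := by
  have := Int.floor_le ((x j - c j) / s)
  rw [le_div_iff₀ hs] at this
  unfold cellOf
  linarith

theorem lt_mul_cellOf_add {s : ℝ} (hs : 0 < s) (c x : ℕ → ℝ) (j : ℕ) :
    x j - c j < s * cellOf s c x j + s := by
  have := Int.lt_floor_add_one ((x j - c j) / s)
  rw [div_lt_iff₀ hs] at this
  unfold cellOf
  linarith

/-- The data point lies in its cell, so its offset is at most `s`; the query is at most one cell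
away, so its offset from the same corner is at most `2s`. -/
theorem abs_offsetIn_mul_le {s : ℝ} (hs : 0 < s) (c x y : ℕ → ℝ) {d : ℕ}
    (h : IsNear d s c y (cellOf s c x)) {j : ℕ} (hj : j < d) :
    |offsetIn s c x (cellOf s c x) j * offsetIn s c y (cellOf s c x) j| ≤ 2 * s ^ 2 := by
  obtain ⟨h₁, h₂⟩ := h.bounds hj
  have h₁' : (cellOf s c y j : ℝ) - 1 ≤ cellOf s c x j := by exact_mod_cast h₁
  have h₂' : (cellOf s c x j : ℝ) ≤ cellOf s c y j + 1 := by exact_mod_cast h₂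
  have hu : |offsetIn s c x (cellOf s c x) j| ≤ s := by
    rw [offsetIn, abs_le]
    constructor <;> linarith [mul_cellOf_le hs c x j, lt_mul_cellOf_add hs c x j]
  have hv : |offsetIn s c y (cellOf s c x) j| ≤ 2 * s := by
    rw [offsetIn, abs_le]
    constructor <;> nlinarith [mul_cellOf_le hs c y j, lt_mul_cellOf_add hs c y j]
  rw [abs_mul]
  calc _ ≤ s * (2 * s) := by gcongr
    _ = _ := by ring

/-- In some coordinate the two cells differ by at least two, so a full cell of width `s` lies
between the points. -/
theorem sq_le_of_not_isNear {s : ℝ} (hs : 0 < s) (c x y : ℕ → ℝ) {d : ℕ}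
    (h : ¬ IsNear d s c y (cellOf s c x)) :
    s ^ 2 ≤ ∑ j ∈ Finset.range d, (x j - y j) ^ 2 := by
  obtain ⟨j, hj, h⟩ := exists_of_not_isNear h
  refine le_trans ?_ (Finset.single_le_sum (f := fun j => (x j - y j) ^ 2)
    (fun _ _ => sq_nonneg _) (Finset.mem_range.2 hj))
  rw [← sq_abs (x j - y j)]
  refine pow_le_pow_left₀ hs.le ?_ 2
  have h₁ := mul_cellOf_le hs c x j
  have h₂ := lt_mul_cellOf_add hs c x j
  have h₃ := mul_cellOf_le hs c y j
  have h₄ := lt_mul_cellOf_add hs c y j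
  rcases h with h | h
  · have h' : (cellOf s c x j : ℝ) + 2 ≤ cellOf s c y j := by exact_mod_cast (by omega)
    have := mul_le_mul_of_nonneg_left h' hs.le
    rw [abs_sub_comm]
    exact le_trans (by linarith) (le_abs_self _)
  · have h' : (cellOf s c y j : ℝ) + 2 ≤ cellOf s c x j := by exact_mod_cast (by omega)
    have := mul_le_mul_of_nonneg_left h' hs.le
    exact le_trans (by linarith) (le_abs_self _)

theorem coords_of_lt {d : ℕ} (x : Pt d) (j : Fin d) : coords x j = x j := by
  simp [coords]

theorem norm_sub_sq_eq {d : ℕ} (x y : Pt d) :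
    ‖x - y‖ ^ 2 = ∑ j ∈ Finset.range d, (coords x j - coords y j) ^ 2 := by
  rw [EuclideanSpace.real_norm_sq_eq, Finset.sum_range]
  simp only [coords_of_lt, PiLp.sub_apply]

/-- By Cauchy–Schwarz the `ℓ¹`-distance to the center is at most `√d Φ`, and a coordinate at
distance `w` from the center has zigzag code at most `2w/s + 2`, where `s` is the side of the cells.
-/
theorem psum_zigzag_le_cellRad {d : ℕ} {α Φ : ℝ} (hs : 0 < cellSide α) {c x : Pt d}
    (h : ‖x - c‖ ≤ Φ) :
    psum (zigzag ∘ cellOf (cellSide α) (coords c) (coords x)) d ≤ cellRad d α Φ := by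
  refine Nat.le_floor ?_
  have h₁ : ∑ j ∈ Finset.range d, |coords x j - coords c j| ≤ Real.sqrt d * Φ := by
    refine le_trans ?_ (mul_le_mul_of_nonneg_left h (Real.sqrt_nonneg _))
    rw [← Real.sqrt_sq (norm_nonneg (x - c)), ← Real.sqrt_mul (by positivity), norm_sub_sq_eq]
    refine Real.le_sqrt_of_sq_le ?_
    have := sq_sum_le_card_mul_sum_sq (s := Finset.range d)
      (f := fun j => |coords x j - coords c j|)
    simpa using this
  rw [psum, Nat.cast_sum]
  calc ∑ j ∈ Finset.range d,
        (((zigzag ∘ cellOf (cellSide α) (coords c) (coords x)) j : ℕ) : ℝ)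
      ≤ ∑ j ∈ Finset.range d, (2 * (|coords x j - coords c j| / cellSide α) + 2) := by
        refine Finset.sum_le_sum fun j _ => (zigzag_floor_le _).trans (le_of_eq ?_)
        rw [abs_div, abs_of_pos hs]
    _ = 2 * ((∑ j ∈ Finset.range d, |coords x j - coords c j|) / cellSide α) + 2 * d := by
        rw [Finset.sum_add_distrib, ← Finset.mul_sum, Finset.sum_div]
        simp [mul_comm]
    _ ≤ 2 * ((Real.sqrt d * Φ) / cellSide α) + 2 * d := by gcongr
    _ = _ := by ring

theorem numFeats_pos (d : ℕ) (α : ℝ) : 0 < numFeats d α := Nat.choose_pos (by omega)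

theorem cellAddr_add_lt {d : ℕ} {α Φ : ℝ} {z : ℕ → ℤ}
    (h : psum (zigzag ∘ z) d ≤ cellRad d α Φ) {i : ℕ} (hi : i < numFeats d α) :
    cellAddr d α z + i < msgLen d α Φ := by
  have h₁ : simplexRank d (zigzag ∘ z) + 1 ≤ numCells d α Φ := simplexRank_lt_of_le h
  have h₂ := Nat.mul_le_mul_right (numFeats d α) h₁
  unfold cellAddr msgLen
  rw [add_mul, one_mul] at h₂
  omega

theorem cellAddr_congr {d : ℕ} {α : ℝ} {z z' : ℕ → ℤ} (h : ∀ j < d, z j = z' j) :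
    cellAddr d α z = cellAddr d α z' := by
  have hp : ∀ j ≤ d, psum (zigzag ∘ z) j = psum (zigzag ∘ z') j := fun j hj =>
    Finset.sum_congr rfl fun i hi => by
      simp [h i ((Finset.mem_range.1 hi).trans_le hj)]
  have : simplexRank d (zigzag ∘ z) = simplexRank d (zigzag ∘ z') :=
    Finset.sum_congr rfl fun j hj => by rw [hp (j + 1) (Finset.mem_range.1 hj)]
  rw [cellAddr, cellAddr, this]

-- The blocks of words of two cells overlap only if their ranks coincide, and the rank is injective
-- on the first `d` coordinates.
open Classical in
theorem contrib_cellAddr_add {d : ℕ} {α : ℝ} {c x : ℕ → ℝ} {z : ℕ → ℤ} {i : ℕ}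
    (hi : i < numFeats d α) :
    contrib d α c x (cellAddr d α z + i) =
      if ∀ j < d, cellOf (cellSide α) c x j = z j then
        featAt d α (offsetIn (cellSide α) c x (cellOf (cellSide α) c x)) i else 0 := by
  rw [contrib]
  set z' := cellOf (cellSide α) c x
  by_cases h : ∀ j < d, z' j = z j
  · rw [if_pos h, cellAddr_congr h, if_pos ⟨by omega, by omega⟩, Nat.add_sub_cancel_left]
  · rw [if_neg h, if_neg]
    rintro ⟨h₁, h₂⟩
    refine h fun j hj => zigzag_injective ?_
    refine simplexRank_injective (d := d) (β := zigzag ∘ z') (γ := zigzag ∘ z) ?_ j hj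
    unfold cellAddr at h₁ h₂
    set N := numFeats d α
    set r := simplexRank d (zigzag ∘ z)
    set r' := simplexRank d (zigzag ∘ z')
    have h₃ : r' * N < (r + 1) * N := by rw [add_mul]; omega
    have h₄ : r * N < (r' + 1) * N := by rw [add_mul]; omega
    have := Nat.lt_of_mul_lt_mul_right h₃
    have := Nat.lt_of_mul_lt_mul_right h₄
    omega

theorem featAt_congr {d : ℕ} {α : ℝ} {u v : ℕ → ℝ} (h : ∀ j < d, u j = v j) (i : ℕ) :
    featAt d α u i = featAt d α v i := by
  have hw : gaussWeight d u = gaussWeight d v := by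
    unfold gaussWeight
    rw [Finset.sum_congr rfl fun j hj => by rw [h j (Finset.mem_range.1 hj)]]
  unfold featAt feature
  rw [hw, Finset.prod_congr rfl fun j hj => by rw [h j (Finset.mem_range.1 hj)]]

theorem sum_featAt_mul (d : ℕ) (α : ℝ) (u v : ℕ → ℝ) :
    ∑ i ∈ Finset.range (numFeats d α), featAt d α u i * featAt d α v i =
      ((multiIdx (featDeg d α) d).map fun β =>
        feature (gaussWeight d u) u d β * feature (gaussWeight d v) v d β).sum := by
  rw [← length_multiIdx_featDeg, Finset.sum_range, ← Fin.sum_univ_fun_getElem]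
  refine Finset.sum_congr rfl fun i _ => ?_
  rw [featAt, featAt, List.getD_eq_getElem _ _ i.2]

/-- The truncated kernel. -/
def approxKernel (d : ℕ) (α : ℝ) (c x y : ℕ → ℝ) : ℝ :=
  open Classical in
  if IsNear d (cellSide α) c y (cellOf (cellSide α) c x) then
    ∑ i ∈ Finset.range (numFeats d α),
      featAt d α (offsetIn (cellSide α) c x (cellOf (cellSide α) c x)) i *
        featAt d α (offsetIn (cellSide α) c y (cellOf (cellSide α) c x)) i
  else 0

/-- Interchanging the sums over nearby cells and over data points leaves, for each point, the term
of its own cell if that cell is near `y`. -/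
theorem clientSum_exact {d : ℕ} (P : Params d) (hs : 0 < cellSide P.α) {X : List (Pt d)}
    (hX : InBall P.center P.Φ X) (y : Pt d) :
    clientSum P (exactWord P X) y =
      (X.map fun x => approxKernel d P.α (coords P.center) (coords x) (coords y)).sum := by
  classical
  set c := coords P.center
  set s := cellSide P.α
  set z := nearCell s c (coords y)
  have h₁ : ∀ r, cellTerm d P.α P.Φ c (coords y) (exactWord P X) (z r) =
      (X.map fun x => if ∀ j < d, cellOf s c (coords x) j = z r j then
        ∑ i ∈ Finset.range (numFeats d P.α),
          featAt d P.α (offsetIn s c (coords x) (cellOf s c (coords x))) i *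
          featAt d P.α (offsetIn s c (coords y) (cellOf s c (coords x))) i else 0).sum := by
    intro r
    rw [cellTerm]
    have hterm : ∀ i ∈ Finset.range (numFeats d P.α),
        featAt d P.α (offsetIn s c (coords y) (z r)) i *
          exactWord P X (cellAddr d P.α (z r) + i) =
        (X.map fun x => if ∀ j < d, cellOf s c (coords x) j = z r j then
          featAt d P.α (offsetIn s c (coords x) (cellOf s c (coords x))) i *
          featAt d P.α (offsetIn s c (coords y) (cellOf s c (coords x))) i else 0).sum := by
      intro i hi
      rw [exactWord_eq, if_neg (by unfold cellAddr; omega), zero_add, ← List.sum_map_mul_left]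
      congr 1
      refine List.map_congr_left fun x _ => ?_
      rw [contrib_cellAddr_add (Finset.mem_range.1 hi)]
      split_ifs with h
      · rw [mul_comm]
        congr 1
        exact featAt_congr (fun j hj => by rw [offsetIn, offsetIn, ← h j hj]) i
      · rw [mul_zero]
    split_ifs with hr
    · rw [Finset.sum_congr rfl hterm]
      clear hterm hX
      induction X with
      | nil => simp
      | cons x X ih =>
        simp only [List.map_cons, List.sum_cons, Finset.sum_add_distrib, ih]
        congr 1
        split_ifs <;> simp
    -- A cell beyond `cellRad` is skipped by the client; since the data lie in the ball, no point is
    -- in it and nothing is lost.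
    · symm
      refine List.sum_eq_zero fun v hv => ?_
      obtain ⟨x, hx, rfl⟩ := List.mem_map.1 hv
      refine if_neg fun h => hr ?_
      have hp : psum (zigzag ∘ z r) d = psum (zigzag ∘ cellOf s c (coords x)) d :=
        Finset.sum_congr rfl fun j hj => by simp [h j (Finset.mem_range.1 hj)]
      rw [hp]
      exact psum_zigzag_le_cellRad hs (by simpa [dist_eq_norm] using hX x hx)
  rw [clientSum]
  simp only [show ∀ r, nearCell (cellSide P.α) (coords P.center) (coords y) r = z r from
    fun _ => rfl]
  rw [Finset.sum_congr rfl fun r _ => h₁ r]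
  clear h₁ hX
  induction X with
  | nil => simp
  | cons x X ih =>
    simp only [List.map_cons, List.sum_cons, Finset.sum_add_distrib, ih]
    congr 1
    rw [sum_ite_nearCell_eq, approxKernel]

/-- For far cells the error is at most `exp(-s²) = α⁴`, where `s = cellSide α`. For near cells
`16·d·2s² = 128·d·log(1/α)` is the number whose floor is `featDeg`, so the truncation error is at
most `2α⁵`. Both are at most `α/8` because `α ≤ 1/2`. -/
theorem abs_approxKernel_sub_le {d : ℕ} (hd : 1 ≤ d) {α : ℝ} (hα : 0 < α)
    (hα₁ : α ≤ 1 / 2) (hL : 1 ≤ Real.log (1 / α)) (c : ℕ → ℝ) (x y : Pt d) :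
    |approxKernel d α c (coords x) (coords y) - gaussianKernel x y| ≤ α / 8 := by
  have hs2 : cellSide α ^ 2 = 4 * Real.log (1 / α) := Real.sq_sqrt (by linarith)
  have hs : 0 < cellSide α := Real.sqrt_pos.2 (by linarith)
  have hexp : ∀ k : ℕ, Real.exp (-(k * Real.log (1 / α))) = α ^ k := fun k => by
    rw [one_div, Real.log_inv, mul_neg, neg_neg, Real.exp_nat_mul, Real.exp_log hα]
  have hα3 : α ^ 3 ≤ (1 / 2) ^ 3 := pow_le_pow_left₀ hα.le hα₁ 3
  have hα4 : α ^ 4 ≤ α / 8 := by nlinarith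
  have hα5 : 2 * α ^ 5 ≤ α / 8 := by nlinarith [pow_pos hα 4]
  rw [gaussianKernel, norm_sub_sq_eq, approxKernel]
  split_ifs with h
  · rw [sum_featAt_mul]
    have hsum : ∑ j ∈ Finset.range d, (coords x j - coords y j) ^ 2 = ∑ j ∈ Finset.range d,
        (offsetIn (cellSide α) c (coords x) (cellOf (cellSide α) c (coords x)) j -
          offsetIn (cellSide α) c (coords y) (cellOf (cellSide α) c (coords x)) j) ^ 2 :=
      Finset.sum_congr rfl fun j _ => by rw [offsetIn, offsetIn]; ring
    rw [hsum]
    have hD : 128 * d * Real.log (1 / α) < featDeg d α + 1 := Nat.lt_floor_add_one _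
    refine (abs_sum_feature_sub_le (c := 2 * cellSide α ^ 2)
      (fun j hj => abs_offsetIn_mul_le hs c _ _ h hj) ?_).trans ?_
    · rw [hs2]
      linarith
    · have hd' : (1 : ℝ) ≤ d := by exact_mod_cast hd
      have : Real.exp (-((featDeg d α : ℝ) + 1)) ≤ α ^ 5 := by
        rw [← hexp]
        refine Real.exp_le_exp.2 (neg_le_neg (le_trans ?_ hD.le))
        push_cast
        nlinarith
      linarith
  · have h' := sq_le_of_not_isNear hs c _ _ h
    rw [zero_sub, abs_neg, abs_of_pos (Real.exp_pos _)]
    have : Real.exp (-∑ j ∈ Finset.range d, (coords x j - coords y j) ^ 2) ≤ α ^ 4 := by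
      rw [← hexp]
      refine Real.exp_le_exp.2 (neg_le_neg (le_trans (le_of_eq ?_) h'))
      rw [hs2]
      norm_num
    linarith

theorem clientSum_add {d : ℕ} (P : Params d) (w w' : ℕ → ℝ) (y : Pt d) :
    clientSum P (fun a => w a + w' a) y = clientSum P w y + clientSum P w' y := by
  unfold clientSum
  rw [← Finset.sum_add_distrib]
  refine Finset.sum_congr rfl fun r _ => ?_
  unfold cellTerm
  split_ifs
  · simp only [mul_add, Finset.sum_add_distrib]
  · simp

/-- The indices of the words of the message that the client uses to answer the query `y`. -/
def usedWords {d : ℕ} (P : Params d) (y : Pt d) : Finset ℕ :=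
  insert 0 ((Finset.range (3 ^ d) ×ˢ Finset.range (numFeats d P.α)).image fun p =>
    cellAddr d P.α (nearCell (cellSide P.α) (coords P.center) (coords y) p.1) + p.2)

theorem card_usedWords_le {d : ℕ} (P : Params d) (y : Pt d) :
    (usedWords P y).card ≤ 3 ^ d * numFeats d P.α + 1 := by
  refine (Finset.card_insert_le _ _).trans (Nat.succ_le_succ (Finset.card_image_le.trans ?_))
  simp

theorem clientSum_congr {d : ℕ} (P : Params d) {w w' : ℕ → ℝ}
    (h : ∀ a < msgLen d P.α P.Φ, w a = w' a) (y : Pt d) : clientSum P w y = clientSum P w' y := by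
  refine Finset.sum_congr rfl fun r _ => ?_
  unfold cellTerm
  split_ifs with hr
  · exact Finset.sum_congr rfl fun i hi => by
      rw [h _ (cellAddr_add_lt hr (Finset.mem_range.1 hi))]
  · rfl

/-- All features are bounded by `1`, and at most `3^d` blocks of words enter the sum. -/
theorem abs_clientSum_le {d : ℕ} (P : Params d) {w : ℕ → ℝ} {y : Pt d} {t : ℝ} (ht : 0 ≤ t)
    (h : ∀ a ∈ usedWords P y, |w a| ≤ t) :
    |clientSum P w y| ≤ 3 ^ d * numFeats d P.α * t := by
  refine (Finset.abs_sum_le_sum_abs _ _).trans ?_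
  calc _ ≤ ∑ r ∈ Finset.range (3 ^ d), numFeats d P.α * t := by
        refine Finset.sum_le_sum fun r hr => ?_
        unfold cellTerm
        split_ifs
        · refine (Finset.abs_sum_le_sum_abs _ _).trans ?_
          calc _ ≤ ∑ i ∈ Finset.range (numFeats d P.α), 1 * t := by
                refine Finset.sum_le_sum fun i hi => ?_
                rw [abs_mul]
                gcongr
                · exact abs_featAt_le _ _ _ _
                · refine h _ (Finset.mem_insert_of_mem (Finset.mem_image.2 ⟨(r, i), ?_, rfl⟩))
                  exact Finset.mem_product.2 ⟨hr, hi⟩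
            _ = _ := by simp
        · rw [abs_zero]
          positivity
    _ = _ := by simp [mul_assoc]

/-! ### From the sums to the quotient, and the error analysis -/

theorem gaussianKernel_nonneg {d : ℕ} (x y : Pt d) : 0 ≤ gaussianKernel x y := (Real.exp_pos _).le

theorem gaussianKernel_le_one {d : ℕ} (x y : Pt d) : gaussianKernel x y ≤ 1 :=
  Real.exp_le_one_iff.2 (by simp)

theorem sum_gaussianKernel_mem {d : ℕ} (X : List (Pt d)) (y : Pt d) :
    0 ≤ (X.map fun x => gaussianKernel x y).sum ∧
      (X.map fun x => gaussianKernel x y).sum ≤ X.length := by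
  induction X with
  | nil => simp
  | cons x X ih =>
    simp only [List.map_cons, List.sum_cons, List.length_cons, Nat.cast_add, Nat.cast_one]
    constructor <;> linarith [gaussianKernel_nonneg x y, gaussianKernel_le_one x y]

theorem abs_sum_map_sub_le {ι : Type*} (l : List ι) (f g : ι → ℝ) {c : ℝ}
    (h : ∀ x ∈ l, |f x - g x| ≤ c) : |(l.map f).sum - (l.map g).sum| ≤ l.length * c := by
  induction l with
  | nil => simp
  | cons x l ih =>
    simp only [List.map_cons, List.sum_cons, List.length_cons, Nat.cast_add, Nat.cast_one]
    have h₁ := h x (by simp)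
    have h₂ := ih fun y hy => h y (by simp [hy])
    calc _ = |(f x - g x) + ((l.map f).sum - (l.map g).sum)| := by congr 1; ring
      _ ≤ _ := by
        refine (abs_add_le _ _).trans ?_
        linarith

theorem abs_min_max_sub_le {v k e : ℝ} (hk₀ : 0 ≤ k) (hk₁ : k ≤ 1) (h : |v - k| ≤ e) :
    |min (max v 0) 1 - k| ≤ e := by
  rw [abs_le] at h ⊢
  obtain ⟨h₁, h₂⟩ := h
  constructor
  · rcases min_choice (max v 0) 1 with h | h <;> rw [h] <;> linarith [le_max_left v 0]
  · have : min (max v 0) 1 ≤ max v 0 := min_le_left _ _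
    rcases max_choice v 0 with h | h <;> rw [h] at this ⊢ <;> linarith

/-- Since `S/n ≤ 1`, the errors of numerator and denominator add up to at most `3nα/8`, while the
denominator is still at least `n/2`. -/
theorem abs_div_sub_div_le {S T n m α : ℝ} (hα : 0 < α) (hα₁ : α ≤ 1) (hn : 0 < n) (hS₀ : 0 ≤ S)
    (hS : S ≤ n) (hT : |T - S| ≤ n * (α / 4)) (hm : |m - n| ≤ n * (α / 8)) :
    |T / m - S / n| ≤ α := by
  have hm' : n / 2 ≤ m := by
    have := (abs_le.1 hm).1
    nlinarith
  have hm₀ : 0 < m := by linarith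
  have hq₀ : 0 ≤ S / n := by positivity
  have hq₁ : S / n ≤ 1 := (div_le_one hn).2 hS
  have h : T / m - S / n = ((T - S) - S / n * (m - n)) / m := by
    field_simp
    ring
  rw [h, abs_div, abs_of_pos hm₀, div_le_iff₀ hm₀]
  calc |(T - S) - S / n * (m - n)| ≤ |T - S| + |S / n * (m - n)| := abs_sub _ _
    _ ≤ n * (α / 4) + 1 * (n * (α / 8)) := by
        rw [abs_mul, abs_of_nonneg hq₀]
        gcongr
    _ ≤ α * (n / 2) := by nlinarith
    _ ≤ α * m := by gcongr

theorem measurable_clientSum {d : ℕ} (P : Params d) (y : Pt d) :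
    Measurable fun w : ℕ → ℝ => clientSum P w y := by
  unfold clientSum cellTerm
  refine Finset.measurable_sum _ fun r _ => ?_
  split_ifs
  · exact Finset.measurable_sum _ fun i _ => (measurable_pi_apply _).const_mul _
  · exact measurable_const

theorem measurable_estimate {d : ℕ} (P : Params d) (y : Pt d) :
    Measurable fun M : Message => estimate P M y := by
  unfold estimate
  have h₁ : Measurable fun M : Message => clientSum P M.2 y :=
    (measurable_clientSum P y).comp measurable_snd
  have h₂ : Measurable fun M : Message => M.2 0 := (measurable_pi_apply 0).comp measurable_snd
  exact ((h₁.div h₂).max measurable_const).min measurable_const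

/-- The numerator has error `nα/8` from the truncated kernel and `nα/8` from the noise, the count
has error at most `nα/8`, and clamping does not increase the distance to a value in `[0,1]`. -/
theorem isApprox_estimate {d : ℕ} (P : Params d) (hd : 1 ≤ d) (hε : 0 < P.ε) (hα : 0 < P.α)
    (hα₁ : P.α ≤ 1 / 2) (hL : 1 ≤ Real.log (1 / P.α)) (hη : 0 < P.η) (hη₁ : P.η ≤ 1)
    {X : List (Pt d)} (hX : InBall P.center P.Φ X) (hne : 0 < X.length)
    (hn : 8 * (3 ^ d * numFeats d P.α) * (noiseScale P *
      Real.log ((3 ^ d * numFeats d P.α + 1) / P.η)) ≤ P.α * X.length) :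
    IsApprox P.α P.η X fun ω y => estimate P (released P X ω) y := by
  intro y
  set m : ℝ := 3 ^ d * numFeats d P.α with hm
  set t := Real.log ((m + 1) / P.η) with ht
  have hb := noiseScale_pos P hε
  have hN : (1 : ℝ) ≤ numFeats d P.α := by exact_mod_cast numFeats_pos d P.α
  have hm₁ : 1 ≤ m := by
    have : (1 : ℝ) ≤ 3 ^ d := one_le_pow₀ (by norm_num)
    nlinarith
  have ht₀ : 0 ≤ t := Real.log_nonneg (by rw [le_div_iff₀ hη]; linarith)
  have hs : 0 < cellSide P.α := Real.sqrt_pos.2 (by linarith)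
  have hn₀ : (0 : ℝ) < X.length := by exact_mod_cast hne
  refine ⟨(measurable_estimate P y).comp (measurable_released P X), fun ω =>
    ⟨le_min (le_max_right _ _) zero_le_one, min_le_right _ _⟩, ?_⟩
  -- The union bound runs only over the words used for this one query, so the threshold for `n` does
  -- not depend on the number of cells.
  refine (tapeMeasure_forall_abs_le (usedWords P y) ht₀ hη.le ?_).trans (measure_mono ?_)
  · have hc : ((usedWords P y).card : ℝ) ≤ m + 1 := by
      have := card_usedWords_le P y
      rw [hm]
      exact_mod_cast this
    rw [ht, Real.exp_neg, Real.exp_log (by positivity), inv_div]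
    calc ((usedWords P y).card : ℝ) * (P.η / (m + 1)) ≤ (m + 1) * (P.η / (m + 1)) := by gcongr
      _ = P.η := by field_simp
  · intro ω hω
    have hω' : ∀ a ∈ usedWords P y, |ω (a, .laplace)| ≤ t := hω
    have hnoise : ∀ a ∈ usedWords P y, |noiseScale P * ω (a, .laplace)| ≤ noiseScale P * t := by
      intro a ha
      rw [abs_mul, abs_of_pos hb]
      exact mul_le_mul_of_nonneg_left (hω' a ha) hb.le
    have hbt : 0 ≤ noiseScale P * t := by positivity
    have hsum : clientSum P (released P X ω).2 y = clientSum P (exactWord P X) y +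
        clientSum P (fun a => noiseScale P * ω (a, .laplace)) y := by
      -- The released words vanish beyond the message length, but the client's sum uses only words
      -- below it.
      rw [← clientSum_add]
      exact clientSum_congr P (fun a ha => by simp [released, ha]) y
    have h0 : (released P X ω).2 0 = X.length + noiseScale P * ω (0, .laplace) := by
      have hz : ∀ x : ℕ → ℝ, contrib d P.α (coords P.center) x 0 = 0 := fun x => by
        rw [contrib, if_neg]
        unfold cellAddr
        omega
      simp [released, exactWord_eq, hz, msgLen]
    change |estimate P (released P X ω) y - kde X y| ≤ P.α
    have hS := sum_gaussianKernel_mem X y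
    rw [estimate, kde]
    refine abs_min_max_sub_le (div_nonneg hS.1 hn₀.le) ((div_le_one hn₀).2 hS.2) ?_
    refine abs_div_sub_div_le hα (by linarith) hn₀ hS.1 hS.2 ?_ ?_
    · rw [hsum, clientSum_exact P hs hX]
      have h₁ := abs_sum_map_sub_le X
        (fun x => approxKernel d P.α (coords P.center) (coords x) (coords y))
        (fun x => gaussianKernel x y)
        (fun x _ => abs_approxKernel_sub_le hd hα hα₁ hL (coords P.center) x y)
      have h₂ := abs_clientSum_le P hbt hnoise
      rw [← hm] at h₂
      calc _ = |((X.map fun x => approxKernel d P.α (coords P.center) (coords x) (coords y)).sum -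
            (X.map fun x => gaussianKernel x y).sum) +
            clientSum P (fun a => noiseScale P * ω (a, .laplace)) y| := by congr 1; ring
        _ ≤ _ := by
          refine (abs_add_le _ _).trans ?_
          linarith
    · rw [h0, add_sub_cancel_left]
      refine (hnoise 0 (Finset.mem_insert_self _ _)).trans ?_
      have : noiseScale P * t ≤ m * (noiseScale P * t) := le_mul_of_one_le_left hbt hm₁
      linarith

/-! ### Size and time bounds -/

theorem cast_le_two_pow (d : ℕ) : (d : ℝ) ≤ 2 ^ d := by
  exact_mod_cast Nat.lt_two_pow_self.le

/-- A common bound for the dimension, the degree, and the number of features. -/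
def sizeBound (d : ℕ) (α : ℝ) : ℝ := (400 * Real.log (1 / α)) ^ d

theorem pow_le_sizeBound {d : ℕ} {α c : ℝ} (hL : 1 ≤ Real.log (1 / α)) (hc₀ : 0 ≤ c)
    (hc : c ≤ 400) : c ^ d ≤ sizeBound d α :=
  pow_le_pow_left₀ hc₀ (by linarith) d

theorem one_le_sizeBound {d : ℕ} {α : ℝ} (hL : 1 ≤ Real.log (1 / α)) : 1 ≤ sizeBound d α := by
  simpa using pow_le_sizeBound (d := d) hL zero_le_one (by norm_num)

theorem cast_le_sizeBound {d : ℕ} {α : ℝ} (hL : 1 ≤ Real.log (1 / α)) : (d : ℝ) ≤ sizeBound d α :=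
  (cast_le_two_pow d).trans (pow_le_sizeBound hL (by norm_num) (by norm_num))

theorem featDeg_le {d : ℕ} {α : ℝ} (hL : 1 ≤ Real.log (1 / α)) :
    (featDeg d α : ℝ) ≤ 128 * d * Real.log (1 / α) := Nat.floor_le (by positivity)

theorem featDeg_le_sizeBound {d : ℕ} {α : ℝ} (hd : 1 ≤ d) (hL : 1 ≤ Real.log (1 / α)) :
    (featDeg d α : ℝ) ≤ sizeBound d α := by
  have h : 128 * Real.log (1 / α) ≤ (128 * Real.log (1 / α)) ^ d :=
    le_self_pow₀ (by linarith) (by omega)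
  calc (featDeg d α : ℝ) ≤ 128 * d * Real.log (1 / α) := featDeg_le hL
    _ = d * (128 * Real.log (1 / α)) := by ring
    _ ≤ 2 ^ d * (128 * Real.log (1 / α)) ^ d := by
        gcongr
        exact cast_le_two_pow d
    _ = (2 * (128 * Real.log (1 / α))) ^ d := by rw [← mul_pow]
    _ ≤ sizeBound d α := pow_le_pow_left₀ (by positivity) (by linarith) d

/-- Here `3(128 log(1/α) + 1) ≤ 400 log(1/α)`, which is what fixes the constant in `sizeBound`. -/
theorem numFeats_le_sizeBound {d : ℕ} {α : ℝ} (hd : 1 ≤ d) (hL : 1 ≤ Real.log (1 / α)) :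
    (numFeats d α : ℝ) ≤ sizeBound d α := by
  refine (choose_add_le (featDeg d α) hd).trans (pow_le_pow_left₀ (by positivity) ?_ d)
  have hd' : (0 : ℝ) < d := by exact_mod_cast hd
  have h : ((featDeg d α : ℝ) + d) / d ≤ 128 * Real.log (1 / α) + 1 := by
    rw [div_le_iff₀ hd']
    linarith [featDeg_le (d := d) hL]
  linarith

/-- Since the side of a cell is at least `2`, `cellRad` is at most `√d Φ + 2d = d(Φ/√d + 2)`;
dividing by `d` inside `choose_add_le` leaves `3(Φ/√d + 3)`. -/
theorem numCells_le {d : ℕ} {α Φ : ℝ} (hd : 1 ≤ d) (hL : 1 ≤ Real.log (1 / α)) (hΦ : 0 < Φ) :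
    (numCells d α Φ : ℝ) ≤ (9 * (1 + Φ / Real.sqrt d)) ^ d := by
  refine (choose_add_le (cellRad d α Φ) hd).trans (pow_le_pow_left₀ (by positivity) ?_ d)
  have hd' : (0 : ℝ) < d := by exact_mod_cast hd
  have hs : 2 ≤ cellSide α := Real.le_sqrt_of_sq_le (by linarith)
  have hr : 0 < Real.sqrt d := Real.sqrt_pos.2 hd'
  have hE : (cellRad d α Φ : ℝ) ≤ 2 * Real.sqrt d * Φ / cellSide α + 2 * d :=
    Nat.floor_le (by positivity)
  have h₁ : 2 * Real.sqrt d * Φ / cellSide α ≤ Real.sqrt d * Φ := by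
    rw [div_le_iff₀ (by linarith)]
    nlinarith [mul_pos hr hΦ]
  have h₂ : Real.sqrt d * Φ = d * (Φ / Real.sqrt d) := by
    rw [← mul_div_assoc, eq_div_iff hr.ne']
    nth_rewrite 3 [← Real.mul_self_sqrt hd'.le]
    ring
  have h : ((cellRad d α Φ : ℝ) + d) / d ≤ Φ / Real.sqrt d + 3 := by
    rw [div_le_iff₀ hd']
    linarith
  have : 0 < Φ / Real.sqrt d := by positivity
  linarith

theorem msgLen_le {d : ℕ} {α Φ : ℝ} (hd : 1 ≤ d) (hL : 1 ≤ Real.log (1 / α)) (hΦ : 0 < Φ) :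
    (msgLen d α Φ : ℝ) ≤ 2 * ((9 * (1 + Φ / Real.sqrt d)) ^ d * sizeBound d α) := by
  have h₁ := numCells_le hd hL hΦ
  have h₂ := numFeats_le_sizeBound hd hL
  have h₃ : (1 : ℝ) ≤ numCells d α Φ * numFeats d α := by
    exact_mod_cast Nat.mul_pos (Nat.choose_pos (by omega)) (numFeats_pos d α)
  have h₄ : (numCells d α Φ : ℝ) * numFeats d α ≤
      (9 * (1 + Φ / Real.sqrt d)) ^ d * sizeBound d α := by gcongr
  unfold msgLen
  push_cast
  linarith

theorem cellTime_le {d : ℕ} {α : ℝ} (hd : 1 ≤ d) (hL : 1 ≤ Real.log (1 / α)) :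
    (cellTime d α : ℝ) ≤ 400 * sizeBound d α ^ 3 := by
  have h₁ := one_le_sizeBound (d := d) hL
  have h₂ := cast_le_sizeBound (d := d) hL
  have h₃ := featDeg_le_sizeBound hd hL
  have h₄ := numFeats_le_sizeBound hd hL
  set B := sizeBound d α
  have hB₁ : B ≤ B ^ 3 := le_self_pow₀ h₁ (by norm_num)
  have hB₂ : B ^ 2 ≤ B ^ 3 := pow_le_pow_right₀ h₁ (by norm_num)
  unfold cellTime
  push_cast
  calc (d : ℝ) * (28 * d + 90) + 20 + (d * (numFeats d α * (60 * featDeg d α + 40) + 70) + 50)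
      ≤ B * (28 * B + 90) + 20 + (B * (B * (60 * B + 40) + 70) + 50) := by gcongr
    _ = 60 * B ^ 3 + 68 * B ^ 2 + 160 * B + 70 := by ring
    _ ≤ _ := by linarith

theorem clientTime_le {d : ℕ} {α : ℝ} (hd : 1 ≤ d) (hL : 1 ≤ Real.log (1 / α)) :
    (clientTime d α : ℝ) ≤ 900 * sizeBound d α ^ 5 := by
  have h₀ := cellTime_le hd hL
  have h₁ := one_le_sizeBound (d := d) hL
  have h₂ := cast_le_sizeBound (d := d) hL
  have h₃ := pow_le_sizeBound (d := d) (c := 3) hL (by norm_num) (by norm_num)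
  have h₄ := numFeats_le_sizeBound hd hL
  set B := sizeBound d α
  have hB₁ : B ≤ B ^ 5 := le_self_pow₀ h₁ (by norm_num)
  have hB₂ : B ^ 2 ≤ B ^ 5 := pow_le_pow_right₀ h₁ (by norm_num)
  have hB₄ : B ^ 4 ≤ B ^ 5 := pow_le_pow_right₀ h₁ (by norm_num)
  unfold clientTime
  push_cast
  calc 60 * (d : ℝ) + 200 + 3 ^ d * (80 * d + 50 + cellTime d α + 40 * numFeats d α)
      ≤ 60 * B + 200 + B * (80 * B + 50 + 400 * B ^ 3 + 40 * B) := by gcongr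
    _ = 400 * B ^ 4 + 120 * B ^ 2 + 110 * B + 200 := by ring
    _ ≤ _ := by linarith

/-- The noise costs a multiple of the message length, of order `(1 + Φ/√d)^d` up to `sizeBound`. It
splits into a part with `(Φ/√d)^d` and a constant part, and the latter is absorbed by `n d ≥ 1`. -/
theorem curatorTime_le {d n : ℕ} {α Φ : ℝ} (hd : 1 ≤ d) (hn : 1 ≤ n)
    (hL : 1 ≤ Real.log (1 / α)) (hΦ : 0 < Φ) :
    (curatorTime d n α Φ : ℝ) ≤
      (n * d + (Φ / Real.sqrt d) ^ d) * (900 * sizeBound d α ^ 5) := by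
  have h₀ := cellTime_le hd hL
  have h₁ := one_le_sizeBound (d := d) hL
  have h₂ := cast_le_sizeBound (d := d) hL
  have h₃ := pow_le_sizeBound (d := d) (c := 18) hL (by norm_num) (by norm_num)
  have h₄ := numFeats_le_sizeBound hd hL
  have h₅ := msgLen_le hd hL hΦ
  set B := sizeBound d α
  set x := Φ / Real.sqrt d
  have hx : 0 ≤ x := by positivity
  have hd' : (1 : ℝ) ≤ d := by exact_mod_cast hd
  have hn' : (1 : ℝ) ≤ n := by exact_mod_cast hn
  set Y := n * d + x ^ d with hY
  have hnd : (n : ℝ) ≤ n * d := le_mul_of_one_le_right (by linarith) hd'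
  have hxd : 0 ≤ x ^ d := by positivity
  have hY₁ : 1 + x ^ d ≤ Y := by linarith
  have hY₂ : (n : ℝ) ≤ Y := by linarith
  have hY₀ : 1 ≤ Y := by linarith
  have hpow : (1 + x) ^ d ≤ 2 ^ d * (1 + x ^ d) := by
    have h : 1 + x ≤ 2 * max 1 x := by linarith [le_max_left 1 x, le_max_right 1 x]
    calc (1 + x) ^ d ≤ (2 * max 1 x) ^ d := pow_le_pow_left₀ (by linarith) h d
      _ = 2 ^ d * max 1 x ^ d := mul_pow _ _ _
      _ ≤ 2 ^ d * (1 + x ^ d) := by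
        gcongr
        rcases max_choice 1 x with h | h <;> rw [h]
        · simpa using hxd
        · linarith
  have hlen : (msgLen d α Φ : ℝ) ≤ 2 * Y * B ^ 2 := by
    refine h₅.trans ?_
    calc 2 * ((9 * (1 + x)) ^ d * B) ≤ 2 * ((9 ^ d * (2 ^ d * Y)) * B) := by
          rw [mul_pow]
          gcongr
          exact hpow.trans (by gcongr)
      _ = 2 * (18 ^ d * Y * B) := by
          rw [← mul_assoc (9 ^ d : ℝ), ← mul_pow]
          norm_num
      _ ≤ 2 * (B * Y * B) := by gcongr
      _ = _ := by ring
  have hB₁ : B ≤ B ^ 5 := le_self_pow₀ h₁ (by norm_num)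
  have hB₂ : B ^ 2 ≤ B ^ 5 := pow_le_pow_right₀ h₁ (by norm_num)
  have hB₃ : B ^ 3 ≤ B ^ 5 := pow_le_pow_right₀ h₁ (by norm_num)
  unfold curatorTime
  push_cast
  calc 60 * (d : ℝ) + 200 + 30 * msgLen d α Φ +
        n * (70 * d + 40 + cellTime d α + 40 * numFeats d α)
      ≤ 60 * B + 200 + 30 * (2 * Y * B ^ 2) + Y * (70 * B + 40 + 400 * B ^ 3 + 40 * B) := by gcongr
    _ ≤ 60 * B ^ 5 + 200 * B ^ 5 + 30 * (2 * Y * B ^ 5) +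
        Y * (70 * B ^ 5 + 40 * B ^ 5 + 400 * B ^ 5 + 40 * B ^ 5) := by
        have : 1 ≤ B ^ 5 := h₁.trans hB₁
        have hY' : 0 ≤ Y := by linarith
        gcongr
        · linarith
        · linarith
    _ = 260 * (1 * B ^ 5) + 610 * (Y * B ^ 5) := by ring
    _ ≤ 260 * (Y * B ^ 5) + 610 * (Y * B ^ 5) := by gcongr
    _ ≤ _ := by
        have : 0 ≤ Y * B ^ 5 := by positivity
        linarith

/-- Crude bounds suffice: `log (m + 1) ≤ m + 1` for the number `m` of feature words used, and `A`
turns the terms free of `η` into multiples of `log(1/η)`. -/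
theorem noise_bound {d : ℕ} {α η : ℝ} {A : ℕ} (hd : 1 ≤ d) (hL : 1 ≤ Real.log (1 / α))
    (hη : 0 < η) (hA : 1 ≤ A) (hAη : 1 ≤ A * Real.log (1 / η)) :
    8 * (3 ^ d * numFeats d α) * ((numFeats d α + 1) *
      Real.log ((3 ^ d * numFeats d α + 1) / η)) ≤
      900 * A * sizeBound d α ^ 5 * Real.log (1 / η) := by
  have h₁ := one_le_sizeBound (d := d) hL
  have h₃ := pow_le_sizeBound (d := d) (c := 3) hL (by norm_num) (by norm_num)
  have h₄ := numFeats_le_sizeBound hd hL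
  set B := sizeBound d α
  set ℓ := Real.log (1 / η) with hℓ
  have hA' : (1 : ℝ) ≤ A := by exact_mod_cast hA
  have hℓ₀ : 0 < ℓ := by
    by_contra! h
    nlinarith
  have hB₁ : 1 ≤ B ^ 2 := one_le_pow₀ h₁
  have hm : (3 : ℝ) ^ d * numFeats d α + 1 ≤ 2 * B ^ 2 := by
    have : (3 : ℝ) ^ d * numFeats d α ≤ B * B := by gcongr
    nlinarith
  have hlog : Real.log ((3 ^ d * numFeats d α + 1) / η) ≤ 3 * A * B ^ 2 * ℓ := by
    rw [div_eq_mul_one_div, Real.log_mul (by positivity) (by positivity), ← hℓ]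
    have h₅ : Real.log (3 ^ d * numFeats d α + 1) ≤ 2 * B ^ 2 :=
      (Real.log_le_self (by positivity)).trans hm
    have h₆ : 2 * B ^ 2 * 1 ≤ 2 * B ^ 2 * (A * ℓ) := by gcongr
    have h₇ : 1 * ℓ ≤ (A * B ^ 2) * ℓ := by
      gcongr
      exact one_le_mul_of_one_le_of_one_le hA' hB₁
    linarith
  have hlog₀ : 0 ≤ Real.log ((3 ^ d * numFeats d α + 1) / η) := by
    rw [div_eq_mul_one_div, Real.log_mul (by positivity) (by positivity), ← hℓ]
    have : 0 ≤ Real.log (3 ^ d * numFeats d α + 1) :=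
      Real.log_nonneg (le_add_of_nonneg_left (by positivity))
    linarith
  have hN1 : (numFeats d α : ℝ) + 1 ≤ 2 * B := by linarith
  calc _ ≤ 8 * (B * B) * (2 * B * (3 * A * B ^ 2 * ℓ)) := by gcongr
    _ = 48 * (A * B ^ 5 * ℓ) := by ring
    _ ≤ 900 * (A * B ^ 5 * ℓ) := by
        have : 0 ≤ A * B ^ 5 * ℓ := by positivity
        linarith
    _ = _ := by ring

/-- All constants are raised to the power `d` and then absorbed into `k d` extra powers of
`log(1/α)`, which works because `log(1/α)` is bounded below by some `lam > 1`. -/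
theorem sizeBound_pow_le {d k A C : ℕ} {α lam : ℝ} (hd : 1 ≤ d) (hlam : 1 < lam)
    (hL : lam ≤ Real.log (1 / α)) (hA : 1 ≤ A) (hk : 900 * A * 400 ^ 5 ≤ lam ^ k)
    (hC : k + 5 ≤ C) :
    900 * A * sizeBound d α ^ 5 ≤ Real.log (1 / α) ^ (C * d) := by
  set L := Real.log (1 / α)
  have hL₁ : 1 ≤ L := by linarith
  have hA' : (1 : ℝ) ≤ A := by exact_mod_cast hA
  calc 900 * A * sizeBound d α ^ 5 ≤ (900 * A) ^ d * sizeBound d α ^ 5 := by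
        have : 900 * (A : ℝ) ≤ (900 * A) ^ d := le_self_pow₀ (by linarith) (by omega)
        have h : 0 ≤ sizeBound d α ^ 5 :=
          pow_nonneg (zero_le_one.trans (one_le_sizeBound hL₁)) 5
        gcongr
    _ = (900 * A * 400 ^ 5) ^ d * (L ^ 5) ^ d := by
        rw [sizeBound, ← pow_mul, mul_comm d 5, pow_mul, ← mul_pow, ← mul_pow]
        congr 1
        ring
    _ ≤ (L ^ k) ^ d * (L ^ 5) ^ d := by
        gcongr
        exact hk.trans (pow_le_pow_left₀ (by linarith) hL k)
    _ = L ^ ((k + 5) * d) := by rw [← mul_pow, ← pow_add, ← pow_mul]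
    _ ≤ L ^ (C * d) := pow_le_pow_right₀ hL₁ (Nat.mul_le_mul_right d hC)

/-- The exponent here is exactly `d`, so constants go into the base: `7200 = 2·9·400`, and `A`
compensates for a small `log(1/η)`. -/
theorem msgLen_le_of_le {d A C : ℕ} {α η Φ : ℝ} (hd : 1 ≤ d) (hL : 1 ≤ Real.log (1 / α))
    (hΦ : 0 < Φ) (hA : 1 ≤ A) (hAη : 1 ≤ A * Real.log (1 / η)) (hC : 7200 * A ≤ C) :
    (msgLen d α Φ : ℝ) ≤
      (C * ((1 + Φ / Real.sqrt d) * Real.log (1 / α))) ^ d * Real.log (1 / η) := by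
  set L := Real.log (1 / α) with hLdef
  set ℓ := Real.log (1 / η)
  set x := Φ / Real.sqrt d
  have hx : 0 ≤ x := by positivity
  have hA' : (1 : ℝ) ≤ A := by exact_mod_cast hA
  have hC' : 7200 * (A : ℝ) ≤ C := by exact_mod_cast hC
  have hℓ : 0 < ℓ := by
    by_contra! h
    nlinarith
  have h2 : (2 : ℝ) ≤ 2 ^ d := le_self_pow₀ (by norm_num) (by omega)
  have hAd : (A : ℝ) ≤ (A : ℝ) ^ d := le_self_pow₀ hA' (by omega)
  have h₀ : 0 ≤ (3600 * ((1 + x) * L)) ^ d := by positivity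
  calc (msgLen d α Φ : ℝ) ≤ 2 * ((9 * (1 + x)) ^ d * sizeBound d α) := msgLen_le hd hL hΦ
    _ = 2 * (3600 * ((1 + x) * L)) ^ d := by
        rw [sizeBound, ← mul_pow, ← hLdef]
        congr 2
        ring
    _ ≤ 2 ^ d * (3600 * ((1 + x) * L)) ^ d * 1 := by
        rw [mul_one]
        gcongr
    _ ≤ 2 ^ d * (3600 * ((1 + x) * L)) ^ d * ((A : ℝ) ^ d * ℓ) := by
        gcongr
        exact hAη.trans (by gcongr)
    _ = (7200 * A * ((1 + x) * L)) ^ d * ℓ := by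
        rw [← mul_assoc, ← mul_pow, ← mul_pow]
        congr 2
        ring
    _ ≤ (C * ((1 + x) * L)) ^ d * ℓ := by gcongr

end

end DPKDE

/-! ### Choice of the constants and assembly of the theorem -/

theorem theorem2 (α₀ η₀ : ℝ) (hα₀ : α₀ < Real.exp (-1)) (hη₀ : η₀ < 1) :
    ∃ (curator client : DPKDE.Cmd) (C : ℕ), client.SampleFree ∧
      ∀ (d : ℕ) (P : DPKDE.Params d), 1 ≤ d → 0 < P.ε → 0 < P.α → P.α ≤ α₀ → 0 < P.η →
        P.η ≤ η₀ → 0 < P.Φ →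
        ∃ (release : List (DPKDE.Pt d) → DPKDE.Tape → DPKDE.Message)
          (est : DPKDE.Message → DPKDE.Pt d → ℝ),
          (∀ X, DPKDE.InBall P.center P.Φ X →
            ∀ ω, ∃ t, DPKDE.CuratorRun curator P X ω (release X ω) t) ∧
          DPKDE.IsDP P.ε (DPKDE.InBall P.center P.Φ) release ∧
          ∀ X, DPKDE.InBall P.center P.Φ X →
            Real.log (1 / P.η) * Real.log (1 / P.α) ^ (C * d) / (P.ε * P.α) ≤ (X.length : ℝ) →
            DPKDE.IsApprox P.α P.η X (fun ω y => est (release X ω) y) ∧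
            ∀ ω,
              (∃ t : ℕ, DPKDE.CuratorRun curator P X ω (release X ω) t ∧
                (t : ℝ) ≤ (X.length * d + (P.Φ / Real.sqrt d) ^ d) *
                  (C * Real.log (1 / P.α)) ^ (C * d) * Real.log (1 / P.η)) ∧
              ((release X ω).1 : ℝ) ≤
                (C * ((1 + P.Φ / Real.sqrt d) * Real.log (1 / P.α))) ^ d *
                  Real.log (1 / P.η) ∧
              ∀ y, ∃ t : ℕ, DPKDE.ClientRun client P (release X ω) y (est (release X ω) y) t ∧
                (t : ℝ) ≤ Real.log (1 / P.α) ^ (C * d) * Real.log (1 / P.η) := by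
  -- The bounds `α₀` and `η₀` may be nonpositive; enlarging them to positive numbers keeps the
  -- logarithms meaningful.
  obtain ⟨α₁, hα₁, hα₁pos, hα₁lt⟩ : ∃ α₁, α₀ ≤ α₁ ∧ 0 < α₁ ∧ α₁ < Real.exp (-1) :=
    ⟨max α₀ (Real.exp (-2)), le_max_left _ _, lt_max_of_lt_right (Real.exp_pos _),
      max_lt hα₀ (Real.exp_lt_exp.2 (by norm_num))⟩
  obtain ⟨η₁, hη₁, hη₁pos, hη₁lt⟩ : ∃ η₁, η₀ ≤ η₁ ∧ 0 < η₁ ∧ η₁ < 1 :=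
    ⟨max η₀ (1 / 2), le_max_left _ _, lt_max_of_lt_right (by norm_num), max_lt hη₀ (by norm_num)⟩
  have hlam : 1 < Real.log (1 / α₁) := by
    rw [one_div, Real.log_inv]
    have := (Real.log_lt_iff_lt_exp hα₁pos).2 hα₁lt
    linarith
  have hell : 0 < Real.log (1 / η₁) := Real.log_pos (by rw [lt_div_iff₀ hη₁pos]; linarith)
  obtain ⟨A', hA'⟩ := exists_nat_gt (1 / Real.log (1 / η₁))
  obtain ⟨A, hA, hAη⟩ : ∃ A : ℕ, 1 ≤ A ∧ 1 ≤ A * Real.log (1 / η₁) := by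
    refine ⟨A' + 1, by omega, ?_⟩
    rw [div_lt_iff₀ hell] at hA'
    push_cast
    linarith
  -- This needs `log(1/α₁) > 1`, that is `α₀ < 1/e`.
  obtain ⟨k, hk⟩ := pow_unbounded_of_one_lt (900 * (A : ℝ) * 400 ^ 5) hlam
  -- The exponents need `k + 5` and the base in the bound for the message needs `7200 * A`; the sum
  -- serves both.
  refine ⟨DPKDE.curatorCmd, DPKDE.clientCmd, k + 5 + 7200 * A, DPKDE.clientCmd_sampleFree, ?_⟩
  intro d P hd hε hα hαle hη hηle hΦ
  set C := k + 5 + 7200 * A with hC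
  have hlog : ∀ {a b : ℝ}, 0 < a → a ≤ b → Real.log (1 / b) ≤ Real.log (1 / a) :=
    fun ha hab => Real.log_le_log (one_div_pos.2 (ha.trans_le hab)) (one_div_le_one_div_of_le ha hab)
  have hLlam : Real.log (1 / α₁) ≤ Real.log (1 / P.α) := hlog hα (hαle.trans hα₁)
  have hL : 1 ≤ Real.log (1 / P.α) := by linarith
  have hℓη : Real.log (1 / η₁) ≤ Real.log (1 / P.η) := hlog hη (hηle.trans hη₁)
  have hℓ : 0 < Real.log (1 / P.η) := by linarith
  have hAP : 1 ≤ A * Real.log (1 / P.η) := hAη.trans (by gcongr)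
  have hhalf : P.α ≤ 1 / 2 := by
    have : Real.exp (-1) < 1 / 2 := by
      have := Real.exp_neg_one_lt_d9
      linarith
    linarith
  have hA1 : (1 : ℝ) ≤ A := by exact_mod_cast hA
  have hsize : 900 * A * DPKDE.sizeBound d P.α ^ 5 ≤ Real.log (1 / P.α) ^ (C * d) :=
    DPKDE.sizeBound_pow_le hd hlam hLlam hA hk.le (by omega)
  have hsize' : 900 * DPKDE.sizeBound d P.α ^ 5 ≤
      Real.log (1 / P.α) ^ (C * d) * Real.log (1 / P.η) := by
    have hB : 0 ≤ 900 * DPKDE.sizeBound d P.α ^ 5 :=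
      mul_nonneg (by norm_num) (pow_nonneg (zero_le_one.trans (DPKDE.one_le_sizeBound hL)) 5)
    calc 900 * DPKDE.sizeBound d P.α ^ 5
        ≤ 900 * DPKDE.sizeBound d P.α ^ 5 * (A * Real.log (1 / P.η)) :=
          le_mul_of_one_le_right hB hAP
      _ = 900 * A * DPKDE.sizeBound d P.α ^ 5 * Real.log (1 / P.η) := by ring
      _ ≤ _ := by gcongr
  refine ⟨DPKDE.released P, DPKDE.estimate P, fun X _ ω => ?_, DPKDE.isDP_released P hε _,
    fun X hX hn => ?_⟩
  · obtain ⟨t, -, h⟩ := DPKDE.curatorCmd_spec P hα (by linarith) hΦ X ω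
    exact ⟨t, h⟩
  have hlen : 1 ≤ X.length := by
    -- The threshold for the size is positive, which excludes the empty dataset.
    have : (0 : ℝ) < X.length := lt_of_lt_of_le (by positivity) hn
    exact_mod_cast this
  refine ⟨?_, fun ω => ⟨?_, ?_, fun y => ?_⟩⟩
  · refine DPKDE.isApprox_estimate P hd hε hα hhalf hL hη (by linarith) hX (by omega) ?_
    rw [div_le_iff₀ (by positivity)] at hn
    have h := DPKDE.noise_bound hd hL hη hA hAP
    -- The `ε` of the noise scale is moved to the side of `α n`, where the threshold for the size of
    -- the dataset provides it.
    rw [DPKDE.noiseScale, div_mul_eq_mul_div, mul_div_assoc', div_le_iff₀ hε]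
    calc _ ≤ 900 * A * DPKDE.sizeBound d P.α ^ 5 * Real.log (1 / P.η) := h
      _ ≤ Real.log (1 / P.α) ^ (C * d) * Real.log (1 / P.η) := by gcongr
      _ ≤ _ := by linarith
  · obtain ⟨t, ht, h⟩ := DPKDE.curatorCmd_spec P hα (by linarith) hΦ X ω
    refine ⟨t, h, ?_⟩
    have hC1 : (1 : ℝ) ≤ C := by exact_mod_cast (by omega : 1 ≤ C)
    calc (t : ℝ) ≤ DPKDE.curatorTime d X.length P.α P.Φ := by exact_mod_cast ht
      _ ≤ _ := DPKDE.curatorTime_le hd hlen hL hΦ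
      _ ≤ (X.length * d + (P.Φ / Real.sqrt d) ^ d) *
          (Real.log (1 / P.α) ^ (C * d) * Real.log (1 / P.η)) := by gcongr
      _ ≤ (X.length * d + (P.Φ / Real.sqrt d) ^ d) *
          ((C * Real.log (1 / P.α)) ^ (C * d) * Real.log (1 / P.η)) := by
          gcongr
          exact le_mul_of_one_le_left (by linarith) hC1
      _ = _ := by ring
  · exact DPKDE.msgLen_le_of_le hd hL hΦ hA hAP (by omega)
  · obtain ⟨t, ht, h⟩ := DPKDE.clientCmd_spec P hα (by linarith) hΦ (DPKDE.released P X ω) y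
    refine ⟨t, h, ?_⟩
    calc (t : ℝ) ≤ DPKDE.clientTime d P.α := by exact_mod_cast ht
      _ ≤ _ := DPKDE.clientTime_le hd hL
      _ ≤ _ := hsize'
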